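/- Let $n\ge 3$, let $(M,g)$ be a closed (compact, without boundary) smooth $n$-dimensional Riemannian manifold, and write $2^*=\frac{2n}{n-2}$. For a smooth Riemannian metric $h$ on $M$ with scalar curvature $R_h$ and Riemannian measure $dV_h$, let $H^1(M,h)\subset L^2(M,h)$ be the completion of $C^\infty(M)$ in the $H^1$-norm (functions in $L^2$ with weak gradient $\nabla_h u$ in $L^2$), let $$H^1_+(M,h)=\{u\in H^1(M,h):\ u>0 \text{ a.e.}\},$$ and set $$\langle u,v\rangle_h=4\,\frac{n-1}{n-2}\int_M h(\nabla_h u,\nabla_h v)\,dV_h+\int_M R_h\,u\,v\,dV_h .$$ Let $[g]=\{w^{4/(n-2)}g:\ w\in C^\infty(M),\ w>0\}$ be the conformal class of $g$ and $$\mathcal Y(M,[g])=\inf_{u\in H^1_+(M,g)}\frac{\langle u,u\rangle_g}{\|u\|_{L^{2^*}(M,g)}^2}$$ the Yamabe invariant. **Proposition.** Assume $\mathcal Y(M,[g])>0$ and $h\in[g]$. Then for every $u\in H^1_+(M,h)$ the problem of minimizing $\langle v,v\rangle_h$ over all $v\in H^1_+(M,h)$ with $v\ge u$ a.e. has a unique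 solution $T_h(u)\in H^1_+(M,h)$, and the resulting obstacle solution map $T_h:H^1_+(M,h)\to H^1_+(M,h)$ is idempotent: $T_h\circ T_h=T_h$. -/

import Mathlib

open MeasureTheory Filter Topology
open scoped Manifold ContDiff ENNReal

noncomputable section

namespace YamabeObstacle

/-! ### Coordinate expressions on `ℝⁿ` -/

section Coordinates

variable {n : ℕ}

/-- The `i`-th vector of the standard basis of `ℝⁿ`. -/
def stdVec (i : Fin n) : EuclideanSpace ℝ (Fin n) := EuclideanSpace.single i 1

/-- The `i`-th coordinate functional on `ℝⁿ`. -/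
def stdCoord (i : Fin n) : EuclideanSpace ℝ (Fin n) →L[ℝ] ℝ := EuclideanSpace.proj i

/-- The Christoffel symbols of a field `G` of bilinear forms on `ℝⁿ`, as a vector-valued bilinear
expression: `Γ = christoffel G y u v` is the vector with
`G(Γ, w) = (∂_u G(v, w) + ∂_v G(u, w) - ∂_w G(u, v)) / 2` for all `w`
(`(G y).inverse` raises the index). -/
def christoffel
    (G : EuclideanSpace ℝ (Fin n) →
      (EuclideanSpace ℝ (Fin n) →L[ℝ] EuclideanSpace ℝ (Fin n) →L[ℝ] ℝ))
    (y u v : EuclideanSpace ℝ (Fin n)) : EuclideanSpace ℝ (Fin n) :=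
  (G y).inverse ((1 / 2 : ℝ) •
    (fderiv ℝ G y u v + fderiv ℝ G y v u - ((fderiv ℝ G y).flip u).flip v))

/-- The Riemann curvature `R(u, v) w = ∇_u ∇_v w - ∇_v ∇_u w` of `G` at `y`, for constant
vector fields `u`, `v`, `w` on `ℝⁿ`. -/
def coordRiemann
    (G : EuclideanSpace ℝ (Fin n) →
      (EuclideanSpace ℝ (Fin n) →L[ℝ] EuclideanSpace ℝ (Fin n) →L[ℝ] ℝ))
    (y u v w : EuclideanSpace ℝ (Fin n)) : EuclideanSpace ℝ (Fin n) :=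
  fderiv ℝ (fun z => christoffel G z v w) y u - fderiv ℝ (fun z => christoffel G z u w) y v
    + christoffel G y u (christoffel G y v w) - christoffel G y v (christoffel G y u w)

/-- The Ricci curvature `Ric(v, w)`, the trace of `u ↦ R(u, v) w`. -/
def coordRicci
    (G : EuclideanSpace ℝ (Fin n) →
      (EuclideanSpace ℝ (Fin n) →L[ℝ] EuclideanSpace ℝ (Fin n) →L[ℝ] ℝ))
    (y v w : EuclideanSpace ℝ (Fin n)) : ℝ :=
  ∑ i : Fin n, stdCoord i (coordRiemann G y (stdVec i) v w)

/-- The scalar curvature `∑ j k, G^{jk} Ric(e_j, e_k)`; the vector `∑ k, G^{jk} e_k` is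
`(G y).inverse` applied to the `j`-th coordinate functional. -/
def coordScalar
    (G : EuclideanSpace ℝ (Fin n) →
      (EuclideanSpace ℝ (Fin n) →L[ℝ] EuclideanSpace ℝ (Fin n) →L[ℝ] ℝ))
    (y : EuclideanSpace ℝ (Fin n)) : ℝ :=
  ∑ j : Fin n, coordRicci G y (stdVec j) ((G y).inverse (stdCoord j))

end Coordinates

/-! ### Riemannian metrics on a manifold -/

section Riemannian

variable {n : ℕ} {M : Type*} [TopologicalSpace M] [ChartedSpace (EuclideanSpace ℝ (Fin n)) M]
  [IsManifold (𝓡 n) ∞ M]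

variable (n M) in
/-- Smooth Riemannian metrics on the `n`-dimensional smooth manifold `M`. -/
abbrev Metric : Type _ :=
  Bundle.ContMDiffRiemannianMetric (𝓡 n) ∞ (EuclideanSpace ℝ (Fin n))
    (fun x : M => TangentSpace (𝓡 n) x)

/-- The derivative at `y` of the inverse of the preferred chart at `x₀`. -/
def chartFrame (x₀ : M) (y : EuclideanSpace ℝ (Fin n)) :
    EuclideanSpace ℝ (Fin n) →L[ℝ] TangentSpace (𝓡 n) ((extChartAt (𝓡 n) x₀).symm y) :=
  mfderiv 𝓘(ℝ, EuclideanSpace ℝ (Fin n)) (𝓡 n) (extChartAt (𝓡 n) x₀).symm y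

/-- The metric in the preferred chart at `x₀`: its pull-back under the inverse of that chart. -/
def metricInChart (g : Metric n M) (x₀ : M) (y : EuclideanSpace ℝ (Fin n)) :
    EuclideanSpace ℝ (Fin n) →L[ℝ] EuclideanSpace ℝ (Fin n) →L[ℝ] ℝ :=
  ContinuousLinearMap.bilinearComp (E := EuclideanSpace ℝ (Fin n))
    (F := EuclideanSpace ℝ (Fin n)) (g.inner ((extChartAt (𝓡 n) x₀).symm y))
    (chartFrame x₀ y) (chartFrame x₀ y)

/-- The scalar curvature `R_g`, computed at each point in the preferred chart there. -/
def scalarCurvature (g : Metric n M) (x : M) : ℝ :=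
  coordScalar (metricInChart g x) (extChartAt (𝓡 n) x x)

/-- The density `√(det g_ij)` of the Riemannian volume in the preferred chart at `x₀`. -/
def volumeDensity (g : Metric n M) (x₀ : M) (y : EuclideanSpace ℝ (Fin n)) : ℝ :=
  √(Matrix.det (Matrix.of fun i j : Fin n => metricInChart g x₀ y (stdVec i) (stdVec j)))

/-- The measure `√(det g_ij) dy` of the preferred chart at `x₀`, carried over to `M`; it lives on
the domain of that chart. -/
def chartVolume [MeasurableSpace M] (g : Metric n M) (x₀ : M) : Measure M :=
  Measure.map (extChartAt (𝓡 n) x₀).symm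
    ((volume.restrict (extChartAt (𝓡 n) x₀).target).withDensity
      (fun y => ENNReal.ofReal (volumeDensity g x₀ y)))

/-- The Riemannian measure `dV_g`: the least measure dominating all the measures `√(det g_ij) dy`
of the charts. As these agree on overlaps, `dV_g` restricts to each of them on the domain of the
chart. -/
def vol [MeasurableSpace M] (g : Metric n M) : Measure M := ⨆ x₀ : M, chartVolume g x₀

/-- The gradient `∇_g f`, i.e. the vector field with `g(∇_g f, v) = df(v)` for all `v`. -/
def grad (g : Metric n M) (f : M → ℝ) (x : M) : TangentSpace (𝓡 n) x :=
  (g.inner x).inverse (mvfderiv (𝓡 n) f x)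

/-- The conformal class `[g] = {w^{4/(n-2)} g : w smooth and positive}`. -/
def conformalClass (g : Metric n M) : Set (Metric n M) :=
  {h | ∃ w : M → ℝ, ContMDiff (𝓡 n) 𝓘(ℝ, ℝ) ∞ w ∧ (∀ x, 0 < w x) ∧
    ∀ (x : M) (a b : TangentSpace (𝓡 n) x),
      h.inner x a b = (w x) ^ (4 / ((n : ℝ) - 2)) * g.inner x a b}

/-! ### The Sobolev space `H¹(M, g)` -/

variable [MeasurableSpace M]

/-- `X` is the weak gradient of `u`: there are smooth functions `f k` with `f k → u` in `L²` and
`∇_g (f k) → X` in `L²`. This describes the elements `u` of the completion of the smooth functions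
in the `H¹`-norm, together with their gradients. -/
def IsWeakGrad (g : Metric n M) (u : M → ℝ) (X : ∀ x : M, TangentSpace (𝓡 n) x) : Prop :=
  ∃ f : ℕ → M → ℝ,
    (∀ k, ContMDiff (𝓡 n) 𝓘(ℝ, ℝ) ∞ (f k)) ∧
    Tendsto (fun k => eLpNorm (fun x => f k x - u x) 2 (vol g)) atTop (𝓝 0) ∧
    (∀ k, AEMeasurable
      (fun x => g.inner x (grad g (f k) x - X x) (grad g (f k) x - X x)) (vol g)) ∧
    Tendsto (fun k => ∫⁻ x, ENNReal.ofReal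
      (g.inner x (grad g (f k) x - X x) (grad g (f k) x - X x)) ∂(vol g)) atTop (𝓝 0)

/-- The Sobolev space `H¹(M, g)`, as a set of (classes of) square integrable functions. -/
def H1 (g : Metric n M) : Set (Lp ℝ 2 (vol g)) := {u | ∃ X, IsWeakGrad g u X}

open Classical in
/-- The weak gradient of `u` (zero if there is none); it is unique almost everywhere. -/
def weakGrad (g : Metric n M) (u : M → ℝ) : ∀ x : M, TangentSpace (𝓡 n) x :=
  if hu : ∃ X, IsWeakGrad g u X then hu.choose else fun _ => 0

/-- `H¹₊(M, g)`, the functions in `H¹(M, g)` that are positive (almost everywhere). It carries the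
almost everywhere order `u ≤ v` of `L²`. -/
def H1Plus (g : Metric n M) : Set (Lp ℝ 2 (vol g)) := {u | u ∈ H1 g ∧ ∀ᵐ x ∂(vol g), 0 < u x}

/-- The form `⟨u, v⟩_g = 4 (n-1)/(n-2) ∫ g(∇u, ∇v) dV_g + ∫ R_g u v dV_g`. -/
def form (g : Metric n M) (u v : M → ℝ) : ℝ :=
  4 * (((n : ℝ) - 1) / ((n : ℝ) - 2)) *
      ∫ x, g.inner x (weakGrad g u x) (weakGrad g v x) ∂(vol g)
    + ∫ x, scalarCurvature g x * u x * v x ∂(vol g)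

/-! ### The Yamabe invariant and the obstacle problem -/

/-- The Yamabe functional `⟨u, u⟩_g / ‖u‖²` with the norm of `L^{2n/(n-2)}(M, g)`. -/
def yamabeFunctional (g : Metric n M) (u : H1Plus g) : ℝ :=
  form g u.1 u.1 /
    (eLpNorm u.1 (ENNReal.ofReal (2 * (n : ℝ) / ((n : ℝ) - 2))) (vol g)).toReal ^ 2

/-- The Yamabe invariant, the infimum of the Yamabe functional over `H¹₊(M, g)`. -/
def yamabeInvariant (g : Metric n M) : ℝ := ⨅ u : H1Plus g, yamabeFunctional g u

/-- `v` minimizes `⟨v, v⟩_h` among the elements of `H¹₊(M, h)` that lie above the obstacle `u`. -/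
def IsObstacleSolution (h : Metric n M) (u v : H1Plus h) : Prop :=
  u ≤ v ∧ ∀ v' : H1Plus h, u ≤ v' → form h v.1 v.1 ≤ form h v'.1 v'.1

open Classical in
/-- The obstacle solution map `T_h`: it sends `u` to the solution of the obstacle problem with
obstacle `u` (with a default value if there were no solution). -/
def stateMap (h : Metric n M) (u : H1Plus h) : H1Plus h :=
  if hu : ∃ v, IsObstacleSolution h u v then hu.choose else u

end Riemannian

end YamabeObstacle

end

/-! A positive Yamabe invariant makes ⟨·,·⟩_h the square of a Hilbert norm equivalent to the
H¹-norm, and the functions v ≥ u form a closed convex set. The minimizer is the point of this set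
nearest to 0, so it exists and is unique. It is positive because it lies above u > 0, so minimizing
over all of H¹ instead of H¹₊ changes nothing. Idempotence is then formal: T(u) is admissible for
the obstacle T(u), every competitor above T(u) is also above u, hence T(u) solves its own obstacle
problem, and uniqueness concludes.

Coercivity: for smooth f > 0 the invariant bounds ⟨f,f⟩_g below by a multiple of the squared
L^{2*}-norm, hence of the squared L²-norm, since the volume is finite and 2* ≥ 2. Replacing f by
√(f² + δ) and letting δ → 0 removes the sign condition (`exists_le_smoothForm`). The conformal law
of the scalar curvature and Green's formula give ⟨f,f⟩_h = ⟨wf,wf⟩_g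
(`IsConformalFactor.smoothForm_eq`), which carries the bound from g to h. As the scalar curvature is
bounded, the form is then equivalent to the squared H¹-norm on smooth functions
(`IsConformalFactor.exists_energy_le`).

From smooth functions to H¹: the weak gradient is an arbitrary choice of an L²-limit of gradients.
That ⟨u,u⟩ is nevertheless the limit of ⟨f_k,f_k⟩ along every approximating sequence is the
closability of the Dirichlet energy (`IsApprox.tendsto_energy_zero`), an integration by parts.
Conversely, a sequence that converges in L² and is Cauchy for the energy produces a weak gradient
(`IsApprox.exists_isWeakGrad`). So H¹ is the image in L² of the completion of the smooth functions
for the form, and the Hilbert space argument `exists_unique_minimizer` applies.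

The geometry underneath is done in coordinates. Since curvature and measure are given through
preferred charts, their independence of the chart has to be established: by the transformation rules
under pull-back for the curvature (`IsPullback.scalar_eq`), by change of variables for the measure
(`vol_apply_of_subset_source`). -/

noncomputable section
set_option maxSynthPendingDepth 3
namespace YamabeObstacle

/-! ### Positive definite symmetric bilinear forms -/

section InnerForm

variable {V : Type*} [AddCommGroup V] [Module ℝ V] [TopologicalSpace V]

/-- A positive definite symmetric bilinear form. -/
structure IsInnerForm [IsTopologicalAddGroup V] [ContinuousSMul ℝ V] (b : V →L[ℝ] V →L[ℝ] ℝ) :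
    Prop where
  symm : ∀ v w, b v w = b w v
  pos : ∀ v, v ≠ 0 → 0 < b v v

variable [IsTopologicalAddGroup V] [ContinuousSMul ℝ V] {b : V →L[ℝ] V →L[ℝ] ℝ}

namespace IsInnerForm

theorem nonneg (hb : IsInnerForm b) (v : V) : 0 ≤ b v v := by
  by_cases h : v = 0
  · simp [h]
  · exact (hb.pos v h).le

theorem eq_zero (hb : IsInnerForm b) {v : V} (h : b v v = 0) : v = 0 := by
  by_contra hv
  exact (hb.pos v hv).ne' h

/-- Nondegeneracy. The identities between vectors below, such as the laws for Christoffel symbols,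
are checked by pairing both sides with the metric. -/
theorem ext_left (hb : IsInnerForm b) {v w : V} (h : ∀ x, b v x = b w x) : v = w := by
  rw [← sub_eq_zero]
  apply hb.eq_zero
  have := h (v - w)
  simp only [map_sub, sub_apply] at this ⊢
  linarith

theorem smul (hb : IsInnerForm b) {c : ℝ} (hc : 0 < c) : IsInnerForm (c • b) where
  symm v w := by simp [hb.symm v w]
  pos v hv := by simpa using mul_pos hc (hb.pos v hv)

/-- Lowering an index is injective by definiteness, and a space has the dimension of its dual.
Without invertibility `inverse` would be the default value 0. -/
theorem isInvertible [T2Space V] [FiniteDimensional ℝ V] (hb : IsInnerForm b) :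
    b.IsInvertible := by
  have hker : LinearMap.ker (b : V →ₗ[ℝ] V →L[ℝ] ℝ) = ⊥ := by
    rw [LinearMap.ker_eq_bot']
    intro v hv
    apply hb.eq_zero
    have : b v = 0 := hv
    rw [this]; rfl
  have hdim : Module.finrank ℝ V = Module.finrank ℝ (V →L[ℝ] ℝ) := by
    rw [← (LinearMap.toContinuousLinearMap : (V →ₗ[ℝ] ℝ) ≃ₗ[ℝ] V →L[ℝ] ℝ).finrank_eq]
    exact (Subspace.dual_finrank_eq (K := ℝ) (V := V)).symm
  let e : V ≃ₗ[ℝ] V →L[ℝ] ℝ := LinearEquiv.ofInjectiveOfFinrankEq (b : V →ₗ[ℝ] V →L[ℝ] ℝ)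
    (LinearMap.ker_eq_bot.1 hker) hdim
  refine ⟨e.toContinuousLinearEquiv, ?_⟩
  ext v w
  rfl

variable [T2Space V] [FiniteDimensional ℝ V]

theorem apply_inverse (hb : IsInnerForm b) (α : V →L[ℝ] ℝ) (v : V) : b (b.inverse α) v = α v := by
  rw [hb.isInvertible.self_apply_inverse]

theorem apply_inverse_right (hb : IsInnerForm b) (α : V →L[ℝ] ℝ) (v : V) :
    b v (b.inverse α) = α v := by
  rw [hb.symm, hb.apply_inverse]

theorem inverse_symm (hb : IsInnerForm b) (α β : V →L[ℝ] ℝ) :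
    α (b.inverse β) = β (b.inverse α) := by
  rw [← hb.apply_inverse α, hb.symm, hb.apply_inverse]

theorem inverse_unique (hb : IsInnerForm b) {α : V →L[ℝ] ℝ} {v : V} (h : ∀ w, b v w = α w) :
    b.inverse α = v :=
  hb.ext_left fun w => by rw [hb.apply_inverse, h]

theorem inverse_smul (hb : IsInnerForm b) {c : ℝ} (hc : 0 < c) (α : V →L[ℝ] ℝ) :
    (c • b).inverse α = c⁻¹ • b.inverse α := by
  apply (hb.smul hc).inverse_unique
  intro w
  simp [hb.apply_inverse, hc.ne']

end IsInnerForm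

end InnerForm

/-! ### Contraction -/

section Contraction

variable {E ι : Type*} [NormedAddCommGroup E] [NormedSpace ℝ E] [Fintype ι]

/-- `e` and `ε` are dual bases, in the sense that `v = ∑ ε i v • e i`. -/
def IsDualPair (e : ι → E) (ε : ι → E →L[ℝ] ℝ) : Prop := ∀ v, ∑ i, ε i v • e i = v

variable {e : ι → E} {ε : ι → E →L[ℝ] ℝ}

namespace IsDualPair

theorem sum_apply_mul (he : IsDualPair e ε) (α : E →L[ℝ] ℝ) (v : E) :
    ∑ i, α (e i) * ε i v = α v := by
  conv_rhs => rw [← he v]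
  simp [mul_comm]

/-- A contraction over dual bases does not depend on the basis. -/
theorem sum_map_equiv (he : IsDualPair e ε) (β : E →ₗ[ℝ] (E →L[ℝ] ℝ) →ₗ[ℝ] ℝ) (Φ : E ≃L[ℝ] E) :
    ∑ j, β (Φ (e j)) (ε j ∘L (Φ.symm : E →L[ℝ] E)) = ∑ j, β (e j) (ε j) := by
  have h1 : ∀ j, β (Φ (e j)) (ε j ∘L (Φ.symm : E →L[ℝ] E)) =
      ∑ k, β (e k) (ε k (Φ (e j)) • (ε j ∘L (Φ.symm : E →L[ℝ] E))) := by
    intro j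
    conv_lhs => rw [← he (Φ (e j))]
    simp
  simp_rw [h1]
  -- After the exchange the inner sum is `∑ j, ε k (Φ (e j)) • ε j ∘ Φ⁻¹`, which is `ε k`.
  rw [Finset.sum_comm]
  refine Finset.sum_congr rfl fun k _ => ?_
  rw [← map_sum]
  congr 1
  ext v
  have := he.sum_apply_mul ((ε k ∘L (Φ : E →L[ℝ] E))) (Φ.symm v)
  simpa using this

end IsDualPair

end Contraction

/-! ### Derivatives of bilinear expressions -/

section Derivatives

variable {E F₁ F₂ F₃ : Type*} [NormedAddCommGroup E] [NormedSpace ℝ E]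
  [NormedAddCommGroup F₁] [NormedSpace ℝ F₁] [NormedAddCommGroup F₂] [NormedSpace ℝ F₂]
  [NormedAddCommGroup F₃] [NormedSpace ℝ F₃] {y : E}

theorem fderiv_clm_apply_apply {L : E → F₁ →L[ℝ] F₂} {a : E → F₁} (hL : DifferentiableAt ℝ L y)
    (ha : DifferentiableAt ℝ a y) (x : E) :
    fderiv ℝ (fun z => L z (a z)) y x = fderiv ℝ L y x (a y) + L y (fderiv ℝ a y x) := by
  rw [fderiv_clm_apply hL ha]
  simp [add_comm]

theorem fderiv_clm_apply₂_apply {B : E → F₁ →L[ℝ] F₂ →L[ℝ] F₃} {a : E → F₁} {b : E → F₂}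
    (hB : DifferentiableAt ℝ B y) (ha : DifferentiableAt ℝ a y) (hb : DifferentiableAt ℝ b y)
    (x : E) :
    fderiv ℝ (fun z => B z (a z) (b z)) y x =
      fderiv ℝ B y x (a y) (b y) + B y (fderiv ℝ a y x) (b y) + B y (a y) (fderiv ℝ b y x) := by
  rw [fderiv_clm_apply_apply (hB.clm_apply ha) hb, fderiv_clm_apply_apply hB ha]
  simp

theorem fderiv_clm_apply_const_apply {L : E → F₁ →L[ℝ] F₂} (hL : DifferentiableAt ℝ L y) (a : F₁)
    (x : E) : fderiv ℝ (fun z => L z a) y x = fderiv ℝ L y x a := by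
  rw [fderiv_clm_apply_apply hL (differentiableAt_const a)]
  simp

theorem fderiv_clm_apply₂_const_apply {B : E → F₁ →L[ℝ] F₂ →L[ℝ] F₃}
    (hB : DifferentiableAt ℝ B y) (a : F₁) (b : F₂) (x : E) :
    fderiv ℝ (fun z => B z a b) y x = fderiv ℝ B y x a b := by
  rw [fderiv_clm_apply₂_apply hB (differentiableAt_const a) (differentiableAt_const b)]
  simp

end Derivatives

/-! ### Metrics on open subsets of a vector space -/

section CoordMetric

variable {E : Type*} [NormedAddCommGroup E] [NormedSpace ℝ E]

/-- `G` is a smooth Riemannian metric on the open set `Ω`. -/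
structure IsCoordMetric (G : E → E →L[ℝ] E →L[ℝ] ℝ) (Ω : Set E) : Prop where
  isOpen : IsOpen Ω
  smooth : ContDiffOn ℝ ∞ G Ω
  inner : ∀ y ∈ Ω, IsInnerForm (G y)

variable (E) in
/-- The lowered Christoffel symbols as a linear function of the derivative of the metric. -/
def koszul : (E →L[ℝ] E →L[ℝ] E →L[ℝ] ℝ) →L[ℝ] (E →L[ℝ] E →L[ℝ] E →L[ℝ] ℝ) :=
  (1 / 2 : ℝ) • (ContinuousLinearMap.id ℝ (E →L[ℝ] E →L[ℝ] E →L[ℝ] ℝ)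
    + (ContinuousLinearMap.flipₗᵢ ℝ E E (E →L[ℝ] ℝ)).toContinuousLinearEquiv.toContinuousLinearMap
    - (ContinuousLinearMap.compL ℝ E (E →L[ℝ] E →L[ℝ] ℝ) (E →L[ℝ] E →L[ℝ] ℝ)
        (ContinuousLinearMap.flipₗᵢ ℝ E E ℝ).toContinuousLinearEquiv.toContinuousLinearMap) ∘L
      (ContinuousLinearMap.flipₗᵢ ℝ E E (E →L[ℝ] ℝ)).toContinuousLinearEquiv.toContinuousLinearMap)

theorem koszul_apply (D : E →L[ℝ] E →L[ℝ] E →L[ℝ] ℝ) (u v : E) :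
    koszul E D u v = (1 / 2 : ℝ) • (D u v + D v u - (D.flip u).flip v) := by
  ext w
  simp [koszul]

/-- The Christoffel symbols as a continuous bilinear map. -/
def christoffelL (G : E → E →L[ℝ] E →L[ℝ] ℝ) (y : E) : E →L[ℝ] E →L[ℝ] E :=
  (ContinuousLinearMap.compL ℝ E (E →L[ℝ] ℝ) E (G y).inverse) ∘L koszul E (fderiv ℝ G y)

theorem christoffelL_apply (G : E → E →L[ℝ] E →L[ℝ] ℝ) (y u v : E) :
    christoffelL G y u v = (G y).inverse ((1 / 2 : ℝ) •
      (fderiv ℝ G y u v + fderiv ℝ G y v u - ((fderiv ℝ G y).flip u).flip v)) := by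
  simp [christoffelL, koszul_apply]

/-- The Riemann curvature, as a trilinear expression. -/
def riemann (G : E → E →L[ℝ] E →L[ℝ] ℝ) (y u v w : E) : E :=
  fderiv ℝ (christoffelL G) y u v w - fderiv ℝ (christoffelL G) y v u w
    + christoffelL G y u (christoffelL G y v w) - christoffelL G y v (christoffelL G y u w)

namespace IsCoordMetric

variable {G : E → E →L[ℝ] E →L[ℝ] ℝ} {Ω : Set E} {y : E}

theorem contDiffAt (hG : IsCoordMetric G Ω) (hy : y ∈ Ω) : ContDiffAt ℝ ∞ G y :=
  hG.smooth.contDiffAt (hG.isOpen.mem_nhds hy)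

theorem differentiableAt (hG : IsCoordMetric G Ω) (hy : y ∈ Ω) : DifferentiableAt ℝ G y :=
  (hG.contDiffAt hy).differentiableAt (by simp)

variable [FiniteDimensional ℝ E]

theorem contDiffAt_inverse (hG : IsCoordMetric G Ω) (hy : y ∈ Ω) :
    ContDiffAt ℝ ∞ (fun z => (G z).inverse) y :=
  (hG.inner y hy).isInvertible.contDiffAt_map_inverse.comp y (hG.contDiffAt hy)

/-- Bundled as a bilinear map, the Christoffel symbols are a composition of fixed continuous linear
maps with the smooth functions `(G z).inverse` and `fderiv ℝ G`. -/
theorem contDiffAt_christoffelL (hG : IsCoordMetric G Ω) (hy : y ∈ Ω) :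
    ContDiffAt ℝ ∞ (christoffelL G) y := by
  unfold christoffelL
  have h1 : ContDiffAt ℝ ∞ (fderiv ℝ G) y := (hG.contDiffAt hy).fderiv_right (by simp)
  exact ((ContinuousLinearMap.contDiff _).contDiffAt.comp y (hG.contDiffAt_inverse hy)).clm_comp
    ((ContinuousLinearMap.contDiff _).contDiffAt.comp y h1)

theorem differentiableAt_christoffelL (hG : IsCoordMetric G Ω) (hy : y ∈ Ω) :
    DifferentiableAt ℝ (christoffelL G) y :=
  (hG.contDiffAt_christoffelL hy).differentiableAt (by simp)

omit [FiniteDimensional ℝ E] in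
theorem fderiv_symm (hG : IsCoordMetric G Ω) (hy : y ∈ Ω) (u v w : E) :
    fderiv ℝ G y u v w = fderiv ℝ G y u w v := by
  have h3 : (fun z => G z v w) =ᶠ[𝓝 y] fun z => G z w v := by
    filter_upwards [hG.isOpen.mem_nhds hy] with z hz
    exact (hG.inner z hz).symm v w
  rw [← fderiv_clm_apply₂_const_apply (hG.differentiableAt hy),
    ← fderiv_clm_apply₂_const_apply (hG.differentiableAt hy), h3.fderiv_eq]

/-- The Koszul formula: lowering the index cancels the inverse in the definition. -/
theorem apply_christoffelL (hG : IsCoordMetric G Ω) (hy : y ∈ Ω) (u v w : E) :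
    G y (christoffelL G y u v) w = (1 / 2 : ℝ) *
      (fderiv ℝ G y u v w + fderiv ℝ G y v u w - fderiv ℝ G y w u v) := by
  rw [christoffelL_apply, (hG.inner y hy).apply_inverse]
  simp

/-- The connection is torsion free, because the Koszul expression is symmetric in `u` and `v`. -/
theorem christoffelL_symm (hG : IsCoordMetric G Ω) (hy : y ∈ Ω) (u v : E) :
    christoffelL G y u v = christoffelL G y v u := by
  apply (hG.inner y hy).ext_left
  intro w
  rw [hG.apply_christoffelL hy, hG.apply_christoffelL hy, hG.fderiv_symm hy w u v]
  ring

/-- The Levi-Civita connection is compatible with the metric. -/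
theorem fderiv_eq (hG : IsCoordMetric G Ω) (hy : y ∈ Ω) (u v w : E) :
    fderiv ℝ G y u v w =
      G y (christoffelL G y u v) w + G y v (christoffelL G y u w) := by
  rw [(hG.inner y hy).symm v, hG.apply_christoffelL hy, hG.apply_christoffelL hy,
    hG.fderiv_symm hy w u v, hG.fderiv_symm hy u w v, hG.fderiv_symm hy v u w]
  ring

end IsCoordMetric

end CoordMetric

theorem two_le_infty : (2 : ℕ∞ω) ≤ (∞ : ℕ∞ω) := by
  exact WithTop.coe_le_coe.2 (le_top : (2 : ℕ∞) ≤ ⊤)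

/-! ### Covariance of the curvature -/

section Curvature

variable {E ι : Type*} [NormedAddCommGroup E] [NormedSpace ℝ E] [Fintype ι]

/-- The Ricci curvature, computed with dual bases `e`, `ε`. -/
def ricci (e : ι → E) (ε : ι → E →L[ℝ] ℝ) (G : E → E →L[ℝ] E →L[ℝ] ℝ) (y v w : E) : ℝ :=
  ∑ i, ε i (riemann G y (e i) v w)

/-- The scalar curvature, computed with dual bases `e`, `ε`. -/
def scalar (e : ι → E) (ε : ι → E →L[ℝ] ℝ) (G : E → E →L[ℝ] E →L[ℝ] ℝ) (y : E) : ℝ :=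
  ∑ j, ricci e ε G y (e j) ((G y).inverse (ε j))

/-- Linearity in each slot lets the traces of the curvature be treated as contractions of bilinear
maps, to which `IsDualPair.sum_map_equiv` applies. -/
theorem riemann_add_left (G : E → E →L[ℝ] E →L[ℝ] ℝ) (y u u' v w : E) :
    riemann G y (u + u') v w = riemann G y u v w + riemann G y u' v w := by
  simp only [riemann, map_add, add_apply]
  abel

theorem riemann_smul_left (G : E → E →L[ℝ] E →L[ℝ] ℝ) (y : E) (c : ℝ) (u v w : E) :
    riemann G y (c • u) v w = c • riemann G y u v w := by
  simp only [riemann, map_smul, smul_apply, smul_add, smul_sub]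

theorem riemann_add_middle (G : E → E →L[ℝ] E →L[ℝ] ℝ) (y u v v' w : E) :
    riemann G y u (v + v') w = riemann G y u v w + riemann G y u v' w := by
  simp only [riemann, map_add, add_apply]
  abel

theorem riemann_smul_middle (G : E → E →L[ℝ] E →L[ℝ] ℝ) (y : E) (c : ℝ) (u v w : E) :
    riemann G y u (c • v) w = c • riemann G y u v w := by
  simp only [riemann, map_smul, smul_apply, smul_add, smul_sub]

theorem riemann_add_right (G : E → E →L[ℝ] E →L[ℝ] ℝ) (y u v w w' : E) :
    riemann G y u v (w + w') = riemann G y u v w + riemann G y u v w' := by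
  simp only [riemann, map_add]
  abel

theorem riemann_smul_right (G : E → E →L[ℝ] E →L[ℝ] ℝ) (y : E) (c : ℝ) (u v w : E) :
    riemann G y u v (c • w) = c • riemann G y u v w := by
  simp only [riemann, map_smul, smul_add, smul_sub]

/-- The metric `G'` on `Ω'` is the pull-back of the metric `G` on `Ω` under `φ`. -/
structure IsPullback (φ : E → E) (G' : E → E →L[ℝ] E →L[ℝ] ℝ) (Ω' : Set E)
    (G : E → E →L[ℝ] E →L[ℝ] ℝ) (Ω : Set E) : Prop where
  mapsTo : Set.MapsTo φ Ω' Ω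
  smooth : ContDiffOn ℝ ∞ φ Ω'
  apply_eq : ∀ y ∈ Ω', ∀ u v, G' y u v = G (φ y) (fderiv ℝ φ y u) (fderiv ℝ φ y v)

variable {G G' : E → E →L[ℝ] E →L[ℝ] ℝ} {Ω Ω' : Set E} {φ : E → E} {y : E}

/-- A vector killed by the derivative of `φ` has length zero for `G'`. So the derivative is
injective, hence bijective, without assuming that `φ` is a diffeomorphism. -/
theorem IsPullback.exists_equiv [FiniteDimensional ℝ E] (h : IsPullback φ G' Ω' G Ω)
    (hG' : IsCoordMetric G' Ω') (hy : y ∈ Ω') :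
    ∃ Φ : E ≃L[ℝ] E, (Φ : E →L[ℝ] E) = fderiv ℝ φ y := by
  have hker : LinearMap.ker (fderiv ℝ φ y : E →ₗ[ℝ] E) = ⊥ := by
    rw [LinearMap.ker_eq_bot']
    intro v hv
    have hv' : fderiv ℝ φ y v = 0 := hv
    apply (hG'.inner y hy).eq_zero
    rw [h.apply_eq y hy, hv']
    simp
  refine ⟨(LinearEquiv.ofInjectiveEndo (fderiv ℝ φ y : E →ₗ[ℝ] E)
    (LinearMap.ker_eq_bot.1 hker)).toContinuousLinearEquiv, ?_⟩
  ext v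
  rfl

theorem IsPullback.contDiffAt (h : IsPullback φ G' Ω' G Ω) (hG' : IsCoordMetric G' Ω')
    (hy : y ∈ Ω') : ContDiffAt ℝ ∞ φ y :=
  h.smooth.contDiffAt (hG'.isOpen.mem_nhds hy)

theorem IsPullback.contDiffAt_fderiv (h : IsPullback φ G' Ω' G Ω) (hG' : IsCoordMetric G' Ω')
    (hy : y ∈ Ω') : ContDiffAt ℝ ∞ (fderiv ℝ φ) y :=
  (h.contDiffAt hG' hy).fderiv_right (by simp)

/-- Product and chain rule. The two terms with second derivatives of `φ` are the source of the
inhomogeneous term in the law for the Christoffel symbols. -/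
theorem IsPullback.fderiv_apply (h : IsPullback φ G' Ω' G Ω) (hG' : IsCoordMetric G' Ω')
    (hG : IsCoordMetric G Ω) (hy : y ∈ Ω') (u v w : E) :
    fderiv ℝ G' y u v w =
      fderiv ℝ G (φ y) (fderiv ℝ φ y u) (fderiv ℝ φ y v) (fderiv ℝ φ y w)
      + G (φ y) (fderiv ℝ (fderiv ℝ φ) y u v) (fderiv ℝ φ y w)
      + G (φ y) (fderiv ℝ φ y v) (fderiv ℝ (fderiv ℝ φ) y u w) := by
  have hφ : DifferentiableAt ℝ φ y := (h.contDiffAt hG' hy).differentiableAt (by simp)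
  have hJ : DifferentiableAt ℝ (fderiv ℝ φ) y :=
    (h.contDiffAt_fderiv hG' hy).differentiableAt (by simp)
  have hGd : DifferentiableAt ℝ G (φ y) := hG.differentiableAt (h.mapsTo hy)
  have heq : (fun z => G' z v w) =ᶠ[𝓝 y]
      fun z => (G ∘ φ) z (fderiv ℝ φ z v) (fderiv ℝ φ z w) := by
    filter_upwards [hG'.isOpen.mem_nhds hy] with z hz
    exact h.apply_eq z hz v w
  rw [← fderiv_clm_apply₂_const_apply (hG'.differentiableAt hy), heq.fderiv_eq,
    fderiv_clm_apply₂_apply (hGd.comp y hφ) (hJ.clm_apply (differentiableAt_const v))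
      (hJ.clm_apply (differentiableAt_const w)),
    fderiv_clm_apply_const_apply hJ, fderiv_clm_apply_const_apply hJ, fderiv_comp y hGd hφ]
  rfl

theorem IsPullback.fderiv_fderiv_symm (h : IsPullback φ G' Ω' G Ω) (hG' : IsCoordMetric G' Ω')
    (hy : y ∈ Ω') (u v : E) :
    fderiv ℝ (fderiv ℝ φ) y u v = fderiv ℝ (fderiv ℝ φ) y v u :=
  ((h.contDiffAt hG' hy).isSymmSndFDerivAt (by simp [minSmoothness_of_isRCLikeNormedField, two_le_infty])) u v

variable [FiniteDimensional ℝ E]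

/-- The transformation rule of the Christoffel symbols. -/
theorem IsPullback.christoffelL_eq (h : IsPullback φ G' Ω' G Ω) (hG' : IsCoordMetric G' Ω')
    (hG : IsCoordMetric G Ω) (hy : y ∈ Ω') (u v : E) :
    fderiv ℝ φ y (christoffelL G' y u v) =
      christoffelL G (φ y) (fderiv ℝ φ y u) (fderiv ℝ φ y v) + fderiv ℝ (fderiv ℝ φ) y u v := by
  obtain ⟨Φ, hΦ⟩ := h.exists_equiv hG' hy
  have hi := hG.inner _ (h.mapsTo hy)
  apply hi.ext_left
  intro x
  obtain ⟨w, rfl⟩ : ∃ w, fderiv ℝ φ y w = x := by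
    rw [← hΦ]; exact Φ.surjective x
  -- The Koszul formula contains six second-derivative terms of `φ`. By symmetry four of them cancel
  -- and the other two combine to the asserted one.
  rw [← h.apply_eq y hy, hG'.apply_christoffelL hy, map_add, add_apply,
    hG.apply_christoffelL (h.mapsTo hy), h.fderiv_apply hG' hG hy, h.fderiv_apply hG' hG hy,
    h.fderiv_apply hG' hG hy, h.fderiv_fderiv_symm hG' hy v u, h.fderiv_fderiv_symm hG' hy w u,
    h.fderiv_fderiv_symm hG' hy w v, hi.symm (fderiv ℝ φ y v), hi.symm (fderiv ℝ φ y u)]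
  ring

/-- The Riemann curvature is a tensor. -/
theorem IsPullback.riemann_eq (h : IsPullback φ G' Ω' G Ω) (hG' : IsCoordMetric G' Ω')
    (hG : IsCoordMetric G Ω) (hy : y ∈ Ω') (u v w : E) :
    fderiv ℝ φ y (riemann G' y u v w) =
      riemann G (φ y) (fderiv ℝ φ y u) (fderiv ℝ φ y v) (fderiv ℝ φ y w) := by
  have hφ : DifferentiableAt ℝ φ y := (h.contDiffAt hG' hy).differentiableAt (by simp)
  have hJc := h.contDiffAt_fderiv hG' hy
  have hJ : DifferentiableAt ℝ (fderiv ℝ φ) y := hJc.differentiableAt (by simp)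
  have hJ' : DifferentiableAt ℝ (fderiv ℝ (fderiv ℝ φ)) y :=
    ((hJc.fderiv_right (m := ∞) (by simp)).differentiableAt (by simp))
  have hΓ : DifferentiableAt ℝ (christoffelL G) (φ y) :=
    hG.differentiableAt_christoffelL (h.mapsTo hy)
  have hΓ' : DifferentiableAt ℝ (christoffelL G') y := hG'.differentiableAt_christoffelL hy
  -- The derivative in the direction `a` of the transformation rule of the Christoffel symbols.
  have key : ∀ a b c : E,
      fderiv ℝ (fderiv ℝ φ) y a (christoffelL G' y b c)
        + fderiv ℝ φ y (fderiv ℝ (christoffelL G') y a b c) =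
      fderiv ℝ (christoffelL G) (φ y) (fderiv ℝ φ y a) (fderiv ℝ φ y b) (fderiv ℝ φ y c)
      + christoffelL G (φ y) (fderiv ℝ (fderiv ℝ φ) y a b) (fderiv ℝ φ y c)
      + christoffelL G (φ y) (fderiv ℝ φ y b) (fderiv ℝ (fderiv ℝ φ) y a c)
      + fderiv ℝ (fderiv ℝ (fderiv ℝ φ)) y a b c := by
    intro a b c
    have heq : (fun z => fderiv ℝ φ z (christoffelL G' z b c)) =ᶠ[𝓝 y]
        (fun z => (christoffelL G ∘ φ) z (fderiv ℝ φ z b) (fderiv ℝ φ z c))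
          + fun z => fderiv ℝ (fderiv ℝ φ) z b c := by
      filter_upwards [hG'.isOpen.mem_nhds hy] with z hz
      exact h.christoffelL_eq hG' hG hz b c
    have hb := hJ.clm_apply (differentiableAt_const b)
    have hc := hJ.clm_apply (differentiableAt_const c)
    have hΓφ := hΓ.comp y hφ
    have h1 := fderiv_clm_apply_apply hJ ((hΓ'.clm_apply (differentiableAt_const b)).clm_apply
      (differentiableAt_const c)) a
    rw [heq.fderiv_eq, fderiv_clm_apply₂_const_apply hΓ',
      fderiv_add ((hΓφ.clm_apply hb).clm_apply hc) ((hJ'.clm_apply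
        (differentiableAt_const b)).clm_apply (differentiableAt_const c)),
      add_apply, fderiv_clm_apply₂_const_apply hJ', fderiv_clm_apply₂_apply hΓφ hb hc,
      fderiv_clm_apply_const_apply hJ, fderiv_clm_apply_const_apply hJ, fderiv_comp y hΓ hφ] at h1
    exact h1.symm
  -- The third derivatives of `φ` are symmetric, so they drop out of the expression antisymmetrized
  -- in `u` and `v`; the remaining second derivatives cancel through the quadratic terms.
  have hsymm : fderiv ℝ (fderiv ℝ (fderiv ℝ φ)) y u v w =
      fderiv ℝ (fderiv ℝ (fderiv ℝ φ)) y v u w := by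
    rw [(hJc.isSymmSndFDerivAt (by simp [minSmoothness_of_isRCLikeNormedField, two_le_infty])) u v]
  have k1 := key u v w
  have k2 := key v u w
  have e1 : fderiv ℝ φ y (fderiv ℝ (christoffelL G') y u v w) = _ := eq_sub_of_add_eq' k1
  have e2 : fderiv ℝ φ y (fderiv ℝ (christoffelL G') y v u w) = _ := eq_sub_of_add_eq' k2
  simp only [riemann, map_add, map_sub, e1, e2, h.christoffelL_eq hG' hG hy]
  rw [hsymm, h.fderiv_fderiv_symm hG' hy v u]
  abel

variable {e : ι → E} {ε : ι → E →L[ℝ] ℝ}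

/-- Since the Riemann curvature is a tensor, pulling back amounts to contracting over the image of
the dual bases under the derivative of `φ`, and a contraction does not see the basis. -/
theorem IsPullback.ricci_eq (he : IsDualPair e ε) (h : IsPullback φ G' Ω' G Ω)
    (hG' : IsCoordMetric G' Ω') (hG : IsCoordMetric G Ω) (hy : y ∈ Ω') (v w : E) :
    ricci e ε G' y v w = ricci e ε G (φ y) (fderiv ℝ φ y v) (fderiv ℝ φ y w) := by
  obtain ⟨Φ, hΦ⟩ := h.exists_equiv hG' hy
  let β : E →ₗ[ℝ] (E →L[ℝ] ℝ) →ₗ[ℝ] ℝ := LinearMap.mk₂ ℝ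
    (fun x α => α (riemann G (φ y) x (fderiv ℝ φ y v) (fderiv ℝ φ y w)))
    (fun x x' α => by simp [riemann_add_left]) (fun c x α => by simp [riemann_smul_left])
    (fun x α α' => by simp) (fun c x α => by simp)
  have := he.sum_map_equiv β Φ
  rw [ricci, ricci]
  refine Eq.trans (Finset.sum_congr rfl fun i _ => ?_) this
  change ε i _ = ε i (Φ.symm (riemann G (φ y) ((Φ : E →L[ℝ] E) (e i)) _ _))
  rw [hΦ, ← h.riemann_eq hG' hG hy, ← hΦ]
  simp

/-- The scalar curvature does not depend on the coordinates. -/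
theorem IsPullback.scalar_eq (he : IsDualPair e ε) (h : IsPullback φ G' Ω' G Ω)
    (hG' : IsCoordMetric G' Ω') (hG : IsCoordMetric G Ω) (hy : y ∈ Ω') :
    scalar e ε G' y = scalar e ε G (φ y) := by
  obtain ⟨Φ, hΦ⟩ := h.exists_equiv hG' hy
  let β : E →ₗ[ℝ] (E →L[ℝ] ℝ) →ₗ[ℝ] ℝ := LinearMap.mk₂ ℝ
    (fun x α => ricci e ε G (φ y) x ((G (φ y)).inverse α))
    (fun x x' α => by simp [ricci, riemann_add_middle, Finset.sum_add_distrib])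
    (fun c x α => by simp [ricci, riemann_smul_middle, Finset.mul_sum])
    (fun x α α' => by simp [ricci, riemann_add_right, Finset.sum_add_distrib])
    (fun c x α => by simp [ricci, riemann_smul_right, Finset.mul_sum])
  have := he.sum_map_equiv β Φ
  rw [scalar, scalar]
  refine Eq.trans (Finset.sum_congr rfl fun j _ => ?_) this
  change _ = ricci e ε G (φ y) ((Φ : E →L[ℝ] E) (e j))
    ((G (φ y)).inverse (ε j ∘L (Φ.symm : E →L[ℝ] E)))
  rw [h.ricci_eq he hG' hG hy, hΦ]
  congr 1
  -- Raising an index commutes with the pull-back: the derivative of `φ` carries the `G'`-dual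
  -- vector of `ε j` to the `G`-dual vector of `ε j ∘ Φ⁻¹`.
  symm
  apply (hG.inner _ (h.mapsTo hy)).inverse_unique
  intro x
  obtain ⟨w, rfl⟩ := Φ.surjective x
  have hw : Φ w = fderiv ℝ φ y w := by rw [← hΦ]; rfl
  have h2 := (hG'.inner y hy).apply_inverse (ε j) w
  rw [h.apply_eq y hy, ← hw] at h2
  simpa using h2

end Curvature

/-! ### Conformal changes of the metric -/

section Conformal

variable {E ι : Type*} [NormedAddCommGroup E] [NormedSpace ℝ E] [Fintype ι]

/-- The metrics `G` and `G' = c G` are conformal, and `θ` is half the logarithmic derivative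
of `c`. -/
structure IsConformal (G G' : E → E →L[ℝ] E →L[ℝ] ℝ) (c : E → ℝ) (θ : E → E →L[ℝ] ℝ)
    (Ω : Set E) : Prop where
  metric : IsCoordMetric G Ω
  metric' : IsCoordMetric G' Ω
  eq : ∀ y ∈ Ω, G' y = c y • G y
  pos : ∀ y ∈ Ω, 0 < c y
  differentiableAt_factor : ∀ y ∈ Ω, DifferentiableAt ℝ c y
  fderiv_factor : ∀ y ∈ Ω, fderiv ℝ c y = (2 * c y) • θ y
  differentiableAt : ∀ y ∈ Ω, DifferentiableAt ℝ θ y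

namespace IsConformal

variable {G G' : E → E →L[ℝ] E →L[ℝ] ℝ} {c : E → ℝ} {θ : E → E →L[ℝ] ℝ}
  {Ω : Set E} {y : E}

theorem fderiv_apply (h : IsConformal G G' c θ Ω) (hy : y ∈ Ω) (u v w : E) :
    fderiv ℝ G' y u v w = c y * (fderiv ℝ G y u v w + 2 * θ y u * G y v w) := by
  have hc := h.differentiableAt_factor y hy
  have heq : (fun z => G' z v w) =ᶠ[𝓝 y] fun z => c z * G z v w := by
    filter_upwards [h.metric.isOpen.mem_nhds hy] with z hz
    rw [h.eq z hz]; rfl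
  have hG := h.metric.differentiableAt hy
  rw [← fderiv_clm_apply₂_const_apply (h.metric'.differentiableAt hy), heq.fderiv_eq,
    fderiv_fun_mul hc ((hG.clm_apply (differentiableAt_const v)).clm_apply
      (differentiableAt_const w)), h.fderiv_factor y hy]
  simp only [add_apply, smul_apply, smul_eq_mul, fderiv_clm_apply₂_const_apply hG]
  ring

variable [FiniteDimensional ℝ E]

/-- In the Koszul formula the derivative of `c` adds `2 θ ⊗ G` in three index orders; dividing by
`c` and raising the index gives the difference tensor. -/
theorem christoffelL_eq (h : IsConformal G G' c θ Ω) (hy : y ∈ Ω) (u v : E) :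
    christoffelL G' y u v = christoffelL G y u v
      + (θ y u • v + θ y v • u - G y u v • (G y).inverse (θ y)) := by
  have hi := h.metric.inner y hy
  apply (h.metric'.inner y hy).ext_left
  intro w
  rw [h.metric'.apply_christoffelL hy, h.fderiv_apply hy, h.fderiv_apply hy, h.fderiv_apply hy,
    h.eq y hy]
  simp only [smul_apply, map_add, map_sub, map_smul, add_apply, sub_apply, smul_eq_mul,
    h.metric.apply_christoffelL hy, hi.apply_inverse]
  rw [hi.symm u w, hi.symm v w]
  ring

theorem differentiableAt_inverse (h : IsConformal G G' c θ Ω) (hy : y ∈ Ω) :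
    DifferentiableAt ℝ (fun z => (G z).inverse (θ z)) y :=
  ((h.metric.contDiffAt_inverse hy).differentiableAt (by simp)).clm_apply (h.differentiableAt y hy)

end IsConformal

/-- The covariant derivative of the one-form `θ`. -/
def covDeriv (G : E → E →L[ℝ] E →L[ℝ] ℝ) (θ : E → E →L[ℝ] ℝ) (y u v : E) : ℝ :=
  fderiv ℝ θ y u v - θ y (christoffelL G y u v)

/-- The covariant derivative of the vector field that corresponds to the one-form `θ`. -/
def covDerivSharp (G : E → E →L[ℝ] E →L[ℝ] ℝ) (θ : E → E →L[ℝ] ℝ) (y u : E) : E :=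
  fderiv ℝ (fun z => (G z).inverse (θ z)) y u + christoffelL G y u ((G y).inverse (θ y))

variable [FiniteDimensional ℝ E] {G G' : E → E →L[ℝ] E →L[ℝ] ℝ} {c : E → ℝ} {θ : E → E →L[ℝ] ℝ}
  {Ω : Set E} {y : E}

/-- By metric compatibility, raising an index commutes with the covariant derivative. -/
theorem IsCoordMetric.apply_covDerivSharp (hG : IsCoordMetric G Ω) (hy : y ∈ Ω)
    (hθ : DifferentiableAt ℝ θ y) (u v : E) :
    G y (covDerivSharp G θ y u) v = covDeriv G θ y u v := by
  have ht : DifferentiableAt ℝ (fun z => (G z).inverse (θ z)) y :=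
    ((hG.contDiffAt_inverse hy).differentiableAt (by simp)).clm_apply hθ
  have heq : (fun z => G z ((G z).inverse (θ z)) v) =ᶠ[𝓝 y] fun z => θ z v := by
    filter_upwards [hG.isOpen.mem_nhds hy] with z hz
    exact (hG.inner z hz).apply_inverse _ _
  have h1 := fderiv_clm_apply₂_apply (hG.differentiableAt hy) ht (differentiableAt_const v) u
  rw [heq.fderiv_eq, fderiv_clm_apply_const_apply hθ, hG.fderiv_eq hy,
    (hG.inner y hy).apply_inverse] at h1
  simp only [fderiv_fun_const, Pi.zero_apply, zero_apply, map_zero, add_zero] at h1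
  rw [covDerivSharp, covDeriv, map_add, add_apply]
  linarith

variable {e : ι → E} {ε : ι → E →L[ℝ] ℝ}

/-- Substitution of the law for the Christoffel symbols. Metric compatibility turns the derivatives
of `G` into Christoffel terms, which complete the derivatives of `θ` to covariant ones; `hsymm` says
that `θ` is closed, which removes the multiple of `w`. What is added is built from `G` and the
tensor `∇θ - θ ⊗ θ + (1/2)|θ|² G`. -/
theorem IsConformal.riemann_eq (h : IsConformal G G' c θ Ω) (hy : y ∈ Ω)
    (hsymm : ∀ u v, fderiv ℝ θ y u v = fderiv ℝ θ y v u) (u v w : E) :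
    riemann G' y u v w = riemann G y u v w
      + (covDeriv G θ y u w - θ y u * θ y w + (1 / 2) * θ y ((G y).inverse (θ y)) * G y u w) • v
      - (covDeriv G θ y v w - θ y v * θ y w + (1 / 2) * θ y ((G y).inverse (θ y)) * G y v w) • u
      - G y v w • (covDerivSharp G θ y u - θ y u • (G y).inverse (θ y)
          + ((1 / 2) * θ y ((G y).inverse (θ y))) • u)
      + G y u w • (covDerivSharp G θ y v - θ y v • (G y).inverse (θ y)
          + ((1 / 2) * θ y ((G y).inverse (θ y))) • v) := by
  have hG := h.metric
  have hi := hG.inner y hy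
  have hθ := h.differentiableAt y hy
  have ht := h.differentiableAt_inverse hy
  have hΓ := hG.differentiableAt_christoffelL hy
  have hGd := hG.differentiableAt hy
  have hd : ∀ a b d : E, fderiv ℝ (christoffelL G') y a b d = fderiv ℝ (christoffelL G) y a b d
      + (fderiv ℝ θ y a b • d + fderiv ℝ θ y a d • b
        - (fderiv ℝ G y a b d • (G y).inverse (θ y)
          + G y b d • fderiv ℝ (fun z => (G z).inverse (θ z)) y a)) := by
    intro a b d
    have heq : (fun z => christoffelL G' z b d) =ᶠ[𝓝 y] (fun z => christoffelL G z b d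
        + (θ z b • d + θ z d • b - G z b d • (G z).inverse (θ z))) := by
      filter_upwards [hG.isOpen.mem_nhds hy] with z hz
      exact h.christoffelL_eq hz b d
    have hb := hθ.clm_apply (differentiableAt_const b)
    have hc := hθ.clm_apply (differentiableAt_const d)
    have hGbd := (hGd.clm_apply (differentiableAt_const b)).clm_apply (differentiableAt_const d)
    have h1 : DifferentiableAt ℝ (fun z => θ z b • d + θ z d • b) y :=
      (hb.smul_const d).add (hc.smul_const b)
    have h2 : DifferentiableAt ℝ (fun z => G z b d • (G z).inverse (θ z)) y := hGbd.smul ht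
    have h3 : DifferentiableAt ℝ
        (fun z => θ z b • d + θ z d • b - G z b d • (G z).inverse (θ z)) y := h1.sub h2
    rw [← fderiv_clm_apply₂_const_apply (h.metric'.differentiableAt_christoffelL hy),
      heq.fderiv_eq, fderiv_fun_add ((hΓ.clm_apply (differentiableAt_const b)).clm_apply
        (differentiableAt_const d)) h3, fderiv_fun_sub h1 h2,
      fderiv_fun_add (hb.smul_const d) (hc.smul_const b), fderiv_fun_smul hGbd ht,
      fderiv_smul_const hb, fderiv_smul_const hc]
    simp only [add_apply, sub_apply, smul_apply, ContinuousLinearMap.smulRight_apply,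
      fderiv_clm_apply₂_const_apply hΓ, fderiv_clm_apply₂_const_apply hGd,
      fderiv_clm_apply_const_apply hθ]
    module
  simp only [riemann, hd, h.christoffelL_eq hy, covDeriv, covDerivSharp, map_add, map_sub,
    map_smul, smul_eq_mul, hG.fderiv_eq hy, hi.apply_inverse_right]
  rw [hG.christoffelL_symm hy v u, hsymm v u, hi.symm v (christoffelL G y u w),
    hi.symm u (christoffelL G y v w), hi.symm v u]
  module

/-- The trace of `IsConformal.riemann_eq` in its first slot; the dimension `d` enters as the trace
of the identity. -/
theorem IsConformal.ricci_eq (he : IsDualPair e ε) (h : IsConformal G G' c θ Ω) (hy : y ∈ Ω)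
    (hsymm : ∀ u v, fderiv ℝ θ y u v = fderiv ℝ θ y v u) {d : ℝ} (hd : ∑ i, ε i (e i) = d)
    (v w : E) :
    ricci e ε G' y v w = ricci e ε G y v w
      - (d - 2) * (covDeriv G θ y v w - θ y v * θ y w
          + (1 / 2) * θ y ((G y).inverse (θ y)) * G y v w)
      - (∑ i, ε i (covDerivSharp G θ y (e i)) + (d / 2 - 1) * θ y ((G y).inverse (θ y)))
          * G y v w := by
  have hi := h.metric.inner y hy
  have hθ := h.differentiableAt y hy
  have s1 : ∑ i, covDeriv G θ y (e i) w * ε i v = covDeriv G θ y v w := by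
    have := he.sum_apply_mul ((fderiv ℝ θ y).flip w - θ y ∘L (christoffelL G y).flip w) v
    simpa [covDeriv] using this
  have s2 : ∑ i, θ y (e i) * ε i v = θ y v := he.sum_apply_mul _ _
  have s3 : ∑ i, G y (e i) w * ε i v = G y v w := he.sum_apply_mul ((G y).flip w) v
  have s4 : ∑ i, θ y (e i) * ε i ((G y).inverse (θ y)) = θ y ((G y).inverse (θ y)) :=
    he.sum_apply_mul _ _
  have s5 : ∑ i, G y (e i) w * ε i (covDerivSharp G θ y v) = covDeriv G θ y v w := by
    rw [← h.metric.apply_covDerivSharp hy hθ]; exact he.sum_apply_mul ((G y).flip w) _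
  have s6 : ∑ i, G y (e i) w * ε i ((G y).inverse (θ y)) = θ y w := by
    rw [← hi.apply_inverse (θ y) w]; exact he.sum_apply_mul ((G y).flip w) _
  have key : ∀ i, ε i (riemann G' y (e i) v w) = ε i (riemann G y (e i) v w)
      + (covDeriv G θ y (e i) w * ε i v - θ y w * (θ y (e i) * ε i v)
        + (1 / 2) * θ y ((G y).inverse (θ y)) * (G y (e i) w * ε i v))
      - (covDeriv G θ y v w - θ y v * θ y w + (1 / 2) * θ y ((G y).inverse (θ y)) * G y v w)
          * ε i (e i)
      - G y v w * (ε i (covDerivSharp G θ y (e i)) - θ y (e i) * ε i ((G y).inverse (θ y))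
          + ((1 / 2) * θ y ((G y).inverse (θ y))) * ε i (e i))
      + (G y (e i) w * ε i (covDerivSharp G θ y v)
          - θ y v * (G y (e i) w * ε i ((G y).inverse (θ y)))
          + ((1 / 2) * θ y ((G y).inverse (θ y))) * (G y (e i) w * ε i v)) := by
    intro i
    rw [h.riemann_eq hy hsymm]
    simp only [map_add, map_sub, map_smul, smul_eq_mul]
    ring
  rw [ricci, ricci]
  simp_rw [key, Finset.sum_add_distrib, Finset.sum_sub_distrib, Finset.sum_add_distrib,
    ← Finset.mul_sum, Finset.sum_add_distrib, Finset.sum_sub_distrib, ← Finset.mul_sum]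
  rw [s1, s2, s3, s4, s5, s6, hd]
  ring

/-- The conformal transformation law of the scalar curvature. -/
theorem IsConformal.scalar_eq (he : IsDualPair e ε) (h : IsConformal G G' c θ Ω) (hy : y ∈ Ω)
    (hsymm : ∀ u v, fderiv ℝ θ y u v = fderiv ℝ θ y v u) {d : ℝ} (hd : ∑ i, ε i (e i) = d) :
    c y * scalar e ε G' y = scalar e ε G y - 2 * (d - 1) *
      (∑ i, ε i (covDerivSharp G θ y (e i)) + (d / 2 - 1) * θ y ((G y).inverse (θ y))) := by
  have hi := h.metric.inner y hy
  have hc := h.pos y hy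
  have hθ := h.differentiableAt y hy
  have s1 : ∀ i, covDeriv G θ y (e i) ((G y).inverse (ε i)) = ε i (covDerivSharp G θ y (e i)) := by
    intro i
    rw [← h.metric.apply_covDerivSharp hy hθ, hi.apply_inverse_right]
  have s2 : ∑ i, θ y (e i) * θ y ((G y).inverse (ε i)) = θ y ((G y).inverse (θ y)) := by
    simp_rw [hi.inverse_symm (θ y) (ε _)]
    exact he.sum_apply_mul _ _
  have key : ∀ j, c y * ricci e ε G' y (e j) ((G' y).inverse (ε j)) =
      ricci e ε G y (e j) ((G y).inverse (ε j))
      - (d - 2) * (ε j (covDerivSharp G θ y (e j)) - θ y (e j) * θ y ((G y).inverse (ε j))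
          + (1 / 2) * θ y ((G y).inverse (θ y)) * ε j (e j))
      - (∑ i, ε i (covDerivSharp G θ y (e i)) + (d / 2 - 1) * θ y ((G y).inverse (θ y)))
          * ε j (e j) := by
    intro j
    have hr : ricci e ε G' y (e j) ((G' y).inverse (ε j)) =
        (c y)⁻¹ * ricci e ε G' y (e j) ((G y).inverse (ε j)) := by
      rw [h.eq y hy, hi.inverse_smul hc]
      simp only [ricci, riemann_smul_right, map_smul, smul_eq_mul, Finset.mul_sum]
    rw [hr, mul_inv_cancel_left₀ hc.ne', h.ricci_eq he hy hsymm hd, s1, hi.apply_inverse_right]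
  rw [scalar, scalar, Finset.mul_sum]
  simp_rw [key, Finset.sum_sub_distrib, ← Finset.mul_sum, Finset.sum_add_distrib,
    Finset.sum_sub_distrib, ← Finset.mul_sum]
  rw [s2, hd]
  ring

/-- The Laplacian `∑ i, (∇_{e i} dw)(e i)`. -/
def laplacian (e : ι → E) (ε : ι → E →L[ℝ] ℝ) (G : E → E →L[ℝ] E →L[ℝ] ℝ) (w : E → ℝ) (y : E) : ℝ :=
  ∑ i, ε i (covDerivSharp G (fderiv ℝ w) y (e i))

theorem covDerivSharp_smul (hG : IsCoordMetric G Ω) (hy : y ∈ Ω) {k : E → ℝ}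
    (hk : DifferentiableAt ℝ k y) (hθ : DifferentiableAt ℝ θ y) (u : E) :
    covDerivSharp G (fun z => k z • θ z) y u =
      k y • covDerivSharp G θ y u + fderiv ℝ k y u • (G y).inverse (θ y) := by
  have ht : DifferentiableAt ℝ (fun z => (G z).inverse (θ z)) y :=
    ((hG.contDiffAt_inverse hy).differentiableAt (by simp)).clm_apply hθ
  simp only [covDerivSharp, map_smul]
  rw [fderiv_fun_smul hk ht]
  simp only [add_apply, smul_apply, ContinuousLinearMap.smulRight_apply]
  module

/-- The conformal transformation law of the scalar curvature, with the conformal factor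
`w ^ (4 / (d - 2))` in dimension `d`. -/
theorem IsCoordMetric.scalar_conformal (he : IsDualPair e ε) {d : ℝ} (hd : ∑ i, ε i (e i) = d)
    (hd2 : 2 < d) (hG : IsCoordMetric G Ω) (hG' : IsCoordMetric G' Ω) {w : E → ℝ}
    (hw : ContDiffOn ℝ ∞ w Ω) (hpos : ∀ y ∈ Ω, 0 < w y)
    (heq : ∀ y ∈ Ω, G' y = (w y) ^ (4 / (d - 2)) • G y) (hy : y ∈ Ω) :
    (w y) ^ (4 / (d - 2)) * w y * scalar e ε G' y =
      scalar e ε G y * w y - 4 * ((d - 1) / (d - 2)) * laplacian e ε G w y := by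
  have hwc : ∀ z ∈ Ω, ContDiffAt ℝ ∞ w z := fun z hz => hw.contDiffAt (hG.isOpen.mem_nhds hz)
  have hwd : ∀ z ∈ Ω, DifferentiableAt ℝ w z := fun z hz => (hwc z hz).differentiableAt (by simp)
  have hwd' : ∀ z ∈ Ω, DifferentiableAt ℝ (fderiv ℝ w) z := fun z hz =>
    ((hwc z hz).fderiv_right (m := ∞) (by simp)).differentiableAt (by simp)
  have hd2' : d - 2 ≠ 0 := by linarith
  have hkd : ∀ z ∈ Ω, HasFDerivAt (fun z => 2 / (d - 2) * (w z)⁻¹)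
      ((-(2 / (d - 2)) * ((w z) ^ 2)⁻¹) • fderiv ℝ w z) z := by
    intro z hz
    have := ((hasDerivAt_inv (hpos z hz).ne').comp_hasFDerivAt z
      (hwd z hz).hasFDerivAt).const_mul (2 / (d - 2))
    refine this.congr_fderiv ?_
    rw [smul_smul]
    congr 1
    ring
  -- Half the logarithmic derivative of `w ^ (4 / (d - 2))` is `2 / (d - 2) * w⁻¹ • dw`.
  have hconf : IsConformal G G' (fun y => (w y) ^ (4 / (d - 2)))
      (fun z => (2 / (d - 2) * (w z)⁻¹) • fderiv ℝ w z) Ω :=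
    { metric := hG
      metric' := hG'
      eq := heq
      pos := fun z hz => Real.rpow_pos_of_pos (hpos z hz) _
      differentiableAt_factor := fun z hz => (hwd z hz).rpow_const (Or.inl (hpos z hz).ne')
      fderiv_factor := fun z hz => by
        rw [((hwd z hz).hasFDerivAt.rpow_const (Or.inl (hpos z hz).ne')).fderiv,
          Real.rpow_sub_one (hpos z hz).ne', smul_smul]
        congr 1
        have := (hpos z hz).ne'
        field_simp
        ring
      differentiableAt := fun z hz => (hkd z hz).differentiableAt.smul (hwd' z hz) }
  have hsym2 : ∀ u v, fderiv ℝ (fderiv ℝ w) y u v = fderiv ℝ (fderiv ℝ w) y v u :=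
    (hwc y hy).isSymmSndFDerivAt (by simp [minSmoothness_of_isRCLikeNormedField, two_le_infty])
  have hsymm : ∀ u v, fderiv ℝ (fun z => (2 / (d - 2) * (w z)⁻¹) • fderiv ℝ w z) y u v =
      fderiv ℝ (fun z => (2 / (d - 2) * (w z)⁻¹) • fderiv ℝ w z) y v u := by
    intro u v
    rw [fderiv_fun_smul (hkd y hy).differentiableAt (hwd' y hy), (hkd y hy).fderiv]
    simp only [add_apply, smul_apply, ContinuousLinearMap.smulRight_apply, smul_eq_mul,
      hsym2 u v]
    ring
  have key := hconf.scalar_eq he hy hsymm hd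
  -- The divergence of `θ` contributes `-2/(d-2) · |dw|²/w²`, and the term `(d/2 - 1)|θ|²`
  -- contributes `+2/(d-2) · |dw|²/w²`. The exponent `4 / (d - 2)` is the one for which these
  -- cancel, leaving the Laplacian of `w` alone.
  have hlap : ∑ i, ε i (covDerivSharp G (fun z => (2 / (d - 2) * (w z)⁻¹) • fderiv ℝ w z) y (e i)) =
      2 / (d - 2) * (w y)⁻¹ * laplacian e ε G w y
        + -(2 / (d - 2)) * ((w y) ^ 2)⁻¹ * fderiv ℝ w y ((G y).inverse (fderiv ℝ w y)) := by
    rw [← he.sum_apply_mul (fderiv ℝ w y) ((G y).inverse (fderiv ℝ w y)), laplacian,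
      Finset.mul_sum, Finset.mul_sum, ← Finset.sum_add_distrib]
    refine Finset.sum_congr rfl fun i _ => ?_
    rw [covDerivSharp_smul hG hy (hkd y hy).differentiableAt (hwd' y hy), (hkd y hy).fderiv]
    simp only [map_add, map_smul, smul_apply, smul_eq_mul]
    ring
  rw [hlap] at key
  simp only [map_smul, smul_apply, smul_eq_mul] at key
  have hw0 := (hpos y hy).ne'
  calc (w y) ^ (4 / (d - 2)) * w y * scalar e ε G' y
      = w y * ((w y) ^ (4 / (d - 2)) * scalar e ε G' y) := by ring
    _ = _ := by
      rw [key]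
      field_simp
      ring

end Conformal

/-! ### The Riemannian density in coordinates -/

section Density

variable {E ι : Type*} [NormedAddCommGroup E] [NormedSpace ℝ E] [Fintype ι] [DecidableEq ι]

/-- The Gram matrix of the vectors `e`. -/
def gram (e : ι → E) (G : E → E →L[ℝ] E →L[ℝ] ℝ) (y : E) : Matrix ι ι ℝ :=
  Matrix.of fun i j => G y (e i) (e j)

/-- The density `√(det g_ij)`. -/
def density (e : ι → E) (G : E → E →L[ℝ] E →L[ℝ] ℝ) (y : E) : ℝ := √(gram e G y).det

variable {G G' : E → E →L[ℝ] E →L[ℝ] ℝ} {Ω Ω' : Set E} {y : E}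

/-- Jacobi's formula: the determinant is multilinear in the rows, and replacing one row by its
derivative gives, by Cramer's rule, its pairing with the cofactors. -/
theorem hasFDerivAt_det {A : E → Matrix ι ι ℝ} {A' : ι → ι → E →L[ℝ] ℝ}
    (hA : ∀ i j, HasFDerivAt (fun z => A z i j) (A' i j) y) :
    HasFDerivAt (fun z => (A z).det) (∑ i, ∑ j, (A y).adjugate j i • A' i j) y := by
  let D : ContinuousMultilinearMap ℝ (fun _ : ι => ι → ℝ) ℝ :=
    ⟨(Matrix.detRowAlternating : (ι → ℝ) [⋀^ι]→ₗ[ℝ] ℝ).toMultilinearMap,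
      Continuous.matrix_det (A := fun x : ι → ι → ℝ => (Matrix.of x)) continuous_id⟩
  have hA' : HasFDerivAt (fun z => (fun i j => A z i j : ι → ι → ℝ))
      (ContinuousLinearMap.pi fun i => ContinuousLinearMap.pi fun j => A' i j) y :=
    hasFDerivAt_pi.2 fun i => hasFDerivAt_pi.2 fun j => hA i j
  have h := (D.hasFDerivAt (fun i j => A y i j)).comp y hA'
  refine h.congr_fderiv ?_
  ext v
  have h1 : ∀ i, D (Function.update (fun i j => A y i j) i (fun j => A' i j v)) =
      ∑ j, (A y).adjugate j i * A' i j v := by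
    intro i
    change ((A y).updateRow i (fun j => A' i j v)).det = _
    rw [← Matrix.cramer_transpose_apply, Matrix.cramer_eq_adjugate_mulVec,
      ← Matrix.adjugate_transpose]
    rfl
  simpa using Finset.sum_congr rfl fun i _ => h1 i

omit [Fintype ι] [DecidableEq ι] in
theorem IsCoordMetric.hasFDerivAt_gram (hG : IsCoordMetric G Ω) (hy : y ∈ Ω) (e : ι → E) (i j : ι) :
    HasFDerivAt (fun z => gram e G z i j) (((fderiv ℝ G y).flip (e i)).flip (e j)) y := by
  have hd := ((hG.differentiableAt hy).clm_apply (differentiableAt_const (e i))).clm_apply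
    (differentiableAt_const (e j))
  refine hd.hasFDerivAt.congr_fderiv ?_
  ext v
  rw [fderiv_clm_apply₂_const_apply (hG.differentiableAt hy)]
  rfl

theorem IsCoordMetric.contDiffOn_gram_det (hG : IsCoordMetric G Ω) (e : ι → E) :
    ContDiffOn ℝ ∞ (fun z => (gram e G z).det) Ω := by
  simp only [Matrix.det_apply']
  refine ContDiffOn.sum fun σ _ => contDiffOn_const.mul (contDiffOn_prod fun i _ => ?_)
  exact (hG.smooth.clm_apply contDiffOn_const).clm_apply contDiffOn_const

variable {e : ι → E} {ε : ι → E →L[ℝ] ℝ}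

/-- The duality `hδ` makes `e` linearly independent, so the Gram matrix is positive definite. -/
theorem IsCoordMetric.gram_det_pos (hG : IsCoordMetric G Ω) (hy : y ∈ Ω)
    (hδ : ∀ i j, ε i (e j) = if i = j then 1 else 0) : 0 < (gram e G y).det := by
  apply Matrix.PosDef.det_pos
  have hi := hG.inner y hy
  apply Matrix.PosDef.of_dotProduct_mulVec_pos
  · ext i j
    simp [gram, hi.symm (e j)]
  · intro x hx
    have hv : (∑ i, x i • e i) ≠ 0 := by
      intro h0
      apply hx
      ext j
      have := congrArg (ε j) h0
      simpa [hδ] using this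
    have := hi.pos _ hv
    refine this.trans_eq ?_
    simp only [map_sum, map_smul, sum_apply, smul_apply, smul_eq_mul, dotProduct,
      Matrix.mulVec, gram, Matrix.of_apply, star_trivial, Finset.mul_sum]
    rw [Finset.sum_comm]
    refine Finset.sum_congr rfl fun i _ => Finset.sum_congr rfl fun j _ => ?_
    ring

theorem IsCoordMetric.contDiffOn_density (hG : IsCoordMetric G Ω)
    (hδ : ∀ i j, ε i (e j) = if i = j then 1 else 0) : ContDiffOn ℝ ∞ (density e G) Ω :=
  (hG.contDiffOn_gram_det e).sqrt fun _ hy => (hG.gram_det_pos hy hδ).ne'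

/-- The logarithmic derivative of the density is the trace of the Christoffel symbols. -/
theorem IsCoordMetric.fderiv_density [FiniteDimensional ℝ E] (hG : IsCoordMetric G Ω) (hy : y ∈ Ω)
    (he : IsDualPair e ε) (hδ : ∀ i j, ε i (e j) = if i = j then 1 else 0) (v : E) :
    fderiv ℝ (density e G) y v = density e G y * ∑ i, ε i (christoffelL G y v (e i)) := by
  have hi := hG.inner y hy
  have hpos := hG.gram_det_pos hy hδ
  have hdet := (hasFDerivAt_det fun i j => hG.hasFDerivAt_gram hy e i j).sqrt hpos.ne'
  -- With this matrix metric compatibility reads `∂_v g = C g + g Cᵀ`. Jacobi's formula then gives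
  -- `2 det g · tr C`, and the square root removes the 2.
  set C : Matrix ι ι ℝ := Matrix.of fun i k => ε k (christoffelL G y v (e i)) with hC
  have h1 : ∀ i j, fderiv ℝ G y v (e i) (e j) = (C * gram e G y + gram e G y * C.transpose) i j := by
    intro i j
    rw [hG.fderiv_eq hy]
    conv_lhs => rw [← he (christoffelL G y v (e i)), ← he (christoffelL G y v (e j))]
    simp [Matrix.mul_apply, hC, gram, mul_comm]
  have h2 : ∑ i, ∑ j, (gram e G y).adjugate j i * fderiv ℝ G y v (e i) (e j) =
      2 * (gram e G y).det * C.trace := by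
    have : ∑ i, ∑ j, (gram e G y).adjugate j i * fderiv ℝ G y v (e i) (e j) =
        ((gram e G y).adjugate * (C * gram e G y + gram e G y * C.transpose)).trace := by
      rw [Finset.sum_comm]
      simp only [Matrix.trace, Matrix.diag, Matrix.mul_apply (M := (gram e G y).adjugate), h1]
    rw [this, Matrix.mul_add, Matrix.trace_add, Matrix.trace_mul_comm, Matrix.mul_assoc,
      Matrix.mul_adjugate, ← Matrix.mul_assoc, Matrix.adjugate_mul]
    simp
    ring
  have hf : fderiv ℝ (density e G) y = _ := hdet.fderiv
  rw [hf]
  simp only [smul_apply, sum_apply, ContinuousLinearMap.flip_apply, smul_eq_mul]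
  rw [h2, density]
  have hs := Real.sqrt_pos.2 hpos
  have hsq := Real.mul_self_sqrt hpos.le
  have hCt : C.trace = ∑ i, ε i (christoffelL G y v (e i)) := rfl
  rw [hCt]
  field_simp
  rw [sq, hsq]
  try ring

/-- The Gram determinant of a pulled-back metric. -/
theorem density_pullback (b : Module.Basis ι ℝ E) {G G' : E → E →L[ℝ] E →L[ℝ] ℝ} {y y' : E}
    {Φ : E →L[ℝ] E} (h : ∀ u v, G' y' u v = G y (Φ u) (Φ v)) :
    density b G' y' = |Φ.det| * density b G y := by
  have : gram b G' y' = (LinearMap.toMatrix b b (Φ : E →ₗ[ℝ] E)).transpose * gram b G y *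
      LinearMap.toMatrix b b (Φ : E →ₗ[ℝ] E) := by
    ext i j
    have hsum : ∀ x, Φ x = ∑ k, b.repr (Φ x) k • b k := fun x => (b.sum_repr (Φ x)).symm
    simp only [gram, Matrix.of_apply, h, Matrix.mul_apply, Matrix.transpose_apply,
      LinearMap.toMatrix_apply]
    conv_lhs => rw [hsum (b i), hsum (b j)]
    simp only [map_sum, map_smul, sum_apply, smul_apply, smul_eq_mul,
      Finset.sum_mul, Finset.mul_sum]
    refine Finset.sum_congr rfl fun k _ => Finset.sum_congr rfl fun l _ => ?_
    simp only [ContinuousLinearMap.coe_coe]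
    ring
  rw [density, this, Matrix.det_mul, Matrix.det_mul, Matrix.det_transpose, LinearMap.det_toMatrix,
    density]
  rw [show ∀ a d : ℝ, a * d * a = a ^ 2 * d by intros; ring, Real.sqrt_mul (sq_nonneg _),
    Real.sqrt_sq_eq_abs]

theorem contDiff_mul_of_tsupport_subset {k : ℕ∞ω} {φ V : E → ℝ} (hΩ : IsOpen Ω) (hφ : ContDiff ℝ k φ)
    (hV : ContDiffOn ℝ k V Ω) (hs : tsupport φ ⊆ Ω) : ContDiff ℝ k (fun y => φ y * V y) := by
  rw [contDiff_iff_contDiffAt]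
  intro y
  by_cases hy : y ∈ tsupport φ
  · exact hφ.contDiffAt.mul (hV.contDiffAt (hΩ.mem_nhds (hs hy)))
  · have : (fun y => φ y * V y) =ᶠ[𝓝 y] fun _ => 0 := by
      filter_upwards [(isClosed_tsupport φ).isOpen_compl.mem_nhds hy] with z hz
      rw [image_eq_zero_of_notMem_tsupport hz, zero_mul]
    exact contDiffAt_const.congr_of_eventuallyEq this

variable [FiniteDimensional ℝ E] [MeasurableSpace E] [BorelSpace E] {μ : Measure E}
  [μ.IsAddHaarMeasure]

/-- Integration by parts against the constant function 1. -/
theorem integral_fderiv_eq_zero {ψ : E → ℝ} (hψ : ContDiff ℝ 1 ψ) (hc : HasCompactSupport ψ)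
    (v : E) : ∫ y, fderiv ℝ ψ y v ∂μ = 0 := by
  have h1 : Integrable (fun y => fderiv ℝ ψ y v) μ :=
    ((hψ.continuous_fderiv one_ne_zero).clm_apply continuous_const).integrable_of_hasCompactSupport
      ((hc.fderiv ℝ).comp_left (g := fun L : E →L[ℝ] ℝ => L v) rfl)
  have h2 : Integrable ψ μ := hψ.continuous.integrable_of_hasCompactSupport hc
  have := integral_mul_fderiv_eq_neg_fderiv_mul_of_integrable (𝕜 := ℝ) (μ := μ) (v := v)
    (f := fun _ => (1 : ℝ)) (g := ψ) (by simp) (by simpa using h1) (by simpa using h2)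
    (fun x _ => differentiableAt_const _) (fun x _ => (hψ.differentiable one_ne_zero) x)
  simpa using this

/-- Green's formula in coordinates. -/
theorem IsCoordMetric.integral_green (hG : IsCoordMetric G Ω) (he : IsDualPair e ε)
    (hδ : ∀ i j, ε i (e j) = if i = j then 1 else 0) {f φ : E → ℝ} (hf : ContDiffOn ℝ ∞ f Ω)
    (hφ : ContDiff ℝ 1 φ) (hc : HasCompactSupport φ) (hs : tsupport φ ⊆ Ω) :
    ∫ y in Ω, (fderiv ℝ φ y ((G y).inverse (fderiv ℝ f y)) + φ y * laplacian e ε G f y)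
      * density e G y ∂μ = 0 := by
  have hdf : ContDiffOn ℝ ∞ (fderiv ℝ f) Ω := hf.fderiv_of_isOpen hG.isOpen (by simp)
  have ht : ContDiffOn ℝ ∞ (fun y => (G y).inverse (fderiv ℝ f y)) Ω := fun y hy =>
    (((hG.contDiffAt_inverse hy)).clm_apply
      (hdf.contDiffAt (hG.isOpen.mem_nhds hy))).contDiffWithinAt
  have hρ := hG.contDiffOn_density hδ
  -- These are the components of `√(det g) ∇f`. Multiplied by `φ` they form a compactly supported
  -- field, whose Euclidean divergence has integral zero.
  have hV : ∀ i, ContDiffOn ℝ 1 (fun y => density e G y * ε i ((G y).inverse (fderiv ℝ f y))) Ω :=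
    fun i => (hρ.mul ((ε i).contDiff.comp_contDiffOn ht)).of_le (by simp)
  have hψ := fun i => contDiff_mul_of_tsupport_subset hG.isOpen hφ (hV i) hs
  have hψc : ∀ i, HasCompactSupport
      (fun y => φ y * (density e G y * ε i ((G y).inverse (fderiv ℝ f y)))) :=
    fun i => hc.mul_right
  have hint : ∀ i, Integrable (fun y => fderiv ℝ
      (fun y => φ y * (density e G y * ε i ((G y).inverse (fderiv ℝ f y)))) y (e i)) μ := fun i =>
    (((hψ i).continuous_fderiv one_ne_zero).clm_apply
      continuous_const).integrable_of_hasCompactSupport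
      (((hψc i).fderiv ℝ).comp_left (g := fun L : E →L[ℝ] ℝ => L (e i)) rfl)
  have h0 : ∫ y, ∑ i, fderiv ℝ
      (fun y => φ y * (density e G y * ε i ((G y).inverse (fderiv ℝ f y)))) y (e i) ∂μ = 0 := by
    rw [integral_finsetSum _ fun i _ => hint i]
    exact Finset.sum_eq_zero fun i _ => integral_fderiv_eq_zero (hψ i) (hψc i) (e i)
  rw [← setIntegral_eq_integral_of_forall_compl_eq_zero (s := Ω)] at h0
  · rw [← h0]
    refine setIntegral_congr_fun hG.isOpen.measurableSet fun y hy => ?_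
    have hφd : DifferentiableAt ℝ φ y := hφ.differentiable one_ne_zero y
    have htd : DifferentiableAt ℝ (fun y => (G y).inverse (fderiv ℝ f y)) y :=
      (ht.contDiffAt (hG.isOpen.mem_nhds hy)).differentiableAt (by simp)
    have hρd : DifferentiableAt ℝ (density e G) y :=
      (hρ.contDiffAt (hG.isOpen.mem_nhds hy)).differentiableAt (by simp)
    have hi : ∀ i, fderiv ℝ
        (fun y => φ y * (density e G y * ε i ((G y).inverse (fderiv ℝ f y)))) y (e i) =
        density e G y * (fderiv ℝ φ y (e i) * ε i ((G y).inverse (fderiv ℝ f y)))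
        + φ y * (fderiv ℝ (density e G) y (e i) * ε i ((G y).inverse (fderiv ℝ f y)))
        + density e G y * φ y *
          ε i (fderiv ℝ (fun y => (G y).inverse (fderiv ℝ f y)) y (e i)) := by
      intro i
      have hεd : HasFDerivAt (fun y => ε i ((G y).inverse (fderiv ℝ f y)))
          (ε i ∘L fderiv ℝ (fun y => (G y).inverse (fderiv ℝ f y)) y) y :=
        (ε i).hasFDerivAt.comp y htd.hasFDerivAt
      have hm := hφd.hasFDerivAt.fun_mul (hρd.hasFDerivAt.fun_mul hεd)
      rw [hm.fderiv]
      simp only [add_apply, smul_apply, smul_eq_mul, ContinuousLinearMap.comp_apply]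
      ring
    -- The derivative of the density yields the trace on the left. By torsion-freeness it is the
    -- Christoffel part of the Laplacian, which turns the Euclidean divergence into the Riemannian
    -- one.
    have htr : ∑ i, ε i (christoffelL G y ((G y).inverse (fderiv ℝ f y)) (e i)) =
        ∑ i, ε i (christoffelL G y (e i) ((G y).inverse (fderiv ℝ f y))) :=
      Finset.sum_congr rfl fun i _ => by rw [hG.christoffelL_symm hy]
    simp only [hi, Finset.sum_add_distrib, ← Finset.mul_sum]
    rw [he.sum_apply_mul, he.sum_apply_mul, hG.fderiv_density hy he hδ, htr, laplacian]
    simp only [covDerivSharp, map_add, Finset.sum_add_distrib]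
    ring
  · intro y hy
    have hy' : y ∉ tsupport φ := fun h => hy (hs h)
    refine Finset.sum_eq_zero fun i _ => ?_
    have : (fun y => φ y * (density e G y * ε i ((G y).inverse (fderiv ℝ f y)))) =ᶠ[𝓝 y]
        fun _ => 0 := by
      filter_upwards [(isClosed_tsupport φ).isOpen_compl.mem_nhds hy'] with z hz
      rw [image_eq_zero_of_notMem_tsupport hz, zero_mul]
    rw [this.fderiv_eq]
    simp

end Density

/-! ### The standard basis -/

section Standard

variable {n : ℕ}

@[simp] theorem stdCoord_apply (i : Fin n) (v : EuclideanSpace ℝ (Fin n)) : stdCoord i v = v i := rfl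

theorem stdCoord_stdVec (i j : Fin n) : stdCoord i (stdVec j) = if i = j then 1 else 0 := by
  simp [stdVec]

theorem isDualPair_std : IsDualPair (stdVec : Fin n → EuclideanSpace ℝ (Fin n)) stdCoord := by
  intro v
  ext j
  simp [stdVec, Pi.single_apply]

theorem sum_stdCoord_stdVec : ∑ i : Fin n, stdCoord i (stdVec i) = (n : ℝ) := by
  simp [stdCoord_stdVec, -stdCoord_apply]

/-- The two sides differ in whether the Christoffel symbols are evaluated on vectors before or after
differentiating, which is immaterial because they are differentiable. -/
theorem coordScalar_eq {G : EuclideanSpace ℝ (Fin n) →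
    (EuclideanSpace ℝ (Fin n) →L[ℝ] EuclideanSpace ℝ (Fin n) →L[ℝ] ℝ)}
    {Ω : Set (EuclideanSpace ℝ (Fin n))} {y : EuclideanSpace ℝ (Fin n)} (hG : IsCoordMetric G Ω)
    (hy : y ∈ Ω) : coordScalar G y = scalar stdVec stdCoord G y := by
  have hΓ : ∀ z u v, christoffel G z u v = christoffelL G z u v := fun z u v =>
    (christoffelL_apply G z u v).symm
  have h : ∀ a b c : EuclideanSpace ℝ (Fin n), fderiv ℝ (fun z => christoffelL G z a b) y c =
      fderiv ℝ (christoffelL G) y c a b := by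
    intro a b c
    exact fderiv_clm_apply₂_const_apply (hG.differentiableAt_christoffelL hy) a b c
  simp only [coordScalar, coordRicci, coordRiemann, hΓ, h, scalar, ricci, riemann]

theorem IsCoordMetric.continuousOn_scalar {E ι : Type*} [NormedAddCommGroup E] [NormedSpace ℝ E]
    [FiniteDimensional ℝ E] [Fintype ι] {G : E → E →L[ℝ] E →L[ℝ] ℝ} {Ω : Set E}
    (hG : IsCoordMetric G Ω) (e : ι → E) (ε : ι → E →L[ℝ] ℝ) :
    ContinuousOn (scalar e ε G) Ω := by
  intro y hy
  have h1 : ContinuousAt (christoffelL G) y := (hG.contDiffAt_christoffelL hy).continuousAt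
  have h2 : ContinuousAt (fderiv ℝ (christoffelL G)) y :=
    ((hG.contDiffAt_christoffelL hy).fderiv_right (m := ∞) (by simp)).continuousAt
  have h3 : ContinuousAt (fun z => (G z).inverse) y := (hG.contDiffAt_inverse hy).continuousAt
  apply ContinuousAt.continuousWithinAt
  unfold scalar ricci riemann
  fun_prop

theorem IsCoordMetric.continuousOn_laplacian {E ι : Type*} [NormedAddCommGroup E] [NormedSpace ℝ E]
    [FiniteDimensional ℝ E] [Fintype ι] {G : E → E →L[ℝ] E →L[ℝ] ℝ} {Ω : Set E}
    (hG : IsCoordMetric G Ω) (e : ι → E) (ε : ι → E →L[ℝ] ℝ) {f : E → ℝ}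
    (hf : ContDiffOn ℝ ∞ f Ω) :
    ContinuousOn (laplacian e ε G f) Ω := by
  intro y hy
  have h0 : ContDiffAt ℝ ∞ (fderiv ℝ f) y :=
    (hf.contDiffAt (hG.isOpen.mem_nhds hy)).fderiv_right (by simp)
  have h1 : ContinuousAt (christoffelL G) y := (hG.contDiffAt_christoffelL hy).continuousAt
  have h2 : ContDiffAt ℝ ∞ (fun z => (G z).inverse (fderiv ℝ f z)) y :=
    (hG.contDiffAt_inverse hy).clm_apply h0
  have h3 : ContinuousAt (fun z => (G z).inverse (fderiv ℝ f z)) y := h2.continuousAt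
  have h4 : ContinuousAt (fderiv ℝ (fun z => (G z).inverse (fderiv ℝ f z))) y :=
    (h2.fderiv_right (m := ∞) (by simp)).continuousAt
  apply ContinuousAt.continuousWithinAt
  unfold laplacian covDerivSharp
  fun_prop

end Standard

/-! ### Reading a Riemannian metric in a chart -/

section Charts

variable {n : ℕ} {M : Type*} [TopologicalSpace M] [ChartedSpace (EuclideanSpace ℝ (Fin n)) M]

instance (x : M) : T2Space (TangentSpace (𝓡 n) x) :=
  inferInstanceAs (T2Space (EuclideanSpace ℝ (Fin n)))

instance (x : M) : FiniteDimensional ℝ (TangentSpace (𝓡 n) x) :=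
  inferInstanceAs (FiniteDimensional ℝ (EuclideanSpace ℝ (Fin n)))

variable [IsManifold (𝓡 n) ∞ M]

theorem Metric.isInnerForm (g : Metric n M) (x : M) : IsInnerForm (g.inner x) :=
  ⟨g.symm x, g.pos x⟩

theorem contMDiffAt_chart_symm (x₀ : M) {y : EuclideanSpace ℝ (Fin n)}
    (hy : y ∈ (extChartAt (𝓡 n) x₀).target) :
    ContMDiffAt 𝓘(ℝ, EuclideanSpace ℝ (Fin n)) (𝓡 n) ∞ (extChartAt (𝓡 n) x₀).symm y :=
  (contMDiffOn_extChartAt_symm x₀).contMDiffAt ((isOpen_extChartAt_target x₀).mem_nhds hy)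

theorem mdifferentiableAt_chart_symm (x₀ : M) {y : EuclideanSpace ℝ (Fin n)}
    (hy : y ∈ (extChartAt (𝓡 n) x₀).target) :
    MDifferentiableAt 𝓘(ℝ, EuclideanSpace ℝ (Fin n)) (𝓡 n) (extChartAt (𝓡 n) x₀).symm y :=
  (contMDiffAt_chart_symm x₀ hy).mdifferentiableAt (by simp)

theorem isInvertible_chartFrame (x₀ : M) {y : EuclideanSpace ℝ (Fin n)}
    (hy : y ∈ (extChartAt (𝓡 n) x₀).target) : (chartFrame x₀ y).IsInvertible := by
  have := isInvertible_mfderivWithin_extChartAt_symm (I := 𝓡 n) hy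
  rw [ModelWithCorners.range_eq_univ, mfderivWithin_univ] at this
  exact this

theorem metricInChart_apply (g : Metric n M) (x₀ : M) (y u v : EuclideanSpace ℝ (Fin n)) :
    metricInChart g x₀ y u v =
      g.inner ((extChartAt (𝓡 n) x₀).symm y) (chartFrame x₀ y u) (chartFrame x₀ y v) := rfl

/-- Read in the trivialization at `x₀` this section is constant. -/
theorem contMDiffOn_frame_section (x₀ : M) (u : EuclideanSpace ℝ (Fin n)) :
    ContMDiffOn (𝓡 n) ((𝓡 n).prod 𝓘(ℝ, EuclideanSpace ℝ (Fin n))) ∞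
      (fun x : M => Bundle.TotalSpace.mk' (EuclideanSpace ℝ (Fin n)) x
        ((trivializationAt (EuclideanSpace ℝ (Fin n)) (TangentSpace (𝓡 n)) x₀).symmL ℝ x u))
      (chartAt (EuclideanSpace ℝ (Fin n)) x₀).source := by
  have h := (trivializationAt (EuclideanSpace ℝ (Fin n)) (TangentSpace (𝓡 n) (M := M))
    x₀).contMDiffOn_section_baseSet_iff (IB := 𝓡 n) (n := ∞)
    (s := fun x => (trivializationAt (EuclideanSpace ℝ (Fin n)) (TangentSpace (𝓡 n)) x₀).symmL ℝ x u)
  refine h.2 ?_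
  refine (contMDiffOn_const (c := u)).congr fun x hx => ?_
  rw [Bundle.Trivialization.symmL_apply, Bundle.Trivialization.apply_mk_symm _ hx]
  exact hx

/-- Smoothness of `g` is a statement about a bundle map. It is evaluated on the frame of the
trivialization at `x₀`, which coincides with the derivative of the inverse chart. -/
theorem contDiffOn_metricInChart (g : Metric n M) (x₀ : M) :
    ContDiffOn ℝ ∞ (metricInChart g x₀) (extChartAt (𝓡 n) x₀).target := by
  rw [contDiffOn_clm_apply]
  intro u
  rw [contDiffOn_clm_apply]
  intro v
  have h1 : ContMDiffOn (𝓡 n) 𝓘(ℝ, ℝ) ∞ (fun x : M => g.inner x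
      ((trivializationAt (EuclideanSpace ℝ (Fin n)) (TangentSpace (𝓡 n)) x₀).symmL ℝ x u)
      ((trivializationAt (EuclideanSpace ℝ (Fin n)) (TangentSpace (𝓡 n)) x₀).symmL ℝ x v))
      (chartAt (EuclideanSpace ℝ (Fin n)) x₀).source := by
    intro x hx
    have := ContMDiffWithinAt.clm_bundle_apply₂ (F₁ := EuclideanSpace ℝ (Fin n))
      (F₂ := EuclideanSpace ℝ (Fin n)) (F₃ := ℝ) (E₃ := Bundle.Trivial M ℝ)
      (g.contMDiff.contMDiffAt (x := x)).contMDiffWithinAt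
      (contMDiffOn_frame_section x₀ u x hx) (contMDiffOn_frame_section x₀ v x hx)
    exact (Bundle.contMDiffWithinAt_totalSpace.1 this).2
  have h2 := h1.comp (contMDiffOn_extChartAt_symm (n := ∞) (I := 𝓡 n) x₀)
    (fun y hy => by simpa using (extChartAt (𝓡 n) x₀).map_target hy)
  rw [contMDiffOn_iff_contDiffOn] at h2
  refine h2.congr fun y hy => ?_
  have hx : (extChartAt (𝓡 n) x₀).symm y ∈ (chartAt (EuclideanSpace ℝ (Fin n)) x₀).source := by
    simpa using (extChartAt (𝓡 n) x₀).map_target hy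
  have h3 := TangentBundle.symmL_trivializationAt (I := 𝓡 n) hx
  rw [(extChartAt (𝓡 n) x₀).right_inv hy, ModelWithCorners.range_eq_univ, mfderivWithin_univ] at h3
  rw [metricInChart_apply]
  simp only [Function.comp_apply, h3]
  rfl

theorem isCoordMetric_metricInChart (g : Metric n M) (x₀ : M) :
    IsCoordMetric (metricInChart g x₀) (extChartAt (𝓡 n) x₀).target where
  isOpen := isOpen_extChartAt_target x₀
  smooth := contDiffOn_metricInChart g x₀
  inner y hy := {
    symm := fun v w => g.symm _ _ _
    pos := fun v hv => by
      rw [metricInChart_apply]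
      apply g.pos
      intro h
      apply hv
      have hi := (isInvertible_chartFrame x₀ hy).injective
      exact (map_eq_zero_iff _ hi).1 h }

end Charts

/-! ### Independence of the chart -/

section Charts

variable {n : ℕ} {M : Type*} [TopologicalSpace M] [ChartedSpace (EuclideanSpace ℝ (Fin n)) M]
  [IsManifold (𝓡 n) ∞ M]

theorem IsCoordMetric.mono {E : Type*} [NormedAddCommGroup E] [NormedSpace ℝ E]
    {G : E → E →L[ℝ] E →L[ℝ] ℝ} {Ω Ω' : Set E} (hG : IsCoordMetric G Ω) (ho : IsOpen Ω')
    (hs : Ω' ⊆ Ω) : IsCoordMetric G Ω' :=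
  ⟨ho, hG.smooth.mono hs, fun y hy => hG.inner y (hs hy)⟩

/-- The coordinate change between the preferred charts at `x₀` and `x₁`. -/
def transition (x₀ x₁ : M) (y : EuclideanSpace ℝ (Fin n)) : EuclideanSpace ℝ (Fin n) :=
  extChartAt (𝓡 n) x₁ ((extChartAt (𝓡 n) x₀).symm y)

/-- The domain of the coordinate change between the preferred charts at `x₀` and `x₁`. -/
def overlap (x₀ x₁ : M) : Set (EuclideanSpace ℝ (Fin n)) :=
  (extChartAt (𝓡 n) x₀).target ∩ (extChartAt (𝓡 n) x₀).symm ⁻¹' (extChartAt (𝓡 n) x₁).source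

omit [IsManifold (𝓡 n) ∞ M] in
theorem isOpen_overlap (x₀ x₁ : M) : IsOpen (overlap (n := n) x₀ x₁) :=
  (continuousOn_extChartAt_symm x₀).isOpen_inter_preimage (isOpen_extChartAt_target x₀)
    (isOpen_extChartAt_source x₁)

theorem contDiffOn_transition (x₀ x₁ : M) :
    ContDiffOn ℝ ∞ (transition (n := n) x₀ x₁) (overlap x₀ x₁) := by
  rw [← contMDiffOn_iff_contDiffOn]
  intro y hy
  have h1 : ContMDiffAt (𝓡 n) 𝓘(ℝ, EuclideanSpace ℝ (Fin n)) ∞ (extChartAt (𝓡 n) x₁)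
      ((extChartAt (𝓡 n) x₀).symm y) := contMDiffAt_extChartAt' (by simpa using hy.2)
  exact (h1.comp y (contMDiffAt_chart_symm x₀ hy.1)).contMDiffWithinAt

/-- Chain rule for the inverse chart at `x₀` written as the inverse chart at `x₁` after the
transition. The two base points are equal but not definitionally so, hence the comparison takes
place in the model space. -/
theorem chartFrame_transition (x₀ x₁ : M) {y : EuclideanSpace ℝ (Fin n)} (hy : y ∈ overlap x₀ x₁)
    (u : EuclideanSpace ℝ (Fin n)) :
    (chartFrame x₀ y u : EuclideanSpace ℝ (Fin n)) =
      chartFrame x₁ (transition x₀ x₁ y) (fderiv ℝ (transition x₀ x₁) y u) := by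
  have ho := (isOpen_overlap x₀ x₁).mem_nhds hy
  have hτ : MDifferentiableAt 𝓘(ℝ, EuclideanSpace ℝ (Fin n)) 𝓘(ℝ, EuclideanSpace ℝ (Fin n))
      (transition x₀ x₁) y :=
    (((contDiffOn_transition x₀ x₁).contDiffAt ho).differentiableAt (by simp)).mdifferentiableAt
  have ht : transition x₀ x₁ y ∈ (extChartAt (𝓡 n) x₁).target :=
    (extChartAt (𝓡 n) x₁).map_source hy.2
  have heq : (extChartAt (𝓡 n) x₀).symm =ᶠ[𝓝 y] (extChartAt (𝓡 n) x₁).symm ∘ transition x₀ x₁ := by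
    filter_upwards [ho] with z hz
    exact ((extChartAt (𝓡 n) x₁).left_inv hz.2).symm
  have h1 := (mdifferentiableAt_chart_symm x₁ ht).hasMFDerivAt.comp y hτ.hasMFDerivAt
  have h2 := (h1.congr_of_eventuallyEq heq).mfderiv
  rw [mfderiv_eq_fderiv] at h2
  exact congrArg (fun L : EuclideanSpace ℝ (Fin n) →L[ℝ] EuclideanSpace ℝ (Fin n) => L u) h2

theorem inner_congr_point (g : Metric n M) {p q : M} (h : p = q)
    (a b : EuclideanSpace ℝ (Fin n)) :
    g.inner p (show TangentSpace (𝓡 n) p from a) (show TangentSpace (𝓡 n) p from b) =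
      g.inner q (show TangentSpace (𝓡 n) q from a) (show TangentSpace (𝓡 n) q from b) := by
  subst h; rfl

theorem isPullback_transition (g : Metric n M) (x₀ x₁ : M) :
    IsPullback (transition x₀ x₁) (metricInChart g x₀) (overlap x₀ x₁)
      (metricInChart g x₁) (extChartAt (𝓡 n) x₁).target where
  mapsTo y hy := (extChartAt (𝓡 n) x₁).map_source hy.2
  smooth := contDiffOn_transition x₀ x₁
  apply_eq y hy u v := by
    rw [metricInChart_apply, metricInChart_apply]
    have h := inner_congr_point g ((extChartAt (𝓡 n) x₁).left_inv hy.2).symm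
      (chartFrame x₀ y u) (chartFrame x₀ y v)
    refine Eq.trans h ?_
    rw [chartFrame_transition x₀ x₁ hy, chartFrame_transition x₀ x₁ hy]
    rfl

/-- The definition uses a chart that changes with `x`. Invariance allows one fixed chart on its
whole domain, which is what continuity and the conformal law need. -/
theorem scalarCurvature_eq (g : Metric n M) {x₀ x : M} (hx : x ∈ (extChartAt (𝓡 n) x₀).source) :
    scalarCurvature g x =
      scalar stdVec stdCoord (metricInChart g x₀) (extChartAt (𝓡 n) x₀ x) := by
  have hG := isCoordMetric_metricInChart g x
  have hy : extChartAt (𝓡 n) x x ∈ overlap (n := n) x x₀ :=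
    ⟨mem_extChartAt_target x, by simpa using hx⟩
  rw [scalarCurvature, coordScalar_eq hG (mem_extChartAt_target x),
    (isPullback_transition g x x₀).scalar_eq isDualPair_std
      (hG.mono (isOpen_overlap x x₀) Set.inter_subset_left) (isCoordMetric_metricInChart g x₀) hy,
    transition, extChartAt_to_inv]

theorem continuous_scalarCurvature (g : Metric n M) : Continuous (scalarCurvature g) := by
  rw [continuous_iff_continuousAt]
  intro x
  have h1 : ContinuousAt (fun z => scalar stdVec stdCoord (metricInChart g x)
      (extChartAt (𝓡 n) x z)) x :=
    (((isCoordMetric_metricInChart g x).continuousOn_scalar stdVec stdCoord).continuousAt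
      ((isOpen_extChartAt_target x).mem_nhds (mem_extChartAt_target x))).comp
      (continuousAt_extChartAt x)
  refine h1.congr ?_
  filter_upwards [(isOpen_extChartAt_source x).mem_nhds (mem_extChartAt_source (I := 𝓡 n) x)]
    with z hz
  exact (scalarCurvature_eq g hz).symm

/-! ### Functions in a chart -/

theorem contDiffOn_comp_chart_symm {k : ℕ∞ω} (hk : k ≤ (∞ : ℕ∞ω)) {f : M → ℝ} (hf : ContMDiff (𝓡 n) 𝓘(ℝ, ℝ) k f)
    (x₀ : M) : ContDiffOn ℝ k (fun y => f ((extChartAt (𝓡 n) x₀).symm y))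
      (extChartAt (𝓡 n) x₀).target := by
  rw [← contMDiffOn_iff_contDiffOn]
  exact hf.comp_contMDiffOn ((contMDiffOn_extChartAt_symm (n := ∞) x₀).of_le hk)

theorem fderiv_comp_chart_symm {f : M → ℝ} (x₀ : M) {y : EuclideanSpace ℝ (Fin n)}
    (hy : y ∈ (extChartAt (𝓡 n) x₀).target)
    (hf : MDifferentiableAt (𝓡 n) 𝓘(ℝ, ℝ) f ((extChartAt (𝓡 n) x₀).symm y)) :
    fderiv ℝ (fun y => f ((extChartAt (𝓡 n) x₀).symm y)) y =
      (mvfderiv (𝓡 n) f ((extChartAt (𝓡 n) x₀).symm y)) ∘L (chartFrame x₀ y) := by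
  have h := (hf.hasMFDerivAt.comp y (mdifferentiableAt_chart_symm x₀ hy).hasMFDerivAt).mfderiv
  rw [mfderiv_eq_fderiv] at h
  exact h

/-- The inner product of the gradients of two functions. -/
def gradInner (g : Metric n M) (f₁ f₂ : M → ℝ) (x : M) : ℝ := g.inner x (grad g f₁ x) (grad g f₂ x)

theorem gradInner_eq_mvfderiv (g : Metric n M) (f₁ f₂ : M → ℝ) (x : M) :
    gradInner g f₁ f₂ x = mvfderiv (𝓡 n) f₁ x (grad g f₂ x) :=
  (g.isInnerForm x).apply_inverse _ _

theorem gradInner_comm (g : Metric n M) (f₁ f₂ : M → ℝ) (x : M) :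
    gradInner g f₁ f₂ x = gradInner g f₂ f₁ x := g.symm x _ _

theorem gradInner_self_nonneg (g : Metric n M) (f : M → ℝ) (x : M) : 0 ≤ gradInner g f f x :=
  (g.isInnerForm x).nonneg _

theorem gradInner_chart_symm (g : Metric n M) {f₁ f₂ : M → ℝ} (x₀ : M)
    {y : EuclideanSpace ℝ (Fin n)} (hy : y ∈ (extChartAt (𝓡 n) x₀).target)
    (hf₁ : MDifferentiableAt (𝓡 n) 𝓘(ℝ, ℝ) f₁ ((extChartAt (𝓡 n) x₀).symm y))
    (hf₂ : MDifferentiableAt (𝓡 n) 𝓘(ℝ, ℝ) f₂ ((extChartAt (𝓡 n) x₀).symm y)) :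
    gradInner g f₁ f₂ ((extChartAt (𝓡 n) x₀).symm y) =
      fderiv ℝ (fun y => f₁ ((extChartAt (𝓡 n) x₀).symm y)) y ((metricInChart g x₀ y).inverse
        (fderiv ℝ (fun y => f₂ ((extChartAt (𝓡 n) x₀).symm y)) y)) := by
  rw [gradInner_eq_mvfderiv, fderiv_comp_chart_symm x₀ hy hf₁, fderiv_comp_chart_symm x₀ hy hf₂]
  have hG := (isCoordMetric_metricInChart g x₀).inner y hy
  -- The chart frame is an isometry from the coordinate metric to `g`, so it carries the coordinate
  -- gradient to the gradient.
  have key : grad g f₂ ((extChartAt (𝓡 n) x₀).symm y) = chartFrame x₀ y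
      ((metricInChart g x₀ y).inverse
        ((mvfderiv (𝓡 n) f₂ ((extChartAt (𝓡 n) x₀).symm y)) ∘L (chartFrame x₀ y))) := by
    apply (g.isInnerForm _).inverse_unique
    intro w
    obtain ⟨z, rfl⟩ := (isInvertible_chartFrame x₀ hy).surjective w
    exact hG.apply_inverse ((mvfderiv (𝓡 n) f₂ ((extChartAt (𝓡 n) x₀).symm y)) ∘L
      (chartFrame x₀ y)) z
  rw [key]
  rfl

end Charts

/-! ### The Riemannian measure -/

section Volume

theorem measurableSet_inter_preimage_of_continuousOn {X Y : Type*} [TopologicalSpace X]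
    [MeasurableSpace X] [OpensMeasurableSpace X] [TopologicalSpace Y] [MeasurableSpace Y]
    [BorelSpace Y] {f : X → Y} {s : Set X} (hf : ContinuousOn f s) (hs : MeasurableSet s)
    {t : Set Y} (ht : MeasurableSet t) : MeasurableSet (s ∩ f ⁻¹' t) := by
  have h := (MeasurableEmbedding.subtype_coe hs).measurableSet_image.2
    ((continuousOn_iff_continuous_domRestrict.1 hf).measurable ht)
  convert h using 1
  ext x
  simp [and_comm]

variable {n : ℕ} {M : Type*} [TopologicalSpace M] [ChartedSpace (EuclideanSpace ℝ (Fin n)) M]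
  [IsManifold (𝓡 n) ∞ M]

theorem volumeDensity_eq (g : Metric n M) (x₀ : M) :
    volumeDensity g x₀ = density stdVec (metricInChart g x₀) := rfl

theorem contDiffOn_volumeDensity (g : Metric n M) (x₀ : M) :
    ContDiffOn ℝ ∞ (volumeDensity g x₀) (extChartAt (𝓡 n) x₀).target :=
  (isCoordMetric_metricInChart g x₀).contDiffOn_density stdCoord_stdVec

theorem volumeDensity_transition (g : Metric n M) (x₀ x₁ : M) {y : EuclideanSpace ℝ (Fin n)}
    (hy : y ∈ overlap x₀ x₁) :
    volumeDensity g x₀ y =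
      |(fderiv ℝ (transition x₀ x₁) y).det| * volumeDensity g x₁ (transition x₀ x₁ y) := by
  have hb : ((EuclideanSpace.basisFun (Fin n) ℝ).toBasis : Fin n → EuclideanSpace ℝ (Fin n)) =
      stdVec := by
    ext i
    simp [stdVec]
  have := density_pullback (EuclideanSpace.basisFun (Fin n) ℝ).toBasis
    ((isPullback_transition g x₀ x₁).apply_eq y hy)
  rwa [hb] at this

variable [MeasurableSpace M] [BorelSpace M]

omit [MeasurableSpace M] [BorelSpace M] in
theorem aemeasurable_volumeDensity (g : Metric n M) (x₀ : M) :
    AEMeasurable (fun y => ENNReal.ofReal (volumeDensity g x₀ y))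
      (volume.restrict (extChartAt (𝓡 n) x₀).target) :=
  ((contDiffOn_volumeDensity g x₀).continuousOn.aemeasurable
    (isOpen_extChartAt_target x₀).measurableSet).ennreal_ofReal

omit [IsManifold (𝓡 n) ∞ M] in
theorem aemeasurable_chart_symm (x₀ : M) (ρ : EuclideanSpace ℝ (Fin n) → ℝ≥0∞) :
    AEMeasurable (extChartAt (𝓡 n) x₀).symm
      ((volume.restrict (extChartAt (𝓡 n) x₀).target).withDensity ρ) :=
  ((continuousOn_extChartAt_symm x₀).aemeasurable
    (isOpen_extChartAt_target x₀).measurableSet).mono_ac (withDensity_absolutelyContinuous _ _)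

omit [IsManifold (𝓡 n) ∞ M] in
theorem measurableSet_chart_preimage (x₀ : M) {A : Set M} (hA : MeasurableSet A) :
    MeasurableSet ((extChartAt (𝓡 n) x₀).target ∩ (extChartAt (𝓡 n) x₀).symm ⁻¹' A) :=
  measurableSet_inter_preimage_of_continuousOn (continuousOn_extChartAt_symm x₀)
    (isOpen_extChartAt_target x₀).measurableSet hA

theorem chartVolume_apply (g : Metric n M) (x₀ : M) {A : Set M} (hA : MeasurableSet A) :
    chartVolume g x₀ A =
      ∫⁻ y in (extChartAt (𝓡 n) x₀).target ∩ (extChartAt (𝓡 n) x₀).symm ⁻¹' A,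
        ENNReal.ofReal (volumeDensity g x₀ y) := by
  rw [chartVolume, Measure.map_apply_of_aemeasurable (aemeasurable_chart_symm x₀ _) hA,
    withDensity_apply', Measure.restrict_restrict' (isOpen_extChartAt_target x₀).measurableSet,
    Set.inter_comm]

theorem chartVolume_inter_source (g : Metric n M) (x₀ : M) {A : Set M} (hA : MeasurableSet A) :
    chartVolume g x₀ A = chartVolume g x₀ (A ∩ (extChartAt (𝓡 n) x₀).source) := by
  rw [chartVolume_apply g x₀ hA,
    chartVolume_apply g x₀ (hA.inter (isOpen_extChartAt_source x₀).measurableSet)]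
  congr 2
  ext y
  constructor
  · rintro ⟨h1, h2⟩
    exact ⟨h1, h2, (extChartAt (𝓡 n) x₀).map_target h1⟩
  · rintro ⟨h1, h2, -⟩
    exact ⟨h1, h2⟩

/-- Change of variables along the transition map; its Jacobian is the factor by which the two
densities differ. -/
theorem chartVolume_eq_of_subset (g : Metric n M) (x₀ x₁ : M) {A : Set M} (hA : MeasurableSet A)
    (h₀ : A ⊆ (extChartAt (𝓡 n) x₀).source) (h₁ : A ⊆ (extChartAt (𝓡 n) x₁).source) :
    chartVolume g x₀ A = chartVolume g x₁ A := by
  rw [chartVolume_apply g x₀ hA, chartVolume_apply g x₁ hA]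
  set S := (extChartAt (𝓡 n) x₀).target ∩ (extChartAt (𝓡 n) x₀).symm ⁻¹' A with hS
  have hSo : S ⊆ overlap x₀ x₁ := fun y hy => ⟨hy.1, h₁ hy.2⟩
  have himg : (extChartAt (𝓡 n) x₁).target ∩ (extChartAt (𝓡 n) x₁).symm ⁻¹' A =
      transition x₀ x₁ '' S := by
    ext z
    constructor
    · rintro ⟨hz, hzA⟩
      refine ⟨extChartAt (𝓡 n) x₀ ((extChartAt (𝓡 n) x₁).symm z),
        ⟨(extChartAt (𝓡 n) x₀).map_source (h₀ hzA), ?_⟩, ?_⟩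
      · rw [Set.mem_preimage, (extChartAt (𝓡 n) x₀).left_inv (h₀ hzA)]
        exact hzA
      · rw [transition, (extChartAt (𝓡 n) x₀).left_inv (h₀ hzA),
          (extChartAt (𝓡 n) x₁).right_inv hz]
    · rintro ⟨y, hy, rfl⟩
      refine ⟨(extChartAt (𝓡 n) x₁).map_source (hSo hy).2, ?_⟩
      rw [Set.mem_preimage, transition, (extChartAt (𝓡 n) x₁).left_inv (hSo hy).2]
      exact hy.2
  have hinj : Set.InjOn (transition x₀ x₁) S := by
    intro y hy z hz h
    have h2 := (extChartAt (𝓡 n) x₁).injOn (hSo hy).2 (hSo hz).2 h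
    exact (extChartAt (𝓡 n) x₀).symm.injOn hy.1 hz.1 h2
  have hd : ∀ y ∈ S, HasFDerivWithinAt (transition x₀ x₁) (fderiv ℝ (transition x₀ x₁) y) S y :=
    fun y hy => (((contDiffOn_transition x₀ x₁).contDiffAt ((isOpen_overlap x₀ x₁).mem_nhds
      (hSo hy))).differentiableAt (by simp)).hasFDerivAt.hasFDerivWithinAt
  have hSm : MeasurableSet S := measurableSet_chart_preimage x₀ hA
  rw [himg, lintegral_image_eq_lintegral_abs_det_fderiv_mul volume hSm hd hinj]
  refine setLIntegral_congr_fun hSm fun y hy => ?_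
  rw [volumeDensity_transition g x₀ x₁ (hSo hy), ENNReal.ofReal_mul (abs_nonneg _)]

variable [CompactSpace M]

omit [MeasurableSpace M] [BorelSpace M] [IsManifold (𝓡 n) ∞ M] in
theorem exists_seq_chart_source_cover [Nonempty M] :
    ∃ u : ℕ → M, ⋃ k, (extChartAt (𝓡 n) (u k)).source = Set.univ := by
  obtain ⟨t, ht⟩ := isCompact_univ.elim_finite_subcover
    (fun x : M => (extChartAt (𝓡 n) x).source) (fun x => isOpen_extChartAt_source x)
    (fun x _ => Set.mem_iUnion.2 ⟨x, mem_extChartAt_source x⟩)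
  have hne : (t : Set M).Nonempty := by
    obtain ⟨x⟩ := ‹Nonempty M›
    obtain ⟨y, hy, -⟩ := Set.mem_iUnion₂.1 (ht (Set.mem_univ x))
    exact ⟨y, hy⟩
  obtain ⟨u, hu⟩ := t.countable_toSet.exists_eq_range hne
  refine ⟨u, Set.eq_univ_of_univ_subset fun x hx => ?_⟩
  obtain ⟨y, hy, hxy⟩ := Set.mem_iUnion₂.1 (ht hx)
  have hy' : y ∈ Set.range u := hu ▸ hy
  obtain ⟨k, rfl⟩ := hy'
  exact Set.mem_iUnion.2 ⟨k, hxy⟩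

/-- A supremum of measures is not computed set by set. The upper bound needs one measure that
dominates every `chartVolume`; it is glued from the chart measures on disjoint pieces of a cover by
chart domains. -/
theorem vol_apply_of_subset_source (g : Metric n M) (x₀ : M) {A : Set M} (hA : MeasurableSet A)
    (h₀ : A ⊆ (extChartAt (𝓡 n) x₀).source) : vol g A = chartVolume g x₀ A := by
  refine le_antisymm ?_ (le_iSup (fun x => chartVolume g x) x₀ A)
  have : Nonempty M := ⟨x₀⟩
  obtain ⟨u, hu⟩ := exists_seq_chart_source_cover (n := n) (M := M)
  set D := disjointed fun k => (extChartAt (𝓡 n) (u k)).source with hD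
  have hDm : ∀ k, MeasurableSet (D k) := MeasurableSet.disjointed fun k =>
    (isOpen_extChartAt_source _).measurableSet
  have hDs : ∀ k, D k ⊆ (extChartAt (𝓡 n) (u k)).source := fun k => disjointed_subset _ k
  have hdecomp : ∀ (μ : Measure M) {B : Set M}, MeasurableSet B → μ B = ∑' k, μ (B ∩ D k) := by
    intro μ B hB
    rw [← measure_iUnion, ← Set.inter_iUnion, iUnion_disjointed, hu, Set.inter_univ]
    · intro i j hij
      exact ((disjoint_disjointed _) hij).mono Set.inter_subset_right Set.inter_subset_right
    · exact fun k => hB.inter (hDm k)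
  set ν := Measure.sum fun k => (chartVolume g (u k)).restrict (D k) with hν
  have hνap : ∀ {B : Set M}, MeasurableSet B → ν B = ∑' k, chartVolume g (u k) (B ∩ D k) := by
    intro B hB
    rw [hν, Measure.sum_apply _ hB]
    exact tsum_congr fun k => Measure.restrict_apply hB
  have hle : vol g ≤ ν := by
    refine iSup_le fun y => Measure.le_iff.2 fun B hB => ?_
    rw [hdecomp _ hB, hνap hB]
    refine ENNReal.tsum_le_tsum fun k => ?_
    have hm : MeasurableSet (B ∩ D k) := hB.inter (hDm k)
    rw [chartVolume_inter_source g y hm, chartVolume_eq_of_subset g y (u k)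
      (hm.inter (isOpen_extChartAt_source y).measurableSet) Set.inter_subset_right
      fun x hx => hDs k hx.1.2]
    exact measure_mono Set.inter_subset_left
  calc vol g A ≤ ν A := hle A
    _ = chartVolume g x₀ A := by
      rw [hνap hA, hdecomp _ hA]
      exact tsum_congr fun k => chartVolume_eq_of_subset g _ _ (hA.inter (hDm k))
        (fun x hx => hDs k hx.2) fun x hx => h₀ hx.1

theorem vol_restrict_source (g : Metric n M) (x₀ : M) :
    (vol g).restrict (extChartAt (𝓡 n) x₀).source = chartVolume g x₀ := by
  ext A hA
  rw [Measure.restrict_apply hA, chartVolume_inter_source g x₀ hA]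
  exact vol_apply_of_subset_source g x₀ (hA.inter (isOpen_extChartAt_source x₀).measurableSet)
    Set.inter_subset_right

/-- In a chart the density is bounded on a compact neighbourhood, so the measure is locally finite,
and `M` is compact. -/
instance isFiniteMeasure_vol (g : Metric n M) : IsFiniteMeasure (vol g) := by
  have : IsLocallyFiniteMeasure (vol g) := by
    refine ⟨fun x => ?_⟩
    have ht := (isOpen_extChartAt_target (I := 𝓡 n) x).mem_nhds (mem_extChartAt_target x)
    obtain ⟨K, hK, hKt, hKc⟩ := local_compact_nhds ht
    have hcont : ContinuousOn (volumeDensity g x) K :=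
      (contDiffOn_volumeDensity g x).continuousOn.mono hKt
    obtain ⟨C, hC⟩ := hKc.exists_bound_of_continuousOn hcont
    refine ⟨(extChartAt (𝓡 n) x).source ∩ extChartAt (𝓡 n) x ⁻¹' (interior K), ?_, ?_⟩
    · exact Filter.inter_mem (extChartAt_source_mem_nhds x)
        ((continuousAt_extChartAt x).preimage_mem_nhds
          (isOpen_interior.mem_nhds (mem_interior_iff_mem_nhds.2 hK)))
    · have hm : MeasurableSet ((extChartAt (𝓡 n) x).source ∩ extChartAt (𝓡 n) x ⁻¹' (interior K)) :=
        ((continuousOn_extChartAt x).isOpen_inter_preimage (isOpen_extChartAt_source x)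
          isOpen_interior).measurableSet
      rw [vol_apply_of_subset_source g x hm Set.inter_subset_left, chartVolume_apply g x hm]
      have hsub : (extChartAt (𝓡 n) x).target ∩ (extChartAt (𝓡 n) x).symm ⁻¹'
          ((extChartAt (𝓡 n) x).source ∩ extChartAt (𝓡 n) x ⁻¹' (interior K)) ⊆ K := by
        rintro y ⟨hy, -, hy2⟩
        rw [Set.mem_preimage, (extChartAt (𝓡 n) x).right_inv hy] at hy2
        exact interior_subset hy2
      calc _ ≤ ∫⁻ y in K, ENNReal.ofReal (volumeDensity g x y) := lintegral_mono_set hsub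
        _ ≤ ∫⁻ y in K, ENNReal.ofReal C := setLIntegral_mono measurable_const fun y hy =>
            ENNReal.ofReal_le_ofReal ((le_abs_self _).trans (hC y hy))
        _ < ⊤ := by
          rw [setLIntegral_const]
          exact ENNReal.mul_lt_top ENNReal.ofReal_lt_top hKc.measure_lt_top
  infer_instance

theorem integral_vol_eq_chart (g : Metric n M) (x₀ : M) {F : M → ℝ} (hF : Measurable F)
    (hs : ∀ x, x ∉ (extChartAt (𝓡 n) x₀).source → F x = 0) :
    ∫ x, F x ∂(vol g) = ∫ y in (extChartAt (𝓡 n) x₀).target,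
      F ((extChartAt (𝓡 n) x₀).symm y) * volumeDensity g x₀ y := by
  rw [← setIntegral_eq_integral_of_forall_compl_eq_zero hs, vol_restrict_source, chartVolume,
    integral_map (aemeasurable_chart_symm x₀ _) hF.aestronglyMeasurable,
    integral_withDensity_eq_integral_toReal_smul₀ (aemeasurable_volumeDensity g x₀)
      (Eventually.of_forall fun _ => ENNReal.ofReal_lt_top)]
  refine integral_congr_ae (Eventually.of_forall fun y => ?_)
  dsimp only
  rw [ENNReal.toReal_ofReal (show 0 ≤ volumeDensity g x₀ y from Real.sqrt_nonneg _), smul_eq_mul, mul_comm]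

end Volume

/-! ### Green's formula -/

section Green

variable {n : ℕ} {M : Type*} [TopologicalSpace M] [ChartedSpace (EuclideanSpace ℝ (Fin n)) M]
  [IsManifold (𝓡 n) ∞ M]

omit [IsManifold (𝓡 n) ∞ M] in
theorem mdifferentiableAt_of_smooth {f : M → ℝ} (hf : ContMDiff (𝓡 n) 𝓘(ℝ, ℝ) ∞ f) (x : M) :
    MDifferentiableAt (𝓡 n) 𝓘(ℝ, ℝ) f x := hf.mdifferentiableAt (by simp)

theorem continuous_gradInner (g : Metric n M) {f₁ f₂ : M → ℝ} (hf₁ : ContMDiff (𝓡 n) 𝓘(ℝ, ℝ) ∞ f₁)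
    (hf₂ : ContMDiff (𝓡 n) 𝓘(ℝ, ℝ) ∞ f₂) : Continuous (gradInner g f₁ f₂) := by
  rw [continuous_iff_continuousAt]
  intro x
  have ht := (isOpen_extChartAt_target (I := 𝓡 n) x).mem_nhds (mem_extChartAt_target x)
  have hG := (isCoordMetric_metricInChart g x).contDiffAt_inverse (mem_extChartAt_target x)
  have h1 := ((contDiffOn_comp_chart_symm le_rfl hf₁ x).contDiffAt ht).fderiv_right
    (m := ∞) (by simp)
  have h2 := ((contDiffOn_comp_chart_symm le_rfl hf₂ x).contDiffAt ht).fderiv_right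
    (m := ∞) (by simp)
  have h3 := (h1.clm_apply (hG.clm_apply h2)).continuousAt.comp (continuousAt_extChartAt x)
  refine h3.congr ?_
  filter_upwards [extChartAt_source_mem_nhds (I := 𝓡 n) x] with z hz
  have hzt := (extChartAt (𝓡 n) x).map_source hz
  have := gradInner_chart_symm g x hzt (mdifferentiableAt_of_smooth hf₁ _)
    (mdifferentiableAt_of_smooth hf₂ _)
  rw [(extChartAt (𝓡 n) x).left_inv hz] at this
  exact this.symm

theorem gradInner_sum_left (g : Metric n M) {ι : Type*} (s : Finset ι) {φ : ι → M → ℝ}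
    (hφ : ∀ i, ContMDiff (𝓡 n) 𝓘(ℝ, ℝ) ∞ (φ i)) (f : M → ℝ) (x : M) :
    gradInner g (fun z => ∑ i ∈ s, φ i z) f x = ∑ i ∈ s, gradInner g (φ i) f x := by
  classical
  induction s using Finset.induction_on with
  | empty =>
    simp only [Finset.sum_empty, gradInner_eq_mvfderiv, mvfderiv_const]
    rfl
  | insert i s hi ih =>
    simp only [Finset.sum_insert hi]
    rw [← ih]
    simp only [gradInner_eq_mvfderiv]
    rw [mvfderiv_fun_add (mdifferentiableAt_of_smooth (hφ i) x)
      (mdifferentiableAt_of_smooth (contMDiff_finsetSum fun i _ => hφ i) x)]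
    rfl

theorem gradInner_mul_left (g : Metric n M) {φ ψ : M → ℝ} (hφ : ContMDiff (𝓡 n) 𝓘(ℝ, ℝ) ∞ φ)
    (hψ : ContMDiff (𝓡 n) 𝓘(ℝ, ℝ) ∞ ψ) (f : M → ℝ) (x : M) :
    gradInner g (φ * ψ) f x = φ x * gradInner g ψ f x + ψ x * gradInner g φ f x := by
  simp only [gradInner_eq_mvfderiv]
  rw [mvfderiv_mul (mdifferentiableAt_of_smooth hφ x) (mdifferentiableAt_of_smooth hψ x)]
  rfl

theorem gradInner_eq_zero_of_notMem_tsupport (g : Metric n M) {φ : M → ℝ} (f : M → ℝ) {x : M}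
    (hx : x ∉ tsupport φ) : gradInner g φ f x = 0 := by
  have heq : φ =ᶠ[𝓝 x] fun _ => 0 := by
    filter_upwards [(isClosed_tsupport φ).isOpen_compl.mem_nhds hx] with z hz
    exact image_eq_zero_of_notMem_tsupport hz
  have h : mvfderiv (𝓡 n) φ x = 0 := by
    rw [← mvfderiv_const (I := 𝓡 n) (0 : ℝ) (x := x)]
    simp only [mvfderiv, heq.mfderiv_eq]
    rw [heq.self_of_nhds]
  rw [gradInner_eq_mvfderiv, h]
  rfl

/-- The Laplacian of `f`, computed in the preferred chart at `x₀`. -/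
def chartLaplacian (g : Metric n M) (x₀ : M) (f : M → ℝ) (x : M) : ℝ :=
  laplacian stdVec stdCoord (metricInChart g x₀) (fun y => f ((extChartAt (𝓡 n) x₀).symm y))
    (extChartAt (𝓡 n) x₀ x)

theorem continuous_mul_chartLaplacian (g : Metric n M) (x₀ : M) {f φ : M → ℝ}
    (hf : ContMDiff (𝓡 n) 𝓘(ℝ, ℝ) ∞ f) (hφ : Continuous φ)
    (hs : tsupport φ ⊆ (extChartAt (𝓡 n) x₀).source) :
    Continuous fun x => φ x * chartLaplacian g x₀ f x := by
  rw [continuous_iff_continuousAt]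
  intro x
  by_cases hx : x ∈ tsupport φ
  · have hc := (isCoordMetric_metricInChart g x₀).continuousOn_laplacian stdVec stdCoord
      (contDiffOn_comp_chart_symm le_rfl hf x₀)
    have hxs := hs hx
    exact hφ.continuousAt.mul ((hc.continuousAt ((isOpen_extChartAt_target x₀).mem_nhds
      ((extChartAt (𝓡 n) x₀).map_source hxs))).comp (continuousAt_extChartAt' hxs))
  · refine (continuousAt_const (y := (0 : ℝ))).congr ?_
    filter_upwards [(isClosed_tsupport φ).isOpen_compl.mem_nhds hx] with z hz
    rw [image_eq_zero_of_notMem_tsupport hz, zero_mul]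

variable [MeasurableSpace M] [BorelSpace M] [CompactSpace M]

theorem integral_green_of_tsupport_subset (g : Metric n M) (x₀ : M) {f φ : M → ℝ}
    (hf : ContMDiff (𝓡 n) 𝓘(ℝ, ℝ) ∞ f) (hφ : ContMDiff (𝓡 n) 𝓘(ℝ, ℝ) ∞ φ)
    (hs : tsupport φ ⊆ (extChartAt (𝓡 n) x₀).source) :
    ∫ x, (gradInner g φ f x + φ x * chartLaplacian g x₀ f x) ∂(vol g) = 0 := by
  have hcont : Continuous fun x => gradInner g φ f x + φ x * chartLaplacian g x₀ f x :=
    (continuous_gradInner g hφ hf).add (continuous_mul_chartLaplacian g x₀ hf hφ.continuous hs)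
  rw [integral_vol_eq_chart g x₀ hcont.measurable]
  swap
  · intro x hx
    have hx' : x ∉ tsupport φ := fun h => hx (hs h)
    rw [gradInner_eq_zero_of_notMem_tsupport g f hx', image_eq_zero_of_notMem_tsupport hx']
    ring
  set Ω := (extChartAt (𝓡 n) x₀).target with hΩ
  have hΩo : IsOpen Ω := isOpen_extChartAt_target x₀
  -- Extension by zero: outside its target the inverse chart has meaningless values. It is smooth
  -- because the support of `φ` has a compact image inside the target.
  set ψ : EuclideanSpace ℝ (Fin n) → ℝ :=
    Ω.indicator fun y => φ ((extChartAt (𝓡 n) x₀).symm y) with hψ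
  have hψeq : ∀ y ∈ Ω, ψ =ᶠ[𝓝 y] fun y => φ ((extChartAt (𝓡 n) x₀).symm y) := by
    intro y hy
    filter_upwards [hΩo.mem_nhds hy] with z hz
    exact Set.indicator_of_mem hz _
  set K := extChartAt (𝓡 n) x₀ '' tsupport φ with hK
  have hKc : IsCompact K :=
    (isClosed_tsupport φ).isCompact.image_of_continuousOn ((continuousOn_extChartAt x₀).mono hs)
  have hKΩ : K ⊆ Ω := by
    rintro _ ⟨x, hx, rfl⟩
    exact (extChartAt (𝓡 n) x₀).map_source (hs hx)
  have hψK : ∀ y, y ∉ K → ψ y = 0 := by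
    intro y hy
    by_cases hyΩ : y ∈ Ω
    · rw [hψ, Set.indicator_of_mem hyΩ]
      apply image_eq_zero_of_notMem_tsupport
      intro h
      exact hy ⟨_, h, (extChartAt (𝓡 n) x₀).right_inv hyΩ⟩
    · exact Set.indicator_of_notMem hyΩ _
  have hts : tsupport ψ ⊆ K := closure_minimal (fun y hy => by
    by_contra h
    exact hy (hψK y h)) hKc.isClosed
  have hψd : ContDiff ℝ 1 ψ := by
    rw [contDiff_iff_contDiffAt]
    intro y
    by_cases hy : y ∈ Ω
    · exact (((contDiffOn_comp_chart_symm le_rfl hφ x₀).contDiffAt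
        (hΩo.mem_nhds hy)).of_le (by simp)).congr_of_eventuallyEq (hψeq y hy)
    · have hyK : y ∉ K := fun h => hy (hKΩ h)
      refine (contDiffAt_const (c := (0 : ℝ))).congr_of_eventuallyEq ?_
      filter_upwards [hKc.isClosed.isOpen_compl.mem_nhds hyK] with z hz
      exact hψK z hz
  have key := (isCoordMetric_metricInChart g x₀).integral_green (μ := volume) isDualPair_std
    stdCoord_stdVec (contDiffOn_comp_chart_symm le_rfl hf x₀) hψd
    (HasCompactSupport.of_support_subset_isCompact hKc ((subset_tsupport ψ).trans hts))
    (hts.trans hKΩ)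
  rw [← key]
  refine setIntegral_congr_fun hΩo.measurableSet fun y hy => ?_
  have hr := (extChartAt (𝓡 n) x₀).right_inv hy
  simp only [(hψeq y hy).fderiv_eq, (hψeq y hy).self_of_nhds, chartLaplacian, hr,
    gradInner_chart_symm g x₀ hy (mdifferentiableAt_of_smooth hφ _)
      (mdifferentiableAt_of_smooth hf _), volumeDensity_eq]

omit [MeasurableSpace M] [BorelSpace M] in
theorem exists_finite_smooth_partition [T2Space M] :
    ∃ (t : Finset M) (χ : M → M → ℝ), (∀ i, ContMDiff (𝓡 n) 𝓘(ℝ, ℝ) ∞ (χ i)) ∧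
      (∀ x, ∑ i ∈ t, χ i x = 1) ∧ ∀ i, tsupport (χ i) ⊆ (extChartAt (𝓡 n) i).source := by
  classical
  obtain ⟨t, ht⟩ := isCompact_univ.elim_finite_subcover
    (fun x : M => (extChartAt (𝓡 n) x).source) (fun x => isOpen_extChartAt_source x)
    (fun x _ => Set.mem_iUnion.2 ⟨x, mem_extChartAt_source x⟩)
  obtain ⟨p, hp⟩ := SmoothPartitionOfUnity.exists_isSubordinate (𝓡 n) (isClosed_univ (X := M))
    (fun i : t => (extChartAt (𝓡 n) (i : M)).source) (fun i => isOpen_extChartAt_source _)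
    (fun x hx => by
      obtain ⟨i, hi, hxi⟩ := Set.mem_iUnion₂.1 (ht hx)
      exact Set.mem_iUnion.2 ⟨⟨i, hi⟩, hxi⟩)
  -- Setting the functions outside `t` to zero indexes the family by `M` itself instead of a
  -- subtype.
  refine ⟨t, fun i => if hi : i ∈ t then p ⟨i, hi⟩ else 0, fun i => ?_, fun x => ?_, fun i => ?_⟩
  · by_cases hi : i ∈ t
    · simpa [hi] using (p ⟨i, hi⟩).contMDiff
    · simp only [hi, dif_neg, not_false_eq_true]
      exact contMDiff_const
  · have h1 := p.sum_eq_one (Set.mem_univ x)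
    rw [finsum_eq_sum_of_fintype] at h1
    rw [← h1, ← Finset.sum_attach t, Finset.univ_eq_attach]
    refine Finset.sum_congr rfl fun i _ => ?_
    simp
  · by_cases hi : i ∈ t
    · simpa [hi] using hp ⟨i, hi⟩
    · simp [hi, tsupport]

omit [IsManifold (𝓡 n) ∞ M] in
theorem integrable_vol_of_continuous [IsManifold (𝓡 n) ∞ M] (g : Metric n M) {F : M → ℝ}
    (hF : Continuous F) : Integrable F (vol g) := by
  obtain ⟨C, hC⟩ := isCompact_univ.exists_bound_of_continuousOn hF.continuousOn
  exact Integrable.of_bound hF.measurable.aestronglyMeasurable C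
    (Eventually.of_forall fun x => hC x (Set.mem_univ x))

/-- Every smooth function has a weak Laplacian, which can be computed in charts. -/
theorem exists_weak_laplacian [T2Space M] (g : Metric n M) {f : M → ℝ}
    (hf : ContMDiff (𝓡 n) 𝓘(ℝ, ℝ) ∞ f) :
    ∃ L : M → ℝ, Continuous L ∧
      (∀ φ : M → ℝ, ContMDiff (𝓡 n) 𝓘(ℝ, ℝ) ∞ φ →
        ∫ x, gradInner g φ f x ∂(vol g) = -∫ x, φ x * L x ∂(vol g)) ∧
      ∀ x c, (∀ x₀, x ∈ (extChartAt (𝓡 n) x₀).source → chartLaplacian g x₀ f x = c) → L x = c := by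
  obtain ⟨t, χ, hχ, hsum, hs⟩ := exists_finite_smooth_partition (n := n) (M := M)
  have hLc : ∀ i, Continuous fun x => χ i x * chartLaplacian g i f x := fun i =>
    continuous_mul_chartLaplacian g i hf (hχ i).continuous (hs i)
  refine ⟨fun x => ∑ i ∈ t, χ i x * chartLaplacian g i f x,
    continuous_finsetSum _ fun i _ => hLc i, fun φ hφ => ?_, fun x c hc => ?_⟩
  · have hχφ : ∀ i, ContMDiff (𝓡 n) 𝓘(ℝ, ℝ) ∞ (χ i * φ) := fun i => (hχ i).mul hφ
    have hsφ : ∀ i, tsupport (χ i * φ) ⊆ (extChartAt (𝓡 n) i).source := fun i =>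
      (tsupport_mul_subset_left).trans (hs i)
    have hsumφ : φ = fun x => ∑ i ∈ t, (χ i * φ) x := by
      ext x
      simp [← Finset.sum_mul, hsum]
    have hc1 : ∀ i, Continuous (gradInner g (χ i * φ) f) := fun i =>
      continuous_gradInner g (hχφ i) hf
    have hc2 : ∀ i, Continuous fun x => (χ i * φ) x * chartLaplacian g i f x := fun i =>
      continuous_mul_chartLaplacian g i hf (hχφ i).continuous (hsφ i)
    have h1 : ∀ i, ∫ x, gradInner g (χ i * φ) f x ∂(vol g) =
        -∫ x, (χ i * φ) x * chartLaplacian g i f x ∂(vol g) := by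
      intro i
      have h := integral_green_of_tsupport_subset g i hf (hχφ i) (hsφ i)
      rw [integral_add (integrable_vol_of_continuous g (hc1 i))
        (integrable_vol_of_continuous g (hc2 i))] at h
      linarith
    calc ∫ x, gradInner g φ f x ∂(vol g)
        = ∫ x, ∑ i ∈ t, gradInner g (χ i * φ) f x ∂(vol g) := by
          conv_lhs => rw [hsumφ]
          simp_rw [gradInner_sum_left g t hχφ]
      _ = ∑ i ∈ t, -∫ x, (χ i * φ) x * chartLaplacian g i f x ∂(vol g) := by
          rw [integral_finsetSum _ fun i _ => integrable_vol_of_continuous g (hc1 i)]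
          exact Finset.sum_congr rfl fun i _ => h1 i
      _ = -∫ x, ∑ i ∈ t, (χ i * φ) x * chartLaplacian g i f x ∂(vol g) := by
          rw [integral_finsetSum _ fun i _ => integrable_vol_of_continuous g (hc2 i),
            Finset.sum_neg_distrib]
      _ = _ := by
          congr 2
          ext x
          rw [Finset.mul_sum]
          refine Finset.sum_congr rfl fun i _ => ?_
          simp only [Pi.mul_apply]
          ring
  -- If all charts give the same Laplacian at `x`, the weighted sum is that value. Thus the chart
  -- independence of the Laplacian need not be proved in general.
  · have : ∀ i ∈ t, χ i x * chartLaplacian g i f x = χ i x * c := by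
      intro i _
      by_cases hx : x ∈ tsupport (χ i)
      · rw [hc i (hs i hx)]
      · rw [image_eq_zero_of_notMem_tsupport hx, zero_mul, zero_mul]
    beta_reduce
    rw [Finset.sum_congr rfl this, ← Finset.sum_mul, hsum, one_mul]

end Green

/-! ### Conformal changes of metric -/

section ConformalChange

variable {n : ℕ} {M : Type*} [TopologicalSpace M] [ChartedSpace (EuclideanSpace ℝ (Fin n)) M]
  [IsManifold (𝓡 n) ∞ M]

/-- `h = w ^ (4 / (n - 2)) g` with `w` smooth and positive. -/
structure IsConformalFactor (g h : Metric n M) (w : M → ℝ) : Prop where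
  smooth : ContMDiff (𝓡 n) 𝓘(ℝ, ℝ) ∞ w
  pos : ∀ x, 0 < w x
  inner_eq : ∀ (x : M) (a b : TangentSpace (𝓡 n) x),
    h.inner x a b = (w x) ^ (4 / ((n : ℝ) - 2)) * g.inner x a b

namespace IsConformalFactor

variable {g h : Metric n M} {w : M → ℝ}

theorem metricInChart_eq (H : IsConformalFactor g h w) (x₀ : M) (y : EuclideanSpace ℝ (Fin n)) :
    metricInChart h x₀ y =
      (w ((extChartAt (𝓡 n) x₀).symm y)) ^ (4 / ((n : ℝ) - 2)) • metricInChart g x₀ y := by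
  ext a b
  simp only [smul_apply, smul_eq_mul, metricInChart_apply, H.inner_eq]

theorem volumeDensity_eq (H : IsConformalFactor g h w) (hn : 3 ≤ n) (x₀ : M)
    (y : EuclideanSpace ℝ (Fin n)) :
    volumeDensity h x₀ y = (w ((extChartAt (𝓡 n) x₀).symm y)) ^ (4 / ((n : ℝ) - 2) + 2) *
      volumeDensity g x₀ y := by
  have hn' : (3 : ℝ) ≤ n := by exact_mod_cast hn
  set c := w ((extChartAt (𝓡 n) x₀).symm y) with hc
  have hc0 : 0 < c := H.pos _
  have h1 : (Matrix.of fun i j : Fin n => metricInChart h x₀ y (stdVec i) (stdVec j)) =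
      (c ^ (4 / ((n : ℝ) - 2))) •
        Matrix.of fun i j : Fin n => metricInChart g x₀ y (stdVec i) (stdVec j) := by
    ext i j
    simp [H.metricInChart_eq, hc]
  -- Both exponents are `4n/(n-2)`; the density therefore scales with `4/(n-2) + 2 = 2n/(n-2) = 2*`.
  have h2 : (c ^ (4 / ((n : ℝ) - 2))) ^ n = (c ^ (4 / ((n : ℝ) - 2) + 2)) ^ 2 := by
    rw [← Real.rpow_mul_natCast hc0.le, ← Real.rpow_mul_natCast hc0.le]
    congr 1
    have : (n : ℝ) - 2 ≠ 0 := by linarith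
    field_simp
    push_cast
    ring
  rw [volumeDensity, h1, Matrix.det_smul, Fintype.card_fin, h2,
    Real.sqrt_mul (sq_nonneg _), Real.sqrt_sq (Real.rpow_nonneg hc0.le _), volumeDensity]

theorem gradInner_eq (H : IsConformalFactor g h w) (f₁ f₂ : M → ℝ) (x : M) :
    (w x) ^ (4 / ((n : ℝ) - 2)) * gradInner h f₁ f₂ x = gradInner g f₁ f₂ x := by
  have hc : 0 < (w x) ^ (4 / ((n : ℝ) - 2)) := Real.rpow_pos_of_pos (H.pos x) _
  have h1 : h.inner x = (w x) ^ (4 / ((n : ℝ) - 2)) • g.inner x := by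
    ext a b
    exact H.inner_eq x a b
  have h2 : grad h f₂ x = ((w x) ^ (4 / ((n : ℝ) - 2)))⁻¹ • grad g f₂ x := by
    rw [grad, h1, (g.isInnerForm x).inverse_smul hc]
    rfl
  rw [gradInner_eq_mvfderiv, gradInner_eq_mvfderiv, h2, map_smul, smul_eq_mul,
    mul_inv_cancel_left₀ hc.ne']

theorem scalarCurvature_eq (H : IsConformalFactor g h w) (hn : 3 ≤ n) {x x₀ : M}
    (hx : x ∈ (extChartAt (𝓡 n) x₀).source) :
    (w x) ^ (4 / ((n : ℝ) - 2)) * w x * scalarCurvature h x =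
      scalarCurvature g x * w x -
        4 * (((n : ℝ) - 1) / ((n : ℝ) - 2)) * chartLaplacian g x₀ w x := by
  have hn' : (3 : ℝ) ≤ n := by exact_mod_cast hn
  have hs := IsCoordMetric.scalar_conformal (isDualPair_std (n := n)) (d := (n : ℝ))
    sum_stdCoord_stdVec (by linarith) (isCoordMetric_metricInChart g x₀)
    (isCoordMetric_metricInChart h x₀)
    (w := fun y => w ((extChartAt (𝓡 n) x₀).symm y))
    (contDiffOn_comp_chart_symm le_rfl H.smooth x₀) (fun y _ => H.pos _)
    (fun y _ => H.metricInChart_eq x₀ y) ((extChartAt (𝓡 n) x₀).map_source hx)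
  rw [← YamabeObstacle.scalarCurvature_eq h hx, ← YamabeObstacle.scalarCurvature_eq g hx,
    (extChartAt (𝓡 n) x₀).left_inv hx] at hs
  exact hs

variable [MeasurableSpace M] [BorelSpace M] [CompactSpace M] [T2Space M]

/-- The law `dV_h = w^{2*} dV_g`, reduced to the densities in charts by a partition of unity. -/
theorem integral_vol (H : IsConformalFactor g h w) (hn : 3 ≤ n) {F : M → ℝ} (hF : Continuous F) :
    ∫ x, F x ∂(vol h) = ∫ x, F x * (w x) ^ (4 / ((n : ℝ) - 2) + 2) ∂(vol g) := by
  obtain ⟨t, χ, hχ, hsum, hs⟩ := exists_finite_smooth_partition (n := n) (M := M)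
  have hwc : Continuous fun x => (w x) ^ (4 / ((n : ℝ) - 2) + 2) :=
    H.smooth.continuous.rpow_const fun x => Or.inl (H.pos x).ne'
  have hc1 : ∀ i, Continuous fun x => χ i x * F x := fun i => (hχ i).continuous.mul hF
  have hc2 : ∀ i, Continuous fun x => χ i x * F x * (w x) ^ (4 / ((n : ℝ) - 2) + 2) :=
    fun i => (hc1 i).mul hwc
  have h1 : ∀ x, F x = ∑ i ∈ t, χ i x * F x := fun x => by
    rw [← Finset.sum_mul, hsum, one_mul]
  have h2 : ∀ x, F x * (w x) ^ (4 / ((n : ℝ) - 2) + 2) =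
      ∑ i ∈ t, χ i x * F x * (w x) ^ (4 / ((n : ℝ) - 2) + 2) := fun x => by
    rw [← Finset.sum_mul, ← h1]
  have hz : ∀ i x, x ∉ (extChartAt (𝓡 n) i).source → χ i x = 0 := fun i x hx =>
    image_eq_zero_of_notMem_tsupport fun h => hx (hs i h)
  rw [integral_congr_ae (Eventually.of_forall h1), integral_congr_ae (Eventually.of_forall h2),
    integral_finsetSum _ fun i _ => integrable_vol_of_continuous h (hc1 i),
    integral_finsetSum _ fun i _ => integrable_vol_of_continuous g (hc2 i)]
  refine Finset.sum_congr rfl fun i _ => ?_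
  rw [integral_vol_eq_chart h i (hc1 i).measurable (fun x hx => by rw [hz i x hx, zero_mul]),
    integral_vol_eq_chart g i (hc2 i).measurable
      (fun x hx => by rw [hz i x hx, zero_mul, zero_mul])]
  refine integral_congr_ae (Eventually.of_forall fun y => ?_)
  simp only [H.volumeDensity_eq hn]
  ring

end IsConformalFactor

variable [MeasurableSpace M]

/-- The form `⟨f₁, f₂⟩_g` on smooth functions. -/
def smoothForm (g : Metric n M) (f₁ f₂ : M → ℝ) : ℝ :=
  4 * (((n : ℝ) - 1) / ((n : ℝ) - 2)) * ∫ x, gradInner g f₁ f₂ x ∂(vol g)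
    + ∫ x, scalarCurvature g x * f₁ x * f₂ x ∂(vol g)

variable [BorelSpace M] [CompactSpace M] [T2Space M]

/-- The conformal covariance of the form `⟨f, f⟩_g`. -/
theorem IsConformalFactor.smoothForm_eq {g h : Metric n M} {w : M → ℝ}
    (H : IsConformalFactor g h w) (hn : 3 ≤ n) {f : M → ℝ} (hf : ContMDiff (𝓡 n) 𝓘(ℝ, ℝ) ∞ f) :
    smoothForm h f f = smoothForm g (w * f) (w * f) := by
  obtain ⟨L, hL, hLφ, hLc⟩ := exists_weak_laplacian g H.smooth
  set a : ℝ := 4 * (((n : ℝ) - 1) / ((n : ℝ) - 2)) with ha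
  set p : ℝ := 4 / ((n : ℝ) - 2) with hp
  have ha0 : a ≠ 0 := by
    have hn' : (3 : ℝ) ≤ n := by exact_mod_cast hn
    have : 0 < a := by
      rw [ha]
      have h1 : 0 < (n : ℝ) - 1 := by linarith
      have h2 : 0 < (n : ℝ) - 2 := by linarith
      positivity
    exact this.ne'
  -- The conformal law, solved for the Laplacian of `w`, has the same value in every chart around
  -- `x`, and so identifies `L x`.
  have hR : ∀ x, (w x) ^ p * w x * scalarCurvature h x =
      scalarCurvature g x * w x - a * L x := by
    intro x
    have := hLc x ((scalarCurvature g x * w x - (w x) ^ p * w x * scalarCurvature h x) / a)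
      fun x₀ hx₀ => by
        rw [H.scalarCurvature_eq hn hx₀, ← ha]
        field_simp
        ring
    rw [this]
    field_simp
    ring
  have hw := H.smooth
  have hwf := hw.mul hf
  have hpow : ∀ x, (w x) ^ (p + 2) = (w x) ^ p * (w x) ^ 2 := fun x => by
    rw [Real.rpow_add (H.pos x), Real.rpow_two]
  -- Pointwise `|∇(wf)|² = w²|∇f|² + ⟨∇(wf²), ∇w⟩`. Green's formula turns the last term into `-∫ wf²
  -- Δw`, which matches the Laplacian term of the scalar curvature of `h`.
  have hgrad : ∀ x, gradInner g (w * f) (w * f) x =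
      (w x) ^ 2 * gradInner g f f x + gradInner g (w * f * f) w x := by
    intro x
    rw [gradInner_mul_left g hwf hf, gradInner_mul_left g hw hf, gradInner_mul_left g hw hf,
      gradInner_comm g f (w * f), gradInner_comm g w (w * f), gradInner_mul_left g hw hf,
      gradInner_mul_left g hw hf, gradInner_comm g w f]
    simp only [Pi.mul_apply]
    ring
  have hwfc := hw.continuous
  have hfc := hf.continuous
  have hRg := continuous_scalarCurvature g
  have hRh := continuous_scalarCurvature h
  have hgi := continuous_gradInner g hf hf
  have e1 : ∫ x, gradInner h f f x ∂(vol h) = ∫ x, (w x) ^ 2 * gradInner g f f x ∂(vol g) := by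
    rw [H.integral_vol hn (continuous_gradInner h hf hf)]
    refine integral_congr_ae (Eventually.of_forall fun x => ?_)
    beta_reduce
    rw [hpow, ← H.gradInner_eq f f x]
    ring
  have e2 : ∫ x, scalarCurvature h x * f x * f x ∂(vol h) =
      ∫ x, scalarCurvature g x * (w * f) x * (w * f) x ∂(vol g) -
        a * ∫ x, (w * f * f) x * L x ∂(vol g) := by
    have hc : Continuous fun x => scalarCurvature h x * f x * f x := (hRh.mul hfc).mul hfc
    have hc1 : Continuous fun x => scalarCurvature g x * (w * f) x * (w * f) x :=
      (hRg.mul hwf.continuous).mul hwf.continuous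
    have hc2 : Continuous fun x => a * ((w * f * f) x * L x) :=
      continuous_const.mul ((hwf.mul hf).continuous.mul hL)
    rw [H.integral_vol hn hc, ← integral_const_mul, ← integral_sub
      (integrable_vol_of_continuous g hc1) (integrable_vol_of_continuous g hc2)]
    refine integral_congr_ae (Eventually.of_forall fun x => ?_)
    beta_reduce
    rw [hpow]
    simp only [Pi.mul_apply]
    linear_combination (w x * f x * f x) * hR x
  have e3 : ∫ x, gradInner g (w * f) (w * f) x ∂(vol g) =
      ∫ x, (w x) ^ 2 * gradInner g f f x ∂(vol g) - ∫ x, (w * f * f) x * L x ∂(vol g) := by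
    have hc : Continuous fun x => (w x) ^ 2 * gradInner g f f x := (hwfc.pow 2).mul hgi
    rw [sub_eq_add_neg, ← hLφ _ (hwf.mul hf), ← integral_add
      (integrable_vol_of_continuous g hc)
      (integrable_vol_of_continuous g (continuous_gradInner g (hwf.mul hf) hw))]
    exact integral_congr_ae (Eventually.of_forall hgrad)
  rw [smoothForm, smoothForm, e1, e2, e3, ← ha]
  ring

end ConformalChange

/-! ### Convergence with respect to a positive definite form -/

/-- First `η` makes the fixed term small, then `k` the other. This is the shape in which Young's
inequality bounds the difference of two quadratic expressions. -/
theorem tendsto_of_forall_abs_sub_le {a d : ℕ → ℝ} {l P : ℝ} (hd : Tendsto d atTop (𝓝 0))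
    (h : ∀ η : ℝ, 0 < η → ∀ k, |a k - l| ≤ η * P + (1 + η⁻¹) * d k) :
    Tendsto a atTop (𝓝 l) := by
  rw [Metric.tendsto_atTop]
  intro ε hε
  set η : ℝ := ε / (2 * (|P| + 1)) with hη
  have hP : 0 < |P| + 1 := by positivity
  have hη0 : 0 < η := by positivity
  have h1 : η * P < ε / 2 := by
    have : η * (|P| + 1) = ε / 2 := by rw [hη]; field_simp
    nlinarith [le_abs_self P]
  have h2 : Tendsto (fun k => (1 + η⁻¹) * d k) atTop (𝓝 0) := by
    simpa using hd.const_mul (1 + η⁻¹)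
  obtain ⟨N, hN⟩ := eventually_atTop.1 (h2.eventually (gt_mem_nhds (half_pos hε)))
  refine ⟨N, fun k hk => ?_⟩
  rw [Real.dist_eq]
  linarith [h η hη0 k, hN k hk]

namespace IsInnerForm

variable {V : Type*} [AddCommGroup V] [Module ℝ V] [TopologicalSpace V]
  [IsTopologicalAddGroup V] [ContinuousSMul ℝ V] {b : V →L[ℝ] V →L[ℝ] ℝ}

theorem sub_sub_le (hb : IsInnerForm b) (u v w : V) :
    b (u - v) (u - v) ≤ 2 * b (u - w) (u - w) + 2 * b (v - w) (v - w) := by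
  have h := hb.nonneg ((u - w) + (v - w))
  have e : u - v = (u - w) - (v - w) := by abel
  rw [e]
  generalize u - w = p at *
  generalize v - w = q at *
  simp only [map_sub, map_add, sub_apply, add_apply] at h ⊢
  linarith

/-- The difference is `2 b v q + b q q` with `q = u - v`; positivity on `η • v ± q` bounds the cross
term as in Young's inequality. -/
theorem abs_sub_le (hb : IsInnerForm b) {η : ℝ} (hη : 0 < η) (u v : V) :
    |b u u - b v v| ≤ η * b v v + (1 + η⁻¹) * b (u - v) (u - v) := by
  have h1 := hb.nonneg (η • v - (u - v))
  have h2 := hb.nonneg (η • v + (u - v))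
  have h3 := hb.nonneg (u - v)
  obtain ⟨q, rfl⟩ : ∃ q, u = v + q := ⟨u - v, by abel⟩
  simp only [add_sub_cancel_left] at *
  have hs := hb.symm q v
  simp only [map_sub, map_add, map_smul, sub_apply, add_apply, smul_apply, smul_eq_mul] at *
  have hi : 0 < η⁻¹ := inv_pos.2 hη
  have e1 : η⁻¹ * (η * (η * b v v)) = η * b v v := by field_simp
  have e2 : η⁻¹ * (η * b v q) = b v q := by field_simp
  have k1 := mul_nonneg hi.le h1
  have k2 := mul_nonneg hi.le h2
  rw [abs_le]
  constructor <;> nlinarith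

theorem tendsto_apply_sub (hb : IsInnerForm b) {v : ℕ → V} {X : V}
    (h : Tendsto (fun k => b (v k - X) (v k - X)) atTop (𝓝 0)) (w : V) :
    Tendsto (fun k => b (w - v k) (w - v k)) atTop (𝓝 (b (w - X) (w - X))) := by
  refine tendsto_of_forall_abs_sub_le h (P := b (w - X) (w - X)) fun η hη k => ?_
  have := hb.abs_sub_le hη (w - v k) (w - X)
  have e : w - v k - (w - X) = -(v k - X) := by abel
  rw [e] at this
  simpa only [map_neg, neg_apply, neg_neg] using this

/-- The form `b` makes `V` a finite-dimensional, hence complete, inner product space. Convergence is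
expressed by `b` alone, so its norm topology need not be compared with the given one. -/
theorem exists_tendsto [FiniteDimensional ℝ V] (hb : IsInnerForm b) {v : ℕ → V}
    (h : Summable fun k => √(b (v (k + 1) - v k) (v (k + 1) - v k))) :
    ∃ X, Tendsto (fun k => b (v k - X) (v k - X)) atTop (𝓝 0) := by
  let c : InnerProductSpace.Core ℝ V :=
    { inner := fun u v => b u v
      conj_inner_symm := fun u v => hb.symm v u
      re_inner_nonneg := fun u => hb.nonneg u
      add_left := fun u v w => by simp
      smul_left := fun u v r => by simp
      definite := fun u hu => hb.eq_zero hu }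
  obtain ⟨X, hX⟩ : ∃ X, Tendsto (fun k => b (v k - X) (v k - X)) atTop (𝓝 0) := by
    let _ : NormedAddCommGroup V := c.toNormedAddCommGroup
    let _ : InnerProductSpace ℝ V := InnerProductSpace.ofCore c.toCore
    have hc : CompleteSpace V := FiniteDimensional.complete ℝ V
    have hn : ∀ u : V, ‖u‖ = √(b u u) := fun u => norm_eq_sqrt_real_inner u
    have hcs : CauchySeq v := by
      refine cauchySeq_of_summable_dist (h.congr fun k => ?_)
      rw [dist_comm, dist_eq_norm, hn]
    obtain ⟨X, hX⟩ := cauchySeq_tendsto_of_complete hcs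
    refine ⟨X, ?_⟩
    have h1 := (tendsto_iff_norm_sub_tendsto_zero.1 hX).pow 2
    rw [zero_pow two_ne_zero] at h1
    refine h1.congr fun k => ?_
    rw [← real_inner_self_eq_norm_sq]
    rfl
  exact ⟨X, hX⟩

end IsInnerForm

/-! ### The Dirichlet energy -/

section Energy

variable {n : ℕ} {M : Type*} [TopologicalSpace M] [ChartedSpace (EuclideanSpace ℝ (Fin n)) M]
  [IsManifold (𝓡 n) ∞ M]

theorem grad_sub (g : Metric n M) {f₁ f₂ : M → ℝ} (hf₁ : ContMDiff (𝓡 n) 𝓘(ℝ, ℝ) ∞ f₁)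
    (hf₂ : ContMDiff (𝓡 n) 𝓘(ℝ, ℝ) ∞ f₂) (x : M) :
    grad g (f₁ - f₂) x = grad g f₁ x - grad g f₂ x := by
  rw [grad, mvfderiv_sub (mdifferentiableAt_of_smooth hf₁ x) (mdifferentiableAt_of_smooth hf₂ x),
    map_sub]
  rfl

theorem gradInner_sub (g : Metric n M) {f₁ f₂ : M → ℝ} (hf₁ : ContMDiff (𝓡 n) 𝓘(ℝ, ℝ) ∞ f₁)
    (hf₂ : ContMDiff (𝓡 n) 𝓘(ℝ, ℝ) ∞ f₂) (x : M) :
    gradInner g (f₁ - f₂) (f₁ - f₂) x =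
      g.inner x (grad g f₁ x - grad g f₂ x) (grad g f₁ x - grad g f₂ x) := by
  rw [gradInner, grad_sub g hf₁ hf₂]

theorem gradInner_sub_expand (g : Metric n M) {f₁ f₂ : M → ℝ}
    (hf₁ : ContMDiff (𝓡 n) 𝓘(ℝ, ℝ) ∞ f₁) (hf₂ : ContMDiff (𝓡 n) 𝓘(ℝ, ℝ) ∞ f₂) (x : M) :
    gradInner g (f₁ - f₂) (f₁ - f₂) x =
      gradInner g f₁ f₁ x + gradInner g f₂ f₂ x - 2 * gradInner g f₁ f₂ x := by
  have := gradInner_comm g f₁ f₂ x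
  rw [gradInner_sub g hf₁ hf₂]
  unfold gradInner at *
  simp only [map_sub, sub_apply]
  linarith

variable [MeasurableSpace M]

/-- The Dirichlet energy `∫ |∇f|²`. -/
def energy (g : Metric n M) (f : M → ℝ) : ℝ := ∫ x, gradInner g f f x ∂(vol g)

theorem energy_nonneg (g : Metric n M) (f : M → ℝ) : 0 ≤ energy g f :=
  integral_nonneg fun x => gradInner_self_nonneg g f x

/-- The smooth functions `f k` converge to `u` in `L²` and form a Cauchy sequence for the
Dirichlet energy. -/
structure IsApprox (g : Metric n M) (f : ℕ → M → ℝ) (u : M → ℝ) : Prop where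
  smooth : ∀ k, ContMDiff (𝓡 n) 𝓘(ℝ, ℝ) ∞ (f k)
  tendsto : Tendsto (fun k => eLpNorm (fun x => f k x - u x) 2 (vol g)) atTop (𝓝 0)
  cauchy : ∀ ε : ℝ, 0 < ε → ∃ N, ∀ j, N ≤ j → ∀ k, N ≤ k → energy g (f j - f k) < ε

variable [BorelSpace M] [CompactSpace M]

theorem lintegral_gradInner (g : Metric n M) {f : M → ℝ} (hf : ContMDiff (𝓡 n) 𝓘(ℝ, ℝ) ∞ f) :
    ∫⁻ x, ENNReal.ofReal (gradInner g f f x) ∂(vol g) = ENNReal.ofReal (energy g f) :=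
  (ofReal_integral_eq_lintegral_ofReal
    (integrable_vol_of_continuous g (continuous_gradInner g hf hf))
    (Eventually.of_forall fun x => gradInner_self_nonneg g f x)).symm

theorem energy_sub_le (g : Metric n M) {f₁ f₂ f₃ : M → ℝ}
    (hf₁ : ContMDiff (𝓡 n) 𝓘(ℝ, ℝ) ∞ f₁) (hf₂ : ContMDiff (𝓡 n) 𝓘(ℝ, ℝ) ∞ f₂)
    (hf₃ : ContMDiff (𝓡 n) 𝓘(ℝ, ℝ) ∞ f₃) :
    energy g (f₁ - f₂) ≤ 2 * energy g (f₁ - f₃) + 2 * energy g (f₂ - f₃) := by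
  have h1 : Integrable (gradInner g (f₁ - f₂) (f₁ - f₂)) (vol g) :=
    integrable_vol_of_continuous g (continuous_gradInner g (hf₁.sub hf₂) (hf₁.sub hf₂))
  have h2 : Integrable (gradInner g (f₁ - f₃) (f₁ - f₃)) (vol g) :=
    integrable_vol_of_continuous g (continuous_gradInner g (hf₁.sub hf₃) (hf₁.sub hf₃))
  have h3 : Integrable (gradInner g (f₂ - f₃) (f₂ - f₃)) (vol g) :=
    integrable_vol_of_continuous g (continuous_gradInner g (hf₂.sub hf₃) (hf₂.sub hf₃))
  rw [energy, energy, energy, ← integral_const_mul, ← integral_const_mul,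
    ← integral_add (h2.const_mul 2) (h3.const_mul 2)]
  refine integral_mono h1 ((h2.const_mul 2).add (h3.const_mul 2)) fun x => ?_
  beta_reduce
  rw [gradInner_sub g hf₁ hf₂, gradInner_sub g hf₁ hf₃, gradInner_sub g hf₂ hf₃]
  exact (g.isInnerForm x).sub_sub_le _ _ _

theorem energy_sub_expand (g : Metric n M) {f₁ f₂ : M → ℝ}
    (hf₁ : ContMDiff (𝓡 n) 𝓘(ℝ, ℝ) ∞ f₁) (hf₂ : ContMDiff (𝓡 n) 𝓘(ℝ, ℝ) ∞ f₂) :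
    energy g (f₁ - f₂) =
      energy g f₁ + energy g f₂ - 2 * ∫ x, gradInner g f₁ f₂ x ∂(vol g) := by
  have h1 := integrable_vol_of_continuous g (continuous_gradInner g hf₁ hf₁)
  have h2 := integrable_vol_of_continuous g (continuous_gradInner g hf₂ hf₂)
  have h3 := integrable_vol_of_continuous g (continuous_gradInner g hf₁ hf₂)
  have h4 : Integrable (fun x => gradInner g f₁ f₁ x + gradInner g f₂ f₂ x) (vol g) := h1.add h2
  rw [energy, energy, energy, ← integral_const_mul, ← integral_add h1 h2,
    ← integral_sub h4 (h3.const_mul 2)]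
  exact integral_congr_ae (Eventually.of_forall fun x => gradInner_sub_expand g hf₁ hf₂ x)

theorem memLp_vol_of_continuous (g : Metric n M) {F : M → ℝ} (hF : Continuous F) (p : ℝ≥0∞) :
    MemLp F p (vol g) := by
  obtain ⟨C, hC⟩ := isCompact_univ.exists_bound_of_continuousOn hF.continuousOn
  exact MemLp.of_bound hF.measurable.aestronglyMeasurable C
    (Eventually.of_forall fun x => hC x (Set.mem_univ x))

/-- Closability of the Dirichlet energy. -/
theorem IsApprox.tendsto_energy_zero [T2Space M] {g : Metric n M} {f : ℕ → M → ℝ}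
    (hf : IsApprox g f 0) : Tendsto (fun k => energy g (f k)) atTop (𝓝 0) := by
  -- For fixed `k` the integral is `-∫ f_j Δf_k`, which vanishes in the limit because `f_j → 0` in
  -- L².
  have key : ∀ k, Tendsto (fun j => ∫ x, gradInner g (f j) (f k) x ∂(vol g)) atTop (𝓝 0) := by
    intro k
    obtain ⟨L, hL, hLφ, -⟩ := exists_weak_laplacian g (hf.smooth k)
    have h0 : Tendsto (fun j => ∫ x, f j x * L x ∂(vol g)) atTop
        (𝓝 (∫ x, (0 : ℝ) ∂(vol g))) := by
      refine tendsto_integral_of_L1' (fun _ => (0 : ℝ)) aestronglyMeasurable_const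
        (Eventually.of_forall fun j =>
          integrable_vol_of_continuous g ((hf.smooth j).continuous.mul hL)) ?_
      have hm := (memLp_vol_of_continuous g hL 2).2.ne
      have h1 : Tendsto (fun j => eLpNorm (fun x => f j x - (0 : M → ℝ) x) 2 (vol g) *
          eLpNorm L 2 (vol g)) atTop (𝓝 0) := by
        simpa using ENNReal.Tendsto.mul_const hf.tendsto (Or.inr hm)
      refine tendsto_of_tendsto_of_tendsto_of_le_of_le tendsto_const_nhds h1
        (fun _ => zero_le) fun j => ?_
      have h2 := eLpNorm_smul_le_mul_eLpNorm (p := 2) (q := 2) (r := 1) (μ := vol g)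
        hL.measurable.aestronglyMeasurable (hf.smooth j).continuous.measurable.aestronglyMeasurable
      have e : ((fun x => f j x * L x) - fun _ => (0 : ℝ)) = f j • L := by
        ext x
        simp
      rw [e]
      simpa only [Pi.zero_apply, sub_zero] using h2
    simp only [integral_zero] at h0
    simpa using h0.neg.congr fun j => (hLφ _ (hf.smooth j)).symm
  rw [Metric.tendsto_atTop]
  intro ε hε
  obtain ⟨N, hN⟩ := hf.cauchy (ε / 2) (half_pos hε)
  refine ⟨N, fun k hk => ?_⟩
  rw [Real.dist_eq, sub_zero, abs_of_nonneg (energy_nonneg g _)]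
  -- The energy of `f_k` is at most that of `f_j - f_k` plus twice the mixed integral; now `j → ∞`.
  have h1 : Tendsto (fun j => ε / 2 + 2 * ∫ x, gradInner g (f j) (f k) x ∂(vol g)) atTop
      (𝓝 (ε / 2)) := by
    simpa using ((key k).const_mul 2).const_add (ε / 2)
  refine lt_of_le_of_lt (ge_of_tendsto h1 ?_) (half_lt_self hε)
  filter_upwards [eventually_ge_atTop N] with j hj
  have h2 := hN j hj k hk
  rw [energy_sub_expand g (hf.smooth j) (hf.smooth k)] at h2
  linarith [energy_nonneg g (f j)]

end Energy

theorem two_mul_ofReal (r : ℝ) : 2 * ENNReal.ofReal r = ENNReal.ofReal (2 * r) := by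
  rw [ENNReal.ofReal_mul zero_le_two, ENNReal.ofReal_ofNat]

/-! ### Weak gradients -/

section WeakGradient

variable {n : ℕ} {M : Type*} [TopologicalSpace M] [ChartedSpace (EuclideanSpace ℝ (Fin n)) M]
  [IsManifold (𝓡 n) ∞ M] [MeasurableSpace M] [BorelSpace M] [CompactSpace M]
  {g : Metric n M} {u : M → ℝ} {X : ∀ x : M, TangentSpace (𝓡 n) x}

omit [BorelSpace M] [CompactSpace M] in
theorem exists_subseq_tendsto_ae {f : ℕ → M → ℝ}
    (hm : ∀ k, AEMeasurable
      (fun x => g.inner x (grad g (f k) x - X x) (grad g (f k) x - X x)) (vol g))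
    (ht : Tendsto (fun k => ∫⁻ x, ENNReal.ofReal
      (g.inner x (grad g (f k) x - X x) (grad g (f k) x - X x)) ∂(vol g)) atTop (𝓝 0)) :
    ∃ ns : ℕ → ℕ, StrictMono ns ∧ ∀ᵐ x ∂(vol g), Tendsto (fun k =>
      g.inner x (grad g (f (ns k)) x - X x) (grad g (f (ns k)) x - X x)) atTop (𝓝 0) := by
  refine (tendstoInMeasure_of_tendsto_eLpNorm (p := 1) (g := fun _ : M => (0 : ℝ)) one_ne_zero
    (fun k => (hm k).aestronglyMeasurable) aestronglyMeasurable_const ?_).exists_seq_tendsto_ae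
  refine ht.congr fun k => ?_
  rw [eLpNorm_one_eq_lintegral_enorm]
  refine lintegral_congr fun x => ?_
  rw [Pi.sub_apply, sub_zero, Real.enorm_of_nonneg ((g.isInnerForm x).nonneg _)]

omit [CompactSpace M] in
/-- The squared distance of `X` to a gradient is measurable if `X` is an almost everywhere limit
of gradients. -/
theorem aemeasurable_inner_grad_sub {f : ℕ → M → ℝ}
    (hf : ∀ k, ContMDiff (𝓡 n) 𝓘(ℝ, ℝ) ∞ (f k))
    (h : ∀ᵐ x ∂(vol g), Tendsto (fun k =>
      g.inner x (grad g (f k) x - X x) (grad g (f k) x - X x)) atTop (𝓝 0))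
    {φ : M → ℝ} (hφ : ContMDiff (𝓡 n) 𝓘(ℝ, ℝ) ∞ φ) :
    AEMeasurable (fun x => g.inner x (grad g φ x - X x) (grad g φ x - X x)) (vol g) := by
  refine aemeasurable_of_tendsto_metrizable_ae atTop
    (f := fun k x => gradInner g (φ - f k) (φ - f k) x)
    (fun k => (continuous_gradInner g (hφ.sub (hf k)) (hφ.sub (hf k))).measurable.aemeasurable) ?_
  filter_upwards [h] with x hx
  simp only [gradInner_sub g hφ (hf _)]
  exact (g.isInnerForm x).tendsto_apply_sub hx _

omit [MeasurableSpace M] [BorelSpace M] [CompactSpace M] in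
theorem grad_zero (g : Metric n M) (x : M) : grad g (0 : M → ℝ) x = 0 := by
  have : (0 : M → ℝ) = fun _ => 0 := rfl
  rw [grad, this, mvfderiv_const]
  exact map_zero _

omit [IsManifold (𝓡 n) ∞ M] [MeasurableSpace M] [BorelSpace M] [CompactSpace M] in
theorem contMDiff_zero_fun : ContMDiff (𝓡 n) 𝓘(ℝ, ℝ) ∞ (0 : M → ℝ) := contMDiff_const

-- No measurability of `X` is assumed. It is inherited from the gradients of a subsequence
-- converging almost everywhere, and then holds relative to every smooth `φ`.
omit [CompactSpace M] in
theorem IsWeakGrad.aemeasurable (h : IsWeakGrad g u X) {φ : M → ℝ}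
    (hφ : ContMDiff (𝓡 n) 𝓘(ℝ, ℝ) ∞ φ) :
    AEMeasurable (fun x => g.inner x (grad g φ x - X x) (grad g φ x - X x)) (vol g) := by
  obtain ⟨f, hf, -, hm, ht⟩ := h
  obtain ⟨ns, -, hae⟩ := exists_subseq_tendsto_ae hm ht
  exact aemeasurable_inner_grad_sub (fun k => hf (ns k)) hae hφ

theorem lintegral_inner_grad_sub_le {φ ψ : M → ℝ} (hφ : ContMDiff (𝓡 n) 𝓘(ℝ, ℝ) ∞ φ)
    (hψ : ContMDiff (𝓡 n) 𝓘(ℝ, ℝ) ∞ ψ) :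
    ∫⁻ x, ENNReal.ofReal (g.inner x (grad g φ x - X x) (grad g φ x - X x)) ∂(vol g) ≤
      ENNReal.ofReal (2 * energy g (φ - ψ)) + 2 * ∫⁻ x, ENNReal.ofReal
        (g.inner x (grad g ψ x - X x) (grad g ψ x - X x)) ∂(vol g) := by
  have hc : Continuous (gradInner g (φ - ψ) (φ - ψ)) :=
    continuous_gradInner g (hφ.sub hψ) (hφ.sub hψ)
  rw [ENNReal.ofReal_mul zero_le_two, ENNReal.ofReal_ofNat,
    ← lintegral_gradInner g (f := φ - ψ) (hφ.sub hψ), ← mul_add, ← lintegral_add_left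
      hc.measurable.ennreal_ofReal, ← lintegral_const_mul' _ _ ENNReal.ofNat_ne_top]
  refine lintegral_mono fun x => ?_
  have h1 := (g.isInnerForm x).sub_sub_le (grad g φ x - grad g ψ x) (X x - grad g ψ x) 0
  have h2 := (g.isInnerForm x).nonneg (grad g φ x - grad g ψ x)
  have h3 := (g.isInnerForm x).nonneg (grad g ψ x - X x)
  rw [gradInner_sub g hφ hψ, ← ENNReal.ofReal_add h2 h3, two_mul_ofReal]
  refine ENNReal.ofReal_le_ofReal ?_
  have e1 : grad g φ x - grad g ψ x - (X x - grad g ψ x) = grad g φ x - X x := by abel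
  have e2 : X x - grad g ψ x - 0 = -(grad g ψ x - X x) := by abel
  rw [e1, e2, sub_zero, map_neg, map_neg, neg_apply, neg_neg] at h1
  linarith

theorem energy_sub_le_lintegral {φ ψ : M → ℝ} (hφ : ContMDiff (𝓡 n) 𝓘(ℝ, ℝ) ∞ φ)
    (hψ : ContMDiff (𝓡 n) 𝓘(ℝ, ℝ) ∞ ψ)
    (hm : AEMeasurable (fun x => g.inner x (grad g φ x - X x) (grad g φ x - X x)) (vol g)) :
    ENNReal.ofReal (energy g (φ - ψ)) ≤
      2 * ∫⁻ x, ENNReal.ofReal (g.inner x (grad g φ x - X x) (grad g φ x - X x)) ∂(vol g) +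
      2 * ∫⁻ x, ENNReal.ofReal (g.inner x (grad g ψ x - X x) (grad g ψ x - X x)) ∂(vol g) := by
  rw [← lintegral_gradInner g (f := φ - ψ) (hφ.sub hψ), ← mul_add, ← lintegral_add_left'
      hm.ennreal_ofReal, ← lintegral_const_mul' _ _ ENNReal.ofNat_ne_top]
  refine lintegral_mono fun x => ?_
  rw [gradInner_sub g hφ hψ, ← ENNReal.ofReal_add ((g.isInnerForm x).nonneg _)
    ((g.isInnerForm x).nonneg _), two_mul_ofReal]
  refine ENNReal.ofReal_le_ofReal ?_
  linarith [(g.isInnerForm x).sub_sub_le (grad g φ x) (grad g ψ x) (X x)]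

/-- A function with a weak gradient is approximated by smooth functions. -/
theorem IsWeakGrad.exists_isApprox (h : IsWeakGrad g u X) : ∃ f, IsApprox g f u ∧
    Tendsto (fun k => ∫⁻ x, ENNReal.ofReal
      (g.inner x (grad g (f k) x - X x) (grad g (f k) x - X x)) ∂(vol g)) atTop (𝓝 0) := by
  have hm := fun φ hφ => h.aemeasurable (φ := φ) hφ
  obtain ⟨f, hf, hu, -, ht⟩ := h
  refine ⟨f, ⟨hf, hu, fun ε hε => ?_⟩, ht⟩
  have hε4 : (0 : ℝ≥0∞) < ENNReal.ofReal (ε / 8) := ENNReal.ofReal_pos.2 (by positivity)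
  obtain ⟨N, hN⟩ := eventually_atTop.1 (ht.eventually (gt_mem_nhds hε4))
  refine ⟨N, fun j hj k hk => ?_⟩
  have h1 := energy_sub_le_lintegral (hf j) (hf k) (hm _ (hf j))
  have h2 : ENNReal.ofReal (energy g (f j - f k)) ≤ ENNReal.ofReal (ε / 2) := by
    refine h1.trans ((add_le_add (mul_le_mul_right (hN j hj).le 2)
      (mul_le_mul_right (hN k hk).le 2)).trans_eq ?_)
    rw [two_mul_ofReal, ← ENNReal.ofReal_add (by positivity) (by positivity)]
    congr 1
    ring
  rw [ENNReal.ofReal_le_ofReal_iff (by positivity)] at h2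
  linarith

theorem IsWeakGrad.integrable (h : IsWeakGrad g u X) {φ : M → ℝ}
    (hφ : ContMDiff (𝓡 n) 𝓘(ℝ, ℝ) ∞ φ) :
    Integrable (fun x => g.inner x (grad g φ x - X x) (grad g φ x - X x)) (vol g) := by
  refine ⟨(h.aemeasurable hφ).aestronglyMeasurable, ?_⟩
  rw [hasFiniteIntegral_iff_ofReal (Eventually.of_forall fun x => (g.isInnerForm x).nonneg _)]
  obtain ⟨f, hf, -, -, ht⟩ := h
  obtain ⟨k, hk⟩ := (ht.eventually (gt_mem_nhds (zero_lt_one (α := ℝ≥0∞)))).exists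
  refine (lintegral_inner_grad_sub_le hφ (hf k)).trans_lt ?_
  exact ENNReal.add_lt_top.2 ⟨ENNReal.ofReal_lt_top,
    ENNReal.mul_lt_top ENNReal.ofNat_lt_top (hk.trans ENNReal.one_lt_top)⟩

/-- The energies of approximating smooth functions converge to the energy of the weak gradient. -/
theorem IsWeakGrad.tendsto_energy [T2Space M] (h : IsWeakGrad g u X) {f : ℕ → M → ℝ}
    (hu : AEStronglyMeasurable u (vol g)) (hf : IsApprox g f u) :
    Tendsto (fun k => energy g (f k)) atTop (𝓝 (∫ x, g.inner x (X x) (X x) ∂(vol g))) := by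
  obtain ⟨f', hf', ht⟩ := h.exists_isApprox
  -- The gradients of `f` are not known to converge to `X`, only those of `f'` are. The difference
  -- approximates 0, so closability transfers the convergence to `f`.
  have hd : IsApprox g (fun k => f k - f' k) 0 := by
    refine ⟨fun k => (hf.smooth k).sub (hf'.smooth k), ?_, fun ε hε => ?_⟩
    · have h1 := hf.tendsto.add hf'.tendsto
      rw [add_zero] at h1
      refine tendsto_of_tendsto_of_tendsto_of_le_of_le' tendsto_const_nhds h1
        (Eventually.of_forall fun _ => zero_le) (Eventually.of_forall fun k => ?_)
      have h2 := eLpNorm_sub_le (p := 2)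
        ((hf.smooth k).continuous.measurable.aestronglyMeasurable.sub hu)
        ((hf'.smooth k).continuous.measurable.aestronglyMeasurable.sub hu) one_le_two
      have e : (fun x => (f k - f' k) x - (0 : M → ℝ) x) = f k - u - (f' k - u) := by
        ext x
        simp
      rw [e]
      exact h2
    · obtain ⟨N₁, h₁⟩ := hf.cauchy (ε / 4) (by positivity)
      obtain ⟨N₂, h₂⟩ := hf'.cauchy (ε / 4) (by positivity)
      refine ⟨max N₁ N₂, fun j hj k hk => ?_⟩
      have h3 := h₁ j (le_of_max_le_left hj) k (le_of_max_le_left hk)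
      have h4 := h₂ j (le_of_max_le_right hj) k (le_of_max_le_right hk)
      have h5 := energy_sub_le g (f₁ := f j - f k) (f₂ := f' j - f' k) (f₃ := 0)
        ((hf.smooth j).sub (hf.smooth k)) ((hf'.smooth j).sub (hf'.smooth k)) contMDiff_zero_fun
      rw [sub_zero, sub_zero] at h5
      have e : f j - f' j - (f k - f' k) = f j - f k - (f' j - f' k) := by abel
      rw [e]
      linarith
  have hE := hd.tendsto_energy_zero
  have hlim : Tendsto (fun k => ∫⁻ x, ENNReal.ofReal
      (g.inner x (grad g (f k) x - X x) (grad g (f k) x - X x)) ∂(vol g)) atTop (𝓝 0) := by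
    have h1 := (ENNReal.tendsto_ofReal (hE.const_mul 2)).add
      (ENNReal.Tendsto.const_mul (a := 2) ht (Or.inr ENNReal.ofNat_ne_top))
    simp only [mul_zero, ENNReal.ofReal_zero, add_zero] at h1
    exact tendsto_of_tendsto_of_tendsto_of_le_of_le tendsto_const_nhds h1 (fun _ => zero_le)
      fun k => lintegral_inner_grad_sub_le (hf.smooth k) (hf'.smooth k)
  have hint := fun k => h.integrable (hf.smooth k)
  have hX : Integrable (fun x => g.inner x (X x) (X x)) (vol g) := by
    refine (h.integrable (contMDiff_zero_fun (n := n))).congr (Eventually.of_forall fun x => ?_)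
    simp [grad_zero]
  have hd0 : Tendsto (fun k => ∫ x, g.inner x (grad g (f k) x - X x) (grad g (f k) x - X x)
      ∂(vol g)) atTop (𝓝 0) := by
    have h1 := (ENNReal.tendsto_toReal ENNReal.zero_ne_top).comp hlim
    refine h1.congr fun k => ?_
    rw [integral_eq_lintegral_of_nonneg_ae
      (Eventually.of_forall fun x => (g.isInnerForm x).nonneg _) (hint k).aestronglyMeasurable]
    rfl
  refine tendsto_of_forall_abs_sub_le hd0 (P := ∫ x, g.inner x (X x) (X x) ∂(vol g))
    fun η hη k => ?_
  have hk := integrable_vol_of_continuous g (continuous_gradInner g (hf.smooth k) (hf.smooth k))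
  rw [energy, ← integral_sub hk hX, ← integral_const_mul, ← integral_const_mul,
    ← integral_add (hX.const_mul η) ((hint k).const_mul _)]
  refine (abs_integral_le_integral_abs).trans (integral_mono (hk.sub hX).abs
    ((hX.const_mul η).add ((hint k).const_mul _)) fun x => ?_)
  exact (g.isInnerForm x).abs_sub_le hη _ _

/-- Each `a k` is the product of `2⁻ᵏ` and `2ᵏ a k`, so its root is at most their sum. -/
theorem summable_sqrt_of_summable_two_pow_mul {a : ℕ → ℝ} (ha : ∀ k, 0 ≤ a k)
    (h : Summable fun k => 2 ^ k * a k) : Summable fun k => √(a k) := by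
  have h2 : Summable fun k : ℕ => ((1 : ℝ) / 2) ^ k := summable_geometric_two
  refine Summable.of_nonneg_of_le (fun k => Real.sqrt_nonneg _) (fun k => ?_) (h2.add h)
  rw [Real.sqrt_le_left (add_nonneg (by positivity) (mul_nonneg (by positivity) (ha k)))]
  have e : ((1 : ℝ) / 2) ^ k * 2 ^ k = 1 := by rw [← mul_pow]; norm_num
  have h3 : 0 ≤ (2 : ℝ) ^ k * a k := mul_nonneg (by positivity) (ha k)
  have h4 : 0 ≤ ((1 : ℝ) / 2) ^ k := by positivity
  have h5 : ((1 : ℝ) / 2) ^ k * (2 ^ k * a k) = a k := by rw [← mul_assoc, e, one_mul]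
  nlinarith [ha k, sq_nonneg (((1 : ℝ) / 2) ^ k), sq_nonneg ((2 : ℝ) ^ k * a k)]

/-- Limits of approximating smooth functions have a weak gradient. -/
theorem IsApprox.exists_isWeakGrad {f : ℕ → M → ℝ} (hf : IsApprox g f u) :
    ∃ X, IsWeakGrad g u X := by
  classical
  -- A subsequence whose steps have energy below `4⁻ᵏ` has weighted sum `∑ 2ᵏ|∇(f_{k+1} - f_k)|²`
  -- integrable, so almost everywhere its gradients have summable increments.
  have hev : ∀ m : ℕ, ∀ᶠ N in atTop, ∀ j, N ≤ j → energy g (f j - f N) < (1 / 4) ^ m := by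
    intro m
    obtain ⟨N, hN⟩ := hf.cauchy ((1 / 4) ^ m) (by positivity)
    filter_upwards [eventually_ge_atTop N] with k hk j hj
    exact hN j (hk.trans hj) k hk
  obtain ⟨ns, hns, hE⟩ := extraction_forall_of_eventually hev
  have hsm := fun k => hf.smooth (ns k)
  have hd : ∀ k, ContMDiff (𝓡 n) 𝓘(ℝ, ℝ) ∞ (f (ns (k + 1)) - f (ns k)) :=
    fun k => (hsm (k + 1)).sub (hsm k)
  set ρ : ℕ → M → ℝ := fun k =>
    gradInner g (f (ns (k + 1)) - f (ns k)) (f (ns (k + 1)) - f (ns k)) with hρ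
  have hρ0 : ∀ k x, 0 ≤ ρ k x := fun k x => gradInner_self_nonneg g _ x
  have hρc : ∀ k, Continuous (ρ k) := fun k => continuous_gradInner g (hd k) (hd k)
  have hρm : ∀ k : ℕ, AEMeasurable (fun x => ENNReal.ofReal (2 ^ k * ρ k x)) (vol g) := fun k =>
    ((continuous_const.mul (hρc k)).measurable.ennreal_ofReal).aemeasurable
  have hsum : ∀ᵐ x ∂(vol g), Summable fun k => 2 ^ k * ρ k x := by
    have hfin : ∫⁻ x, ∑' k, ENNReal.ofReal (2 ^ k * ρ k x) ∂(vol g) ≠ ⊤ := by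
      rw [lintegral_tsum hρm]
      have hle : ∀ k, ∫⁻ x, ENNReal.ofReal (2 ^ k * ρ k x) ∂(vol g) ≤
          ENNReal.ofReal ((1 / 2) ^ k) := by
        intro k
        simp_rw [ENNReal.ofReal_mul (show (0 : ℝ) ≤ 2 ^ k by positivity)]
        rw [lintegral_const_mul' _ _ ENNReal.ofReal_ne_top, lintegral_gradInner g (hd k),
          ← ENNReal.ofReal_mul (by positivity)]
        refine ENNReal.ofReal_le_ofReal ?_
        have h1 := (hE k _ (hns (Nat.lt_succ_self k)).le).le
        calc (2 : ℝ) ^ k * energy g (f (ns (k + 1)) - f (ns k)) ≤ 2 ^ k * (1 / 4) ^ k :=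
              mul_le_mul_of_nonneg_left h1 (by positivity)
          _ = (1 / 2) ^ k := by rw [← mul_pow]; norm_num
      refine ((ENNReal.tsum_le_tsum hle).trans_lt ?_).ne
      rw [← ENNReal.ofReal_tsum_of_nonneg (fun k => by positivity) summable_geometric_two]
      exact ENNReal.ofReal_lt_top
    filter_upwards [ae_lt_top' (AEMeasurable.tsum hρm) hfin] with x hx
    have := ENNReal.summable_toReal hx.ne
    refine this.congr fun k => ?_
    exact ENNReal.toReal_ofReal (mul_nonneg (by positivity) (hρ0 k x))
  have hex : ∀ᵐ x ∂(vol g), ∃ Y : TangentSpace (𝓡 n) x, Tendsto (fun k =>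
      g.inner x (grad g (f (ns k)) x - Y) (grad g (f (ns k)) x - Y)) atTop (𝓝 0) := by
    filter_upwards [hsum] with x hx
    refine (g.isInnerForm x).exists_tendsto ?_
    refine (summable_sqrt_of_summable_two_pow_mul (fun k => hρ0 k x) hx).congr fun k => ?_
    rw [hρ]
    beta_reduce
    rw [gradInner_sub g (hsm (k + 1)) (hsm k)]
  set X : ∀ x : M, TangentSpace (𝓡 n) x := fun x =>
    if h : ∃ Y : TangentSpace (𝓡 n) x, Tendsto (fun k =>
      g.inner x (grad g (f (ns k)) x - Y) (grad g (f (ns k)) x - Y)) atTop (𝓝 0)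
    then h.choose else 0 with hXdef
  have hX : ∀ᵐ x ∂(vol g), Tendsto (fun k =>
      g.inner x (grad g (f (ns k)) x - X x) (grad g (f (ns k)) x - X x)) atTop (𝓝 0) := by
    filter_upwards [hex] with x hx
    simp only [hXdef, dif_pos hx]
    exact hx.choose_spec
  refine ⟨X, fun k => f (ns k), hsm, hf.tendsto.comp hns.tendsto_atTop,
    fun k => aemeasurable_inner_grad_sub hsm hX (hsm k), ?_⟩
  rw [ENNReal.tendsto_atTop_zero]
  intro ε hε
  obtain ⟨δ, hδ, hδε⟩ : ∃ δ : ℝ, 0 < δ ∧ ENNReal.ofReal δ ≤ ε := by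
    obtain ⟨r, hr0, hr⟩ := ENNReal.lt_iff_exists_real_btwn.1 hε
    exact ⟨r, by simpa using hr.1, hr.2.le⟩
  obtain ⟨N, hN⟩ := hf.cauchy δ hδ
  refine ⟨N, fun k hk => ?_⟩
  have hc : ∀ j, Continuous (gradInner g (f (ns k) - f (ns j)) (f (ns k) - f (ns j))) :=
    fun j => continuous_gradInner g ((hsm k).sub (hsm j)) ((hsm k).sub (hsm j))
  -- Fatou's lemma in `j`, with `k` fixed: the distance from the gradient of `f_k` to `X` is the
  -- pointwise limit of its distances to the gradients of `f_j`.
  calc ∫⁻ x, ENNReal.ofReal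
        (g.inner x (grad g (f (ns k)) x - X x) (grad g (f (ns k)) x - X x)) ∂(vol g)
      = ∫⁻ x, liminf (fun j => ENNReal.ofReal
          (gradInner g (f (ns k) - f (ns j)) (f (ns k) - f (ns j)) x)) atTop ∂(vol g) := by
        refine lintegral_congr_ae ?_
        filter_upwards [hX] with x hx
        have h1 := ENNReal.tendsto_ofReal ((g.isInnerForm x).tendsto_apply_sub hx
          (grad g (f (ns k)) x))
        simp only [gradInner_sub g (hsm k) (hsm _)]
        exact h1.liminf_eq.symm
    _ ≤ liminf (fun j => ∫⁻ x, ENNReal.ofReal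
          (gradInner g (f (ns k) - f (ns j)) (f (ns k) - f (ns j)) x) ∂(vol g)) atTop :=
        lintegral_liminf_le fun j => (hc j).measurable.ennreal_ofReal
    _ ≤ ENNReal.ofReal δ := by
        refine liminf_le_of_frequently_le' (Eventually.frequently ?_)
        filter_upwards [eventually_ge_atTop N] with j hj
        rw [lintegral_gradInner g (f := f (ns k) - f (ns j)) ((hsm k).sub (hsm j))]
        exact ENNReal.ofReal_le_ofReal (hN _ (hk.trans (hns.id_le k)) _
          (hj.trans (hns.id_le j))).le
    _ ≤ ε := hδε

end WeakGradient

/-! ### The quadratic form on `H¹` -/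

theorem integral_sq_eq_eLpNorm {α : Type*} [MeasurableSpace α] {μ : Measure α} {f : α → ℝ}
    (hf : MemLp f 2 μ) : ∫ x, f x ^ 2 ∂μ = (eLpNorm f 2 μ).toReal ^ 2 := by
  rw [hf.eLpNorm_eq_integral_rpow_norm two_ne_zero ENNReal.ofNat_ne_top]
  have h : ∀ x, ‖f x‖ ^ (2 : ℝ≥0∞).toReal = f x ^ 2 := fun x => by simp
  simp_rw [h]
  have h0 : 0 ≤ ∫ x, f x ^ 2 ∂μ := integral_nonneg fun x => sq_nonneg _
  rw [ENNReal.toReal_ofReal (Real.rpow_nonneg h0 _), ENNReal.toReal_ofNat,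
    ← Real.rpow_two, ← Real.rpow_mul h0]
  norm_num

section FormOnH1

variable {n : ℕ} {M : Type*} [TopologicalSpace M] [ChartedSpace (EuclideanSpace ℝ (Fin n)) M]
  [IsManifold (𝓡 n) ∞ M] [MeasurableSpace M] [BorelSpace M] [CompactSpace M]
  {g : Metric n M} {u : M → ℝ}

theorem tendsto_integral_mul_sq {R : M → ℝ} (hR : Continuous R) {f : ℕ → M → ℝ}
    (hf : ∀ k, Continuous (f k)) (hu : MemLp u 2 (vol g))
    (ht : Tendsto (fun k => eLpNorm (fun x => f k x - u x) 2 (vol g)) atTop (𝓝 0)) :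
    Tendsto (fun k => ∫ x, R x * f k x * f k x ∂(vol g)) atTop
      (𝓝 (∫ x, R x * u x * u x ∂(vol g))) := by
  obtain ⟨C, hC⟩ := isCompact_univ.exists_bound_of_continuousOn hR.continuousOn
  have hd : ∀ k, MemLp (fun x => f k x - u x) 2 (vol g) := fun k =>
    (memLp_vol_of_continuous g (hf k) 2).sub hu
  have hd2 : ∀ k, Integrable (fun x => (f k x - u x) ^ 2) (vol g) := fun k => (hd k).integrable_sq
  have hu2 : Integrable (fun x => u x ^ 2) (vol g) := hu.integrable_sq
  have hRu : Integrable (fun x => R x * u x * u x) (vol g) := by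
    have h1 : Integrable (fun x => R x * u x ^ 2) (vol g) :=
      hu2.bdd_mul hR.measurable.aestronglyMeasurable
        (Eventually.of_forall fun x => hC x (Set.mem_univ x))
    refine h1.congr (Eventually.of_forall fun x => ?_)
    beta_reduce
    ring
  have hRf : ∀ k, Integrable (fun x => R x * f k x * f k x) (vol g) := fun k =>
    integrable_vol_of_continuous g ((hR.mul (hf k)).mul (hf k))
  have hlim : Tendsto (fun k => C * ∫ x, (f k x - u x) ^ 2 ∂(vol g)) atTop (𝓝 0) := by
    have h1 := (((ENNReal.tendsto_toReal ENNReal.zero_ne_top).comp ht).pow 2).const_mul C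
    rw [ENNReal.toReal_zero, zero_pow two_ne_zero, mul_zero] at h1
    refine h1.congr fun k => ?_
    rw [integral_sq_eq_eLpNorm (hd k)]
    rfl
  refine tendsto_of_forall_abs_sub_le hlim (P := C * ∫ x, u x ^ 2 ∂(vol g)) fun η hη k => ?_
  rw [← integral_sub (hRf k) hRu, ← integral_const_mul, ← integral_const_mul, ← integral_const_mul,
    ← integral_const_mul,
    ← integral_add ((hu2.const_mul C).const_mul η) (((hd2 k).const_mul C).const_mul _)]
  refine (abs_integral_le_integral_abs).trans (integral_mono ((hRf k).sub hRu).abs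
    (((hu2.const_mul C).const_mul η).add (((hd2 k).const_mul C).const_mul _)) fun x => ?_)
  have h1 : |R x| ≤ C := hC x (Set.mem_univ x)
  have hC0 : 0 ≤ C := (abs_nonneg _).trans h1
  have h2 : |f k x ^ 2 - u x ^ 2| ≤ η * u x ^ 2 + (1 + η⁻¹) * (f k x - u x) ^ 2 := by
    generalize hq : f k x - u x = q
    have hfk : f k x = u x + q := by rw [← hq]; ring
    have hi : 0 < η⁻¹ := inv_pos.2 hη
    have hηi : η * η⁻¹ = 1 := mul_inv_cancel₀ hη.ne'
    have k1 : η⁻¹ * (η * u x - q) ^ 2 = η * u x ^ 2 - 2 * u x * q + η⁻¹ * q ^ 2 := by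
      field_simp
      ring
    have k2 : η⁻¹ * (η * u x + q) ^ 2 = η * u x ^ 2 + 2 * u x * q + η⁻¹ * q ^ 2 := by
      field_simp
      ring
    have k3 : 0 ≤ η⁻¹ * (η * u x - q) ^ 2 := by positivity
    have k4 : 0 ≤ η⁻¹ * (η * u x + q) ^ 2 := by positivity
    rw [hfk, abs_le]
    constructor <;> nlinarith [sq_nonneg q]
  calc |R x * f k x * f k x - R x * u x * u x| = |R x| * |f k x ^ 2 - u x ^ 2| := by
        rw [← abs_mul]
        congr 1
        ring
    _ ≤ C * (η * u x ^ 2 + (1 + η⁻¹) * (f k x - u x) ^ 2) :=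
        mul_le_mul h1 h2 (abs_nonneg _) hC0
    _ = η * (C * u x ^ 2) + (1 + η⁻¹) * (C * (f k x - u x) ^ 2) := by ring

omit [BorelSpace M] [CompactSpace M] in
theorem isWeakGrad_weakGrad (h : ∃ X, IsWeakGrad g u X) : IsWeakGrad g u (weakGrad g u) := by
  rw [weakGrad, dif_pos h]
  exact h.choose_spec

/-- The form of `u` is the limit of the forms of approximating smooth functions. -/
theorem IsApprox.tendsto_smoothForm [T2Space M] {f : ℕ → M → ℝ} (hu : MemLp u 2 (vol g))
    (hf : IsApprox g f u) :
    Tendsto (fun k => smoothForm g (f k) (f k)) atTop (𝓝 (form g u u)) :=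
  (((isWeakGrad_weakGrad hf.exists_isWeakGrad).tendsto_energy hu.1 hf).const_mul _).add
    (tendsto_integral_mul_sq (continuous_scalarCurvature g) (fun k => (hf.smooth k).continuous)
      hu hf.tendsto)

omit [BorelSpace M] [CompactSpace M] in
theorem isApprox_const {f : M → ℝ} (hf : ContMDiff (𝓡 n) 𝓘(ℝ, ℝ) ∞ f) (h : u =ᵐ[vol g] f) :
    IsApprox g (fun _ => f) u := by
  refine ⟨fun _ => hf, ?_, fun ε hε => ⟨0, fun j _ k _ => ?_⟩⟩
  · have : eLpNorm (fun x => f x - u x) 2 (vol g) = 0 := by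
      rw [← eLpNorm_zero (p := 2) (μ := vol g) (α := M) (ε := ℝ)]
      refine eLpNorm_congr_ae ?_
      filter_upwards [h] with x hx
      simp [hx]
    rw [this]
    exact tendsto_const_nhds
  · have : energy g (f - f) = 0 := by
      simp only [sub_self, energy, gradInner, grad_zero, map_zero, integral_zero]
    rw [this]
    exact hε

/-- The weak gradient is chosen, even for smooth functions; the constant approximating sequence
shows that the form takes the classical value. -/
theorem form_eq_smoothForm [T2Space M] {f : M → ℝ} (hf : ContMDiff (𝓡 n) 𝓘(ℝ, ℝ) ∞ f)
    (h : u =ᵐ[vol g] f) : form g u u = smoothForm g f f :=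
  (tendsto_nhds_unique ((isApprox_const hf h).tendsto_smoothForm
    ((memLp_congr_ae h).2 (memLp_vol_of_continuous g hf.continuous 2))) tendsto_const_nhds)

end FormOnH1

/-! ### Coercivity -/

section Coercivity

variable {n : ℕ} {M : Type*} [TopologicalSpace M] [ChartedSpace (EuclideanSpace ℝ (Fin n)) M]
  [IsManifold (𝓡 n) ∞ M]

omit [IsManifold (𝓡 n) ∞ M] in
theorem contMDiff_sqrt_sq_add {f : M → ℝ} (hf : ContMDiff (𝓡 n) 𝓘(ℝ, ℝ) ∞ f) {δ : ℝ}
    (hδ : 0 < δ) : ContMDiff (𝓡 n) 𝓘(ℝ, ℝ) ∞ fun x => √(f x * f x + δ) := by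
  intro x
  have h1 : f x * f x + δ ≠ 0 := by
    have := mul_self_nonneg (f x)
    positivity
  exact ((Real.contDiffAt_sqrt h1).contMDiffAt).comp x
    (((hf.mul hf).add contMDiff_const).contMDiffAt)

/-- From `F² = f² + δ` follows `F∇F = f∇f`, hence `F²|∇F|² = f²|∇f|² ≤ F²|∇f|²`. -/
theorem gradInner_sqrt_sq_add_le (g : Metric n M) {f : M → ℝ}
    (hf : ContMDiff (𝓡 n) 𝓘(ℝ, ℝ) ∞ f) {δ : ℝ} (hδ : 0 < δ) (x : M) :
    gradInner g (fun x => √(f x * f x + δ)) (fun x => √(f x * f x + δ)) x ≤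
      gradInner g f f x := by
  set F : M → ℝ := fun x => √(f x * f x + δ) with hF
  have hFs : ContMDiff (𝓡 n) 𝓘(ℝ, ℝ) ∞ F := contMDiff_sqrt_sq_add hf hδ
  have hpos : 0 < f x * f x + δ := by
    have := mul_self_nonneg (f x)
    positivity
  have hF2 : F * F = f * f + fun _ => δ := by
    ext z
    have : 0 ≤ f z * f z + δ := by
      have := mul_self_nonneg (f z)
      positivity
    simp only [Pi.mul_apply, Pi.add_apply, hF]
    exact Real.mul_self_sqrt this
  have key : ∀ ψ : M → ℝ, F x * gradInner g F ψ x = f x * gradInner g f ψ x := by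
    intro ψ
    have h1 := gradInner_mul_left g hFs hFs ψ x
    have h2 := gradInner_mul_left g hf hf ψ x
    have h3 : gradInner g (F * F) ψ x = gradInner g (f * f) ψ x := by
      rw [hF2, gradInner_eq_mvfderiv, gradInner_eq_mvfderiv,
        mvfderiv_add (mdifferentiableAt_of_smooth (hf.mul hf) x)
          (mdifferentiableAt_of_smooth contMDiff_const x), mvfderiv_const, add_zero]
    linarith
  have hFx : F x * F x = f x * f x + δ := Real.mul_self_sqrt hpos.le
  have h4 := key F
  have h5 := key f
  rw [gradInner_comm g F f] at h5
  have h6 : (f x * f x + δ) * gradInner g F F x = f x * f x * gradInner g f f x := by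
    rw [← hFx]
    linear_combination F x * h4 + f x * h5
  have h7 := gradInner_self_nonneg g f x
  refine le_of_mul_le_mul_left ?_ hpos
  rw [h6]
  nlinarith

variable [MeasurableSpace M]

/-- A real infimum over a set unbounded below is 0 by convention; positivity excludes this case. -/
theorem yamabeInvariant_le_of_pos {g : Metric n M} (hY : 0 < yamabeInvariant g) (u : H1Plus g) :
    yamabeInvariant g ≤ yamabeFunctional g u := by
  have hb : BddBelow (Set.range (yamabeFunctional g)) := by
    by_contra h
    rw [yamabeInvariant, iInf, Real.sInf_of_not_bddBelow h] at hY
    exact lt_irrefl _ hY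
  exact ciInf_le hb u

variable [BorelSpace M] [CompactSpace M]

theorem toLp_mem_H1Plus {g : Metric n M} {f : M → ℝ} (hf : ContMDiff (𝓡 n) 𝓘(ℝ, ℝ) ∞ f)
    (hpos : ∀ x, 0 < f x) :
    (memLp_vol_of_continuous g hf.continuous 2).toLp f ∈ H1Plus g := by
  have h := (memLp_vol_of_continuous g hf.continuous 2).coeFn_toLp
  refine ⟨(isApprox_const hf h).exists_isWeakGrad, ?_⟩
  filter_upwards [h] with x hx
  rw [hx]
  exact hpos x

/-- By Hölder on a finite measure space the L²-norm is at most `K` times the L^{2*}-norm, which the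
Yamabe functional controls. -/
theorem exists_le_smoothForm_of_pos [T2Space M] (hn : 3 ≤ n) {g : Metric n M}
    (hY : 0 < yamabeInvariant g) :
    ∃ c : ℝ, 0 < c ∧ ∀ f : M → ℝ, ContMDiff (𝓡 n) 𝓘(ℝ, ℝ) ∞ f → (∀ x, 0 < f x) →
      c * ∫ x, f x ^ 2 ∂(vol g) ≤ smoothForm g f f := by
  set p : ℝ≥0∞ := ENNReal.ofReal (2 * (n : ℝ) / ((n : ℝ) - 2)) with hp
  set K : ℝ≥0∞ := vol g Set.univ ^ (1 / (2 : ℝ≥0∞).toReal - 1 / p.toReal) with hK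
  have hn' : (3 : ℝ) ≤ n := by exact_mod_cast hn
  have hn2 : 0 < (n : ℝ) - 2 := by linarith
  have h2p' : 2 ≤ 2 * (n : ℝ) / ((n : ℝ) - 2) := by
    rw [le_div_iff₀ hn2]
    linarith
  have h2p : 2 ≤ p := by
    rw [hp, ← ENNReal.ofReal_ofNat 2]
    exact ENNReal.ofReal_le_ofReal h2p'
  have hKt : K ≠ ⊤ := by
    refine ENNReal.rpow_ne_top_of_nonneg ?_ (measure_ne_top _ _)
    rw [hp, ENNReal.toReal_ofReal (by linarith), ENNReal.toReal_ofNat, sub_nonneg]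
    exact one_div_le_one_div_of_le zero_lt_two h2p'
  -- The summand 1 keeps the denominator positive even when `K` is zero.
  refine ⟨yamabeInvariant g / (K.toReal ^ 2 + 1), by positivity, fun f hf hpos => ?_⟩
  have hm := fun q => memLp_vol_of_continuous g hf.continuous q
  have hae := (hm 2).coeFn_toLp
  have h1 := yamabeInvariant_le_of_pos hY ⟨_, toLp_mem_H1Plus hf hpos⟩
  rw [yamabeFunctional, form_eq_smoothForm hf hae, eLpNorm_congr_ae hae, ← hp] at h1
  set N := (eLpNorm f p (vol g)).toReal with hN
  -- If the norm were zero, the quotient would be 0 by the convention for division, against a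
  -- positive invariant.
  have hN0 : 0 < N ^ 2 := by
    by_contra h
    have : N ^ 2 = 0 := le_antisymm (not_lt.1 h) (sq_nonneg _)
    rw [this, div_zero] at h1
    linarith
  rw [le_div_iff₀ hN0] at h1
  have h2 : (eLpNorm f 2 (vol g)).toReal ≤ N * K.toReal := by
    rw [hN, ← ENNReal.toReal_mul]
    refine ENNReal.toReal_mono (ENNReal.mul_ne_top (hm p).2.ne hKt) ?_
    exact eLpNorm_le_eLpNorm_mul_rpow_measure_univ h2p (hm 2).1
  have h3 : (eLpNorm f 2 (vol g)).toReal ^ 2 ≤ N ^ 2 * K.toReal ^ 2 := by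
    rw [← mul_pow]
    exact pow_le_pow_left₀ ENNReal.toReal_nonneg h2 2
  rw [integral_sq_eq_eLpNorm (hm 2), div_mul_eq_mul_div, div_le_iff₀ (by positivity)]
  calc yamabeInvariant g * (eLpNorm f 2 (vol g)).toReal ^ 2
      ≤ yamabeInvariant g * (N ^ 2 * K.toReal ^ 2) := mul_le_mul_of_nonneg_left h3 hY.le
    _ = yamabeInvariant g * N ^ 2 * K.toReal ^ 2 := by ring
    _ ≤ smoothForm g f f * K.toReal ^ 2 := mul_le_mul_of_nonneg_right h1 (sq_nonneg _)
    _ ≤ smoothForm g f f * (K.toReal ^ 2 + 1) := by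
        have : 0 ≤ smoothForm g f f := (mul_nonneg hY.le hN0.le).trans h1
        nlinarith

/-- A positive Yamabe invariant makes the form coercive on smooth functions. -/
theorem exists_le_smoothForm [T2Space M] (hn : 3 ≤ n) {g : Metric n M}
    (hY : 0 < yamabeInvariant g) :
    ∃ c : ℝ, 0 < c ∧ ∀ f : M → ℝ, ContMDiff (𝓡 n) 𝓘(ℝ, ℝ) ∞ f →
      c * ∫ x, f x ^ 2 ∂(vol g) ≤ smoothForm g f f := by
  obtain ⟨c, hc, h⟩ := exists_le_smoothForm_of_pos hn hY
  refine ⟨c, hc, fun f hf => ?_⟩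
  have hfc := hf.continuous
  have hR := continuous_scalarCurvature g
  have ha : 0 ≤ 4 * (((n : ℝ) - 1) / ((n : ℝ) - 2)) := by
    have hn' : (3 : ℝ) ≤ n := by exact_mod_cast hn
    have h1 : 0 ≤ (n : ℝ) - 1 := by linarith
    have h2 : 0 ≤ (n : ℝ) - 2 := by linarith
    positivity
  -- Passing from `f` to `√(f² + δ) > 0` does not increase the gradient term or decrease the
  -- L²-norm, and changes the curvature term by exactly `δ ∫ R`.
  have key : ∀ δ : ℝ, 0 < δ → c * ∫ x, f x ^ 2 ∂(vol g) ≤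
      smoothForm g f f + δ * ∫ x, scalarCurvature g x ∂(vol g) := by
    intro δ hδ
    have hsq : ∀ x, 0 < f x * f x + δ := fun x => by
      have := mul_self_nonneg (f x)
      positivity
    set F : M → ℝ := fun x => √(f x * f x + δ) with hF
    have hFs : ContMDiff (𝓡 n) 𝓘(ℝ, ℝ) ∞ F := contMDiff_sqrt_sq_add hf hδ
    have hF2 : ∀ x, F x * F x = f x * f x + δ := fun x => Real.mul_self_sqrt (hsq x).le
    have h1 := h F hFs fun x => Real.sqrt_pos.2 (hsq x)
    have h2 : ∫ x, f x ^ 2 ∂(vol g) ≤ ∫ x, F x ^ 2 ∂(vol g) := by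
      refine integral_mono (integrable_vol_of_continuous g (hfc.pow 2))
        (integrable_vol_of_continuous g (hFs.continuous.pow 2)) fun x => ?_
      beta_reduce
      rw [sq, sq, hF2]
      linarith
    have h3 : ∫ x, gradInner g F F x ∂(vol g) ≤ ∫ x, gradInner g f f x ∂(vol g) :=
      integral_mono (integrable_vol_of_continuous g (continuous_gradInner g hFs hFs))
        (integrable_vol_of_continuous g (continuous_gradInner g hf hf))
        fun x => gradInner_sqrt_sq_add_le g hf hδ x
    have h4 : ∫ x, scalarCurvature g x * F x * F x ∂(vol g) =
        ∫ x, scalarCurvature g x * f x * f x ∂(vol g) +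
          δ * ∫ x, scalarCurvature g x ∂(vol g) := by
      have hc1 : Continuous fun x => scalarCurvature g x * f x * f x := (hR.mul hfc).mul hfc
      rw [← integral_const_mul, ← integral_add (integrable_vol_of_continuous g hc1)
        ((integrable_vol_of_continuous g hR).const_mul δ)]
      refine integral_congr_ae (Eventually.of_forall fun x => ?_)
      beta_reduce
      rw [mul_assoc, hF2]
      ring
    rw [smoothForm, h4] at h1
    rw [smoothForm]
    have h5 := mul_le_mul_of_nonneg_left h3 ha
    have h6 := mul_le_mul_of_nonneg_left h2 hc.le
    linarith
  have ht : Tendsto (fun δ : ℝ => smoothForm g f f + δ * ∫ x, scalarCurvature g x ∂(vol g))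
      (𝓝[>] 0) (𝓝 (smoothForm g f f)) := by
    have h1 : Continuous fun δ : ℝ =>
      smoothForm g f f + δ * ∫ x, scalarCurvature g x ∂(vol g) := by fun_prop
    have h2 := (h1.tendsto 0).mono_left (nhdsWithin_le_nhds (s := Set.Ioi 0))
    simpa using h2
  refine ge_of_tendsto ht ?_
  filter_upwards [self_mem_nhdsWithin] with δ hδ using key δ hδ

/-- Conformal covariance gives the bound by `∫ (wf)² dV_g`, and `f² dV_h = w^{4/(n-2)} (wf)² dV_g`
with a bounded factor. -/
theorem IsConformalFactor.exists_le_smoothForm [T2Space M] (hn : 3 ≤ n) {g h : Metric n M}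
    {w : M → ℝ} (H : IsConformalFactor g h w) (hY : 0 < yamabeInvariant g) :
    ∃ c : ℝ, 0 < c ∧ ∀ f : M → ℝ, ContMDiff (𝓡 n) 𝓘(ℝ, ℝ) ∞ f →
      c * ∫ x, f x ^ 2 ∂(vol h) ≤ smoothForm h f f := by
  obtain ⟨c, hc, hcoer⟩ := YamabeObstacle.exists_le_smoothForm hn hY
  have hwp : Continuous fun x => (w x) ^ (4 / ((n : ℝ) - 2)) :=
    H.smooth.continuous.rpow_const fun x => Or.inl (H.pos x).ne'
  obtain ⟨K, hK⟩ := isCompact_univ.exists_bound_of_continuousOn hwp.continuousOn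
  have hK' : ∀ x, (w x) ^ (4 / ((n : ℝ) - 2)) ≤ |K| + 1 := fun x =>
    (le_abs_self _).trans ((hK x (Set.mem_univ x)).trans ((le_abs_self K).trans (by linarith)))
  refine ⟨c / (|K| + 1), by positivity, fun f hf => ?_⟩
  rw [H.smoothForm_eq hn hf, div_mul_eq_mul_div, div_le_iff₀ (by positivity)]
  have h1 := hcoer (w * f) (H.smooth.mul hf)
  have h2 : ∫ x, f x ^ 2 ∂(vol h) ≤ (|K| + 1) * ∫ x, (w * f) x ^ 2 ∂(vol g) := by
    have hc0 : Continuous fun x => f x ^ 2 := hf.continuous.pow 2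
    rw [H.integral_vol hn hc0, ← integral_const_mul]
    have hc1 : Continuous fun x => (|K| + 1) * (w * f) x ^ 2 :=
      continuous_const.mul ((H.smooth.mul hf).continuous.pow 2)
    have hc2 : Continuous fun x => f x ^ 2 * (w x) ^ (4 / ((n : ℝ) - 2) + 2) :=
      (hf.continuous.pow 2).mul (H.smooth.continuous.rpow_const fun x => Or.inl (H.pos x).ne')
    refine integral_mono (integrable_vol_of_continuous g hc2)
      (integrable_vol_of_continuous g hc1) fun x => ?_
    beta_reduce
    rw [Real.rpow_add (H.pos x), Real.rpow_two, Pi.mul_apply]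
    nlinarith [mul_le_mul_of_nonneg_right (hK' x) (sq_nonneg (w x * f x))]
  calc c * ∫ x, f x ^ 2 ∂(vol h) ≤ c * ((|K| + 1) * ∫ x, (w * f) x ^ 2 ∂(vol g)) :=
        mul_le_mul_of_nonneg_left h2 hc.le
    _ = c * (∫ x, (w * f) x ^ 2 ∂(vol g)) * (|K| + 1) := by ring
    _ ≤ _ := mul_le_mul_of_nonneg_right h1 (by positivity)

/-- On smooth functions the form of a metric with positive Yamabe invariant is equivalent to the
squared `H¹`-norm. -/
theorem IsConformalFactor.exists_energy_le [T2Space M] (hn : 3 ≤ n) {g h : Metric n M}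
    {w : M → ℝ} (H : IsConformalFactor g h w) (hY : 0 < yamabeInvariant g) :
    ∃ K : ℝ, 0 < K ∧ ∀ f : M → ℝ, ContMDiff (𝓡 n) 𝓘(ℝ, ℝ) ∞ f →
      ∫ x, f x ^ 2 ∂(vol h) ≤ K * smoothForm h f f ∧ energy h f ≤ K * smoothForm h f f ∧
      smoothForm h f f ≤ K * (energy h f + ∫ x, f x ^ 2 ∂(vol h)) := by
  obtain ⟨c, hc, hcoer⟩ := H.exists_le_smoothForm hn hY
  have hR := continuous_scalarCurvature h
  obtain ⟨C, hC⟩ := isCompact_univ.exists_bound_of_continuousOn hR.continuousOn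
  have hC' : ∀ x, |scalarCurvature h x| ≤ |C| := fun x =>
    (hC x (Set.mem_univ x)).trans (le_abs_self C)
  set a : ℝ := 4 * (((n : ℝ) - 1) / ((n : ℝ) - 2)) with ha
  have ha0 : 0 < a := by
    have hn' : (3 : ℝ) ≤ n := by exact_mod_cast hn
    have h1 : 0 < (n : ℝ) - 1 := by linarith
    have h2 : 0 < (n : ℝ) - 2 := by linarith
    positivity
  -- The three summands are the constants of the three inequalities in turn; `c` is the coercivity
  -- constant and `|C|` bounds the scalar curvature.
  refine ⟨c⁻¹ + (1 + |C| * c⁻¹) * a⁻¹ + (a + |C|), by positivity, fun f hf => ?_⟩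
  set I := ∫ x, f x ^ 2 ∂(vol h) with hI
  set S := smoothForm h f f with hS
  have hI0 : 0 ≤ I := integral_nonneg fun x => sq_nonneg _
  have hE0 := energy_nonneg h f
  have h1 : c * I ≤ S := hcoer f hf
  have hS0 : 0 ≤ S := (mul_nonneg hc.le hI0).trans h1
  have hfc := hf.continuous
  have h2 : |∫ x, scalarCurvature h x * f x * f x ∂(vol h)| ≤ |C| * I := by
    rw [hI, ← integral_const_mul]
    have hc1 : Continuous fun x => scalarCurvature h x * f x * f x := (hR.mul hfc).mul hfc
    refine abs_integral_le_integral_abs.trans (integral_mono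
      (integrable_vol_of_continuous h hc1).abs
      (integrable_vol_of_continuous h (continuous_const.mul (hfc.pow 2))) fun x => ?_)
    beta_reduce
    rw [mul_assoc, abs_mul, ← sq, abs_sq]
    exact mul_le_mul_of_nonneg_right (hC' x) (sq_nonneg _)
  have h3 : S = a * energy h f + ∫ x, scalarCurvature h x * f x * f x ∂(vol h) := rfl
  obtain ⟨h4, h5⟩ := abs_le.1 h2
  have hIS : I ≤ c⁻¹ * S := by
    rw [inv_mul_eq_div, le_div_iff₀ hc]
    linarith
  have hC0 := abs_nonneg C
  have hci : 0 < c⁻¹ := inv_pos.2 hc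
  have hai : 0 < a⁻¹ := inv_pos.2 ha0
  have hES : energy h f ≤ (1 + |C| * c⁻¹) * a⁻¹ * S := by
    have h6 : a * energy h f ≤ (1 + |C| * c⁻¹) * S := by nlinarith
    calc energy h f = a⁻¹ * (a * energy h f) := by rw [inv_mul_cancel_left₀ ha0.ne']
      _ ≤ a⁻¹ * ((1 + |C| * c⁻¹) * S) := mul_le_mul_of_nonneg_left h6 hai.le
      _ = _ := by ring
  have k1 : 0 ≤ c⁻¹ * S := by positivity
  have k2 : 0 ≤ (1 + |C| * c⁻¹) * a⁻¹ * S := by positivity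
  have k3 : 0 ≤ (a + |C|) * S := by positivity
  refine ⟨by linarith, by linarith, ?_⟩
  have k4 : 0 ≤ (c⁻¹ + (1 + |C| * c⁻¹) * a⁻¹) * (energy h f + I) := by positivity
  have k5 : S ≤ (a + |C|) * (energy h f + I) := by nlinarith
  linarith

end Coercivity

/-! ### Minimizing a closed quadratic form over a closed convex set -/

section ClosedForm

variable {D L : Type*} [AddCommGroup D] [Module ℝ D] [NormedAddCommGroup L] [NormedSpace ℝ L]

/-- `f` is a Cauchy sequence for the quadratic form `B`. -/
def IsFormCauchy (B : D →ₗ[ℝ] D →ₗ[ℝ] ℝ) (f : ℕ → D) : Prop :=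
  ∀ ε : ℝ, 0 < ε → ∃ N, ∀ j, N ≤ j → ∀ k, N ≤ k → B (f j - f k) (f j - f k) < ε

/-- Let `B` be a nonnegative form on `D`, let `ι : D → L` be bounded with respect to `B`, and let
the quadratic form `Q` on the closure `S` of `D` in `L` be the extension of `B` by continuity. Then
`Q` has a unique minimizer in each closed convex set that meets `S`. -/
theorem exists_unique_minimizer [CompleteSpace L] (B : D →ₗ[ℝ] D →ₗ[ℝ] ℝ)
    (hsymm : ∀ f₁ f₂, B f₁ f₂ = B f₂ f₁) (hnn : ∀ f, 0 ≤ B f f) (ι : D →ₗ[ℝ] L) (C : ℝ)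
    (hι : ∀ f, ‖ι f‖ ^ 2 ≤ C * B f f) {S : Set L}
    (hS : ∀ u, u ∈ S ↔ ∃ f : ℕ → D, IsFormCauchy B f ∧ Tendsto (fun k => ι (f k)) atTop (𝓝 u))
    {Q : L → ℝ}
    (hQ : ∀ (u : L) (f : ℕ → D), IsFormCauchy B f → Tendsto (fun k => ι (f k)) atTop (𝓝 u) →
      Tendsto (fun k => B (f k) (f k)) atTop (𝓝 (Q u)))
    {K : Set L} (hKc : IsClosed K) (hKconv : Convex ℝ K) (hne : (K ∩ S).Nonempty) :
    ∃ v ∈ K ∩ S, ∀ v' ∈ K ∩ S, Q v ≤ Q v' ∧ (Q v' ≤ Q v → v' = v) := by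
  -- `B` may be degenerate, so `D` is only seminormed; its separated completion is the Hilbert space
  -- in which the minimization takes place.
  let c : PreInnerProductSpace.Core ℝ D :=
    { inner := fun f₁ f₂ => B f₁ f₂
      conj_inner_symm := fun f₁ f₂ => hsymm f₂ f₁
      re_inner_nonneg := fun f => hnn f
      add_left := fun f₁ f₂ f₃ => by simp
      smul_left := fun f₁ f₂ r => by simp }
  let _ : SeminormedAddCommGroup D := InnerProductSpace.Core.toSeminormedAddCommGroup (𝕜 := ℝ)
  let _ : InnerProductSpace ℝ D := InnerProductSpace.ofCore c
  have hnorm : ∀ f : D, ‖f‖ ^ 2 = B f f := fun f => (real_inner_self_eq_norm_sq f).symm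
  have hcauchy : ∀ f : ℕ → D, IsFormCauchy B f ↔ CauchySeq f := by
    intro f
    rw [Metric.cauchySeq_iff]
    constructor
    · intro h ε hε
      obtain ⟨N, hN⟩ := h (ε ^ 2) (by positivity)
      refine ⟨N, fun j hj k hk => ?_⟩
      rw [dist_eq_norm]
      refine lt_of_pow_lt_pow_left₀ 2 hε.le ?_
      rw [hnorm]
      exact hN j hj k hk
    · intro h ε hε
      obtain ⟨N, hN⟩ := h (√ε) (Real.sqrt_pos.2 hε)
      refine ⟨N, fun j hj k hk => ?_⟩
      have h1 := hN j hj k hk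
      rw [dist_eq_norm] at h1
      rw [← hnorm, ← Real.sq_sqrt hε.le]
      exact pow_lt_pow_left₀ h1 (norm_nonneg _) two_ne_zero
  have hbound : ∀ f, ‖ι f‖ ≤ √|C| * ‖f‖ := by
    intro f
    refine le_of_sq_le_sq ?_ (by positivity)
    rw [mul_pow, Real.sq_sqrt (abs_nonneg C), hnorm]
    exact (hι f).trans (mul_le_mul_of_nonneg_right (le_abs_self C) (hnn f))
  let ι' : D →L[ℝ] L := ι.mkContinuous (√|C|) hbound
  let e : D →L[ℝ] UniformSpace.Completion D := UniformSpace.Completion.toComplL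
  let J : UniformSpace.Completion D →L[ℝ] L := ι'.extend e
  have hJ : ∀ f : D, J (f : UniformSpace.Completion D) = ι f := fun f =>
    ContinuousLinearMap.extend_eq ι' UniformSpace.Completion.denseRange_coe
      (UniformSpace.Completion.isUniformInducing_coe D) f
  have hci : ∀ f : ℕ → D,
      CauchySeq (fun k => (f k : UniformSpace.Completion D)) ↔ CauchySeq f := by
    intro f
    rw [CauchySeq, CauchySeq, ← (UniformSpace.Completion.isUniformInducing_coe D).cauchy_map_iff,
      Filter.map_map]
    rfl
  -- With `hsurj` below: `J` maps the completion onto `S` and turns `Q` into the squared norm, so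
  -- minimizing `Q` on `K ∩ S` means finding a shortest vector of `J ⁻¹' K`.
  have hrange : ∀ x, J x ∈ S ∧ Q (J x) = ‖x‖ ^ 2 := by
    intro x
    obtain ⟨y, hy, hyx⟩ := mem_closure_iff_seq_limit.1
      (UniformSpace.Completion.denseRange_coe (α := D) x)
    choose f hf using hy
    have hfx : Tendsto (fun k => (f k : UniformSpace.Completion D)) atTop (𝓝 x) := by
      simpa only [hf] using hyx
    have hfc : IsFormCauchy B f := by
      rw [hcauchy, ← hci]
      exact hfx.cauchySeq
    have hfJ : Tendsto (fun k => ι (f k)) atTop (𝓝 (J x)) := by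
      simpa only [Function.comp_def, hJ] using (J.continuous.tendsto x).comp hfx
    refine ⟨(hS _).2 ⟨f, hfc, hfJ⟩, tendsto_nhds_unique (hQ _ f hfc hfJ) ?_⟩
    refine (hfx.norm.pow 2).congr fun k => ?_
    rw [UniformSpace.Completion.norm_coe, hnorm]
  have hsurj : ∀ u ∈ S, ∃ x, J x = u := by
    intro u hu
    obtain ⟨f, hfc, hfu⟩ := (hS u).1 hu
    have h1 : CauchySeq fun k => (f k : UniformSpace.Completion D) :=
      (hci f).2 ((hcauchy f).1 hfc)
    obtain ⟨x, hx⟩ := cauchySeq_tendsto_of_complete h1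
    refine ⟨x, tendsto_nhds_unique ?_ hfu⟩
    simpa only [Function.comp_def, hJ] using (J.continuous.tendsto x).comp hx
  have hK' : IsClosed (J ⁻¹' K) := hKc.preimage J.continuous
  have hconv' : Convex ℝ (J ⁻¹' K) := hKconv.linear_preimage J.toLinearMap
  have hne' : (J ⁻¹' K).Nonempty := by
    obtain ⟨u, huK, huS⟩ := hne
    obtain ⟨x, rfl⟩ := hsurj u huS
    exact ⟨x, huK⟩
  obtain ⟨v, hv, hmin⟩ := exists_norm_eq_iInf_of_complete_convex hne' hK'.isComplete hconv' 0
  have hineq := (norm_eq_iInf_iff_real_inner_le_zero hconv' hv).1 hmin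
  refine ⟨J v, ⟨hv, (hrange v).1⟩, fun v' hv' => ?_⟩
  obtain ⟨w, rfl⟩ := hsurj v' hv'.2
  have h1 := hineq w hv'.1
  -- The variational inequality `⟨v, w - v⟩ ≥ 0` at the shortest vector. This one estimate gives
  -- minimality and uniqueness.
  have h2 : ‖w - v‖ ^ 2 + ‖v‖ ^ 2 ≤ ‖w‖ ^ 2 := by
    rw [zero_sub, inner_neg_left, inner_sub_right, real_inner_self_eq_norm_sq,
      real_inner_comm] at h1
    rw [norm_sub_sq_real]
    linarith
  rw [(hrange v).2, (hrange w).2]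
  refine ⟨by nlinarith [sq_nonneg ‖w - v‖], fun h => ?_⟩
  have h3 : ‖w - v‖ ^ 2 = 0 := le_antisymm (by linarith) (sq_nonneg _)
  rw [sub_eq_zero.1 (norm_eq_zero.1 (pow_eq_zero_iff two_ne_zero |>.1 h3))]

end ClosedForm

/-! ### The obstacle problem -/

section Obstacle

theorem convex_Ici_Lp {α : Type*} [MeasurableSpace α] {μ : Measure α} (u : Lp ℝ 2 μ) :
    Convex ℝ (Set.Ici u) := by
  intro v₁ h₁ v₂ h₂ a b ha hb hab
  rw [Set.mem_Ici, ← Lp.coeFn_le] at *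
  filter_upwards [h₁, h₂, Lp.coeFn_add (a • v₁) (b • v₂), Lp.coeFn_smul a v₁,
    Lp.coeFn_smul b v₂] with x k₁ k₂ k₃ k₄ k₅
  rw [k₃, Pi.add_apply, k₄, k₅, Pi.smul_apply, Pi.smul_apply, smul_eq_mul, smul_eq_mul]
  calc u x = a * u x + b * u x := by rw [← add_mul, hab, one_mul]
    _ ≤ _ := add_le_add (mul_le_mul_of_nonneg_left k₁ ha) (mul_le_mul_of_nonneg_left k₂ hb)

variable {n : ℕ} {M : Type*} [TopologicalSpace M] [ChartedSpace (EuclideanSpace ℝ (Fin n)) M]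
  [IsManifold (𝓡 n) ∞ M]

theorem gradInner_add_left (g : Metric n M) {f₁ f₂ : M → ℝ}
    (hf₁ : ContMDiff (𝓡 n) 𝓘(ℝ, ℝ) ∞ f₁) (hf₂ : ContMDiff (𝓡 n) 𝓘(ℝ, ℝ) ∞ f₂) (f : M → ℝ)
    (x : M) : gradInner g (f₁ + f₂) f x = gradInner g f₁ f x + gradInner g f₂ f x := by
  simp only [gradInner_eq_mvfderiv]
  rw [mvfderiv_add (mdifferentiableAt_of_smooth hf₁ x) (mdifferentiableAt_of_smooth hf₂ x)]
  rfl

theorem gradInner_smul_left (g : Metric n M) {f₁ : M → ℝ}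
    (hf₁ : ContMDiff (𝓡 n) 𝓘(ℝ, ℝ) ∞ f₁) (c : ℝ) (f : M → ℝ) (x : M) :
    gradInner g (c • f₁) f x = c * gradInner g f₁ f x := by
  have h1 := gradInner_mul_left g (contMDiff_const (c := c)) hf₁ f x
  have h2 : gradInner g (fun _ => c) f x = 0 := by
    rw [gradInner_eq_mvfderiv, mvfderiv_const]
    rfl
  rw [h2, mul_zero, add_zero] at h1
  exact h1

variable [MeasurableSpace M]

theorem smoothForm_comm (g : Metric n M) (f₁ f₂ : M → ℝ) :
    smoothForm g f₁ f₂ = smoothForm g f₂ f₁ := by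
  have h1 : ∫ x, gradInner g f₁ f₂ x ∂(vol g) = ∫ x, gradInner g f₂ f₁ x ∂(vol g) :=
    integral_congr_ae (Eventually.of_forall fun x => gradInner_comm g f₁ f₂ x)
  have h2 : ∫ x, scalarCurvature g x * f₁ x * f₂ x ∂(vol g) =
      ∫ x, scalarCurvature g x * f₂ x * f₁ x ∂(vol g) :=
    integral_congr_ae (Eventually.of_forall fun x => mul_right_comm _ _ _)
  rw [smoothForm, smoothForm, h1, h2]

variable [BorelSpace M] [CompactSpace M]

theorem integrable_scalarCurvature_mul (g : Metric n M) {f₁ f₂ : M → ℝ} (hf₁ : Continuous f₁)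
    (hf₂ : Continuous f₂) :
    Integrable (fun x => scalarCurvature g x * f₁ x * f₂ x) (vol g) := by
  have h : Continuous fun x => scalarCurvature g x * f₁ x * f₂ x :=
    ((continuous_scalarCurvature g).mul hf₁).mul hf₂
  exact integrable_vol_of_continuous g h

theorem smoothForm_add_left (g : Metric n M) {f₁ f₂ f : M → ℝ}
    (hf₁ : ContMDiff (𝓡 n) 𝓘(ℝ, ℝ) ∞ f₁) (hf₂ : ContMDiff (𝓡 n) 𝓘(ℝ, ℝ) ∞ f₂)
    (hf : ContMDiff (𝓡 n) 𝓘(ℝ, ℝ) ∞ f) :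
    smoothForm g (f₁ + f₂) f = smoothForm g f₁ f + smoothForm g f₂ f := by
  have h1 : ∫ x, gradInner g (f₁ + f₂) f x ∂(vol g) =
      ∫ x, gradInner g f₁ f x ∂(vol g) + ∫ x, gradInner g f₂ f x ∂(vol g) := by
    rw [← integral_add (integrable_vol_of_continuous g (continuous_gradInner g hf₁ hf))
      (integrable_vol_of_continuous g (continuous_gradInner g hf₂ hf))]
    exact integral_congr_ae (Eventually.of_forall fun x => gradInner_add_left g hf₁ hf₂ f x)
  have h2 : ∫ x, scalarCurvature g x * (f₁ + f₂) x * f x ∂(vol g) =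
      ∫ x, scalarCurvature g x * f₁ x * f x ∂(vol g) +
        ∫ x, scalarCurvature g x * f₂ x * f x ∂(vol g) := by
    rw [← integral_add (integrable_scalarCurvature_mul g hf₁.continuous hf.continuous)
      (integrable_scalarCurvature_mul g hf₂.continuous hf.continuous)]
    refine integral_congr_ae (Eventually.of_forall fun x => ?_)
    simp only [Pi.add_apply]
    ring
  rw [smoothForm, h1, h2, smoothForm, smoothForm]
  ring

omit [BorelSpace M] [CompactSpace M] in
theorem smoothForm_smul_left (g : Metric n M) {f₁ : M → ℝ}
    (hf₁ : ContMDiff (𝓡 n) 𝓘(ℝ, ℝ) ∞ f₁) (c : ℝ) (f : M → ℝ) :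
    smoothForm g (c • f₁) f = c * smoothForm g f₁ f := by
  have h1 : ∫ x, gradInner g (c • f₁) f x ∂(vol g) = c * ∫ x, gradInner g f₁ f x ∂(vol g) := by
    rw [← integral_const_mul]
    exact integral_congr_ae (Eventually.of_forall fun x => gradInner_smul_left g hf₁ c f x)
  have h2 : ∫ x, scalarCurvature g x * (c • f₁) x * f x ∂(vol g) =
      c * ∫ x, scalarCurvature g x * f₁ x * f x ∂(vol g) := by
    rw [← integral_const_mul]
    refine integral_congr_ae (Eventually.of_forall fun x => ?_)
    simp only [Pi.smul_apply, smul_eq_mul]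
    ring
  rw [smoothForm, h1, h2, smoothForm]
  ring

/-- `smoothForm` as a bilinear form on the smooth functions. -/
def smoothBilin (g : Metric n M) :
    C^∞⟮𝓡 n, M; 𝓘(ℝ, ℝ), ℝ⟯ →ₗ[ℝ] C^∞⟮𝓡 n, M; 𝓘(ℝ, ℝ), ℝ⟯ →ₗ[ℝ] ℝ :=
  LinearMap.mk₂ ℝ (fun f₁ f₂ => smoothForm g f₁ f₂)
    (fun f₁ f₂ f => smoothForm_add_left g f₁.contMDiff f₂.contMDiff f.contMDiff)
    (fun c f₁ f => smoothForm_smul_left g f₁.contMDiff c f)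
    (fun f f₁ f₂ => by
      rw [smoothForm_comm, smoothForm_comm g f, smoothForm_comm g f]
      exact smoothForm_add_left g f₁.contMDiff f₂.contMDiff f.contMDiff)
    (fun c f f₁ => by
      rw [smoothForm_comm, smoothForm_comm g f]
      exact smoothForm_smul_left g f₁.contMDiff c f)

theorem smoothBilin_apply (g : Metric n M) (f₁ f₂ : C^∞⟮𝓡 n, M; 𝓘(ℝ, ℝ), ℝ⟯) :
    smoothBilin g f₁ f₂ = smoothForm g f₁ f₂ := rfl

theorem memLp_smooth (g : Metric n M) (f : C^∞⟮𝓡 n, M; 𝓘(ℝ, ℝ), ℝ⟯) : MemLp f 2 (vol g) :=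
  memLp_vol_of_continuous g f.contMDiff.continuous 2

/-- The inclusion of the smooth functions in `L²`. -/
def smoothToLp (g : Metric n M) : C^∞⟮𝓡 n, M; 𝓘(ℝ, ℝ), ℝ⟯ →ₗ[ℝ] Lp ℝ 2 (vol g) where
  toFun f := (memLp_smooth g f).toLp f
  map_add' f₁ f₂ := MemLp.toLp_add (memLp_smooth g f₁) (memLp_smooth g f₂)
  map_smul' c f := MemLp.toLp_const_smul c (memLp_smooth g f)

theorem norm_smoothToLp_sq (g : Metric n M) (f : C^∞⟮𝓡 n, M; 𝓘(ℝ, ℝ), ℝ⟯) :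
    ‖smoothToLp g f‖ ^ 2 = ∫ x, f x ^ 2 ∂(vol g) := by
  rw [integral_sq_eq_eLpNorm (memLp_smooth g f)]
  exact congrArg (· ^ 2) (Lp.norm_toLp _ (memLp_smooth g f))

theorem tendsto_smoothToLp_iff (g : Metric n M) (f : ℕ → C^∞⟮𝓡 n, M; 𝓘(ℝ, ℝ), ℝ⟯)
    (u : Lp ℝ 2 (vol g)) :
    Tendsto (fun k => smoothToLp g (f k)) atTop (𝓝 u) ↔
      Tendsto (fun k => eLpNorm (fun x => f k x - u x) 2 (vol g)) atTop (𝓝 0) := by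
  have h := Lp.tendsto_Lp_iff_tendsto_eLpNorm (fi := atTop) (fun k => smoothToLp g (f k)) u
    (Lp.memLp u)
  rw [Lp.toLp_coeFn] at h
  rw [h]
  refine tendsto_congr fun k => eLpNorm_congr_ae ?_
  filter_upwards [(memLp_smooth g (f k)).coeFn_toLp] with x hx
  exact congrArg (· - u x) hx

/-- For an equivalent form, form-Cauchy sequences that converge in `L²` are the approximating
sequences. -/
theorem isApprox_iff_isFormCauchy {g : Metric n M} {K : ℝ} (hK : 0 < K)
    (hequiv : ∀ f : M → ℝ, ContMDiff (𝓡 n) 𝓘(ℝ, ℝ) ∞ f →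
      ∫ x, f x ^ 2 ∂(vol g) ≤ K * smoothForm g f f ∧ energy g f ≤ K * smoothForm g f f ∧
      smoothForm g f f ≤ K * (energy g f + ∫ x, f x ^ 2 ∂(vol g)))
    (f : ℕ → C^∞⟮𝓡 n, M; 𝓘(ℝ, ℝ), ℝ⟯) (u : Lp ℝ 2 (vol g)) :
    IsApprox g (fun k => f k) u ↔ IsFormCauchy (smoothBilin g) f ∧
      Tendsto (fun k => smoothToLp g (f k)) atTop (𝓝 u) := by
  constructor
  · intro h
    have ht := (tendsto_smoothToLp_iff g f u).2 h.tendsto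
    refine ⟨fun ε hε => ?_, ht⟩
    have hδ : 0 < ε / (2 * K) := by positivity
    obtain ⟨N₁, h₁⟩ := h.cauchy _ hδ
    obtain ⟨N₂, h₂⟩ := Metric.cauchySeq_iff.1 ht.cauchySeq _ (Real.sqrt_pos.2 hδ)
    refine ⟨max N₁ N₂, fun j hj k hk => ?_⟩
    have k₁ := h₁ j (le_of_max_le_left hj) k (le_of_max_le_left hk)
    have k₂ := h₂ j (le_of_max_le_right hj) k (le_of_max_le_right hk)
    rw [dist_eq_norm, ← map_sub] at k₂
    have k₃ := pow_lt_pow_left₀ k₂ (norm_nonneg _) two_ne_zero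
    rw [Real.sq_sqrt hδ.le, norm_smoothToLp_sq] at k₃
    have k₄ := (hequiv _ (f j - f k).contMDiff).2.2
    rw [smoothBilin_apply]
    calc smoothForm g (f j - f k) (f j - f k)
        ≤ K * (energy g (f j - f k) + ∫ x, (f j - f k) x ^ 2 ∂(vol g)) := k₄
      _ < K * (ε / (2 * K) + ε / (2 * K)) := mul_lt_mul_of_pos_left (add_lt_add k₁ k₃) hK
      _ = ε := by field_simp; ring
  · rintro ⟨hc, ht⟩
    refine ⟨fun k => (f k).contMDiff, (tendsto_smoothToLp_iff g f u).1 ht, fun ε hε => ?_⟩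
    obtain ⟨N, hN⟩ := hc (ε / K) (by positivity)
    refine ⟨N, fun j hj k hk => ?_⟩
    have h1 := hN j hj k hk
    rw [smoothBilin_apply, lt_div_iff₀ hK] at h1
    have h2 := (hequiv _ (f j - f k).contMDiff).2.1
    exact h2.trans_lt (by linarith)

/-- The obstacle problem has a unique solution. -/
theorem IsConformalFactor.existsUnique_isObstacleSolution [T2Space M] (hn : 3 ≤ n)
    {g h : Metric n M} {w : M → ℝ} (H : IsConformalFactor g h w) (hY : 0 < yamabeInvariant g)
    (u : H1Plus h) : ∃! v, IsObstacleSolution h u v := by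
  obtain ⟨K, hK, hequiv⟩ := H.exists_energy_le hn hY
  have happ := isApprox_iff_isFormCauchy hK hequiv
  obtain ⟨v, ⟨hvu, hvS⟩, hv⟩ := exists_unique_minimizer (smoothBilin h)
    (fun f₁ f₂ => smoothForm_comm h f₁ f₂)
    (fun f => by
      have h1 := (hequiv f f.contMDiff).2.1
      exact nonneg_of_mul_nonneg_right ((energy_nonneg h f).trans h1) hK)
    (smoothToLp h) K
    (fun f => by
      rw [norm_smoothToLp_sq]
      exact (hequiv f f.contMDiff).1)
    (S := H1 h)
    (fun u => by
      constructor
      · rintro ⟨X, hX⟩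
        obtain ⟨f, hf, -⟩ := hX.exists_isApprox
        exact ⟨fun k => ⟨f k, hf.smooth k⟩, (happ (fun k => ⟨f k, hf.smooth k⟩) u).1 hf⟩
      · rintro ⟨f, hf⟩
        exact ((happ f u).2 hf).exists_isWeakGrad)
    (Q := fun u => form h u u)
    (fun u f hf hu => ((happ f u).2 ⟨hf, hu⟩).tendsto_smoothForm (Lp.memLp u))
    (K := Set.Ici u.1) isClosed_Ici (convex_Ici_Lp u.1) ⟨u.1, Set.self_mem_Ici, u.2.1⟩
  -- Positivity is not a closed condition in L² and was left out of the minimization; it comes from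
  -- `v ≥ u > 0`.
  have hvpos : v ∈ H1Plus h := by
    refine ⟨hvS, ?_⟩
    filter_upwards [(Lp.coeFn_le u.1 v).2 hvu, u.2.2] with x h1 h2 using h2.trans_le h1
  refine ⟨⟨v, hvpos⟩, ⟨hvu, fun v' hv' => (hv v'.1 ⟨hv', v'.2.1⟩).1⟩, fun v' hv' => ?_⟩
  exact Subtype.ext ((hv v'.1 ⟨hv'.1, v'.2.1⟩).2 (hv'.2 ⟨v, hvpos⟩ hvu))

end Obstacle

end YamabeObstacle

end

/-! ### The obstacle solution map -/

theorem proposition3p2 {n : ℕ} (hn : 3 ≤ n) {M : Type*} [TopologicalSpace M] [T2Space M]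
    [CompactSpace M] [ChartedSpace (EuclideanSpace ℝ (Fin n)) M] [IsManifold (𝓡 n) ∞ M]
    [MeasurableSpace M] [BorelSpace M] (g h : YamabeObstacle.Metric n M)
    (hY : 0 < YamabeObstacle.yamabeInvariant g) (hh : h ∈ YamabeObstacle.conformalClass g) :
    (∀ u v : YamabeObstacle.H1Plus h,
      YamabeObstacle.IsObstacleSolution h u v ↔ v = YamabeObstacle.stateMap h u) ∧
    YamabeObstacle.stateMap h ∘ YamabeObstacle.stateMap h = YamabeObstacle.stateMap h := by
  obtain ⟨w, hw, hpos, hinner⟩ := hh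
  have H : YamabeObstacle.IsConformalFactor g h w := ⟨hw, hpos, hinner⟩
  have hex := H.existsUnique_isObstacleSolution hn hY
  have hsol : ∀ u, YamabeObstacle.IsObstacleSolution h u (YamabeObstacle.stateMap h u) := by
    intro u
    rw [YamabeObstacle.stateMap, dif_pos (hex u).exists]
    exact (hex u).exists.choose_spec
  have hiff : ∀ u v : YamabeObstacle.H1Plus h,
      YamabeObstacle.IsObstacleSolution h u v ↔ v = YamabeObstacle.stateMap h u := fun u v =>
    ⟨fun hv => (hex u).unique hv (hsol u), fun hv => hv ▸ hsol u⟩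
  refine ⟨hiff, funext fun u => ?_⟩
  -- `T(u)` solves the obstacle problem for `T(u)`: what lies above `T(u)` lies above `u`, so
  -- minimality for the obstacle `u` suffices.
  refine ((hiff _ _).1 ⟨le_rfl, fun v' hv' => ?_⟩).symm
  exact (hsol u).2 v' ((hsol u).1.trans hv')
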